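/- Let $d\in\mathbb N$, $T>0$, $\varepsilon>0$, $u_{in}\in L^\infty(\mathbb{R}^d)$ and $f\in C^1(\mathbb{R};\mathbb{R}^d)$. Consider $$\partial_t m+\nabla\cdot f(m)=\tfrac{\varepsilon^2}{2}\Delta m\ \text{ in }\mathbb{R}^d\times(0,T),\qquad m|_{t=0}=u_{in}.$$ A weak solution is a function $m\in L^\infty(\mathbb{R}^d\times(0,T))$ such that $$\int_0^T\!\!\int_{\mathbb{R}^d} m\,\partial_t\varphi+f(m)\cdot\nabla\varphi+\tfrac{\varepsilon^2}{2}\,m\,\Delta\varphi\,dx\,dt+\int_{\mathbb{R}^d}u_{in}(x)\varphi(x,0)\,dx=0$$ for all $\varphi\in C_c^\infty(\mathbb{R}^d\times[0,T))$ (test functions are smooth up to $t=0$ and need not vanish there). Then there exists a weak solution $m$, and it is unique up to equality almost everywhere. It satisfies: (i) (maximum principle) $\|m\|_{L^\infty(\mathbb{R}^d\times(0,T))}\le\|u_{in}\|_{L^\infty(\mathbb{R}^d)}$, and also $\|m(\cdot,t)\|_{L^\infty(\mathbb{R}^d)}\le\|u_{in}\|_{L^\infty(\mathbb{R}^d)}$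 for a.e. $t\in(0,T)$; (ii) (Hölder regularity) $m\in L^q((0,T);C^{0,\beta}(\mathbb{R}^d))$ for all real $q\in[1,\infty)$ and all $\beta\in(0,\min(1,2/q))$. Here $C^{0,\beta}(\mathbb{R}^d)$ is the space of bounded functions $g$ with $\|g\|_{C^{0,\beta}}=\sup_x|g(x)|+\sup_{x\ne y}|g(x)-g(y)|/|x-y|^\beta<\infty$, and $L^q((0,T);C^{0,\beta}(\mathbb{R}^d))$ consists of the (classes of) strongly measurable $M:(0,T)\to C^{0,\beta}(\mathbb{R}^d)$ with finite norm $\bigl(\int_0^T\|M(t)\|_{C^{0,\beta}}^q\,dt\bigr)^{1/q}$ that lie in the closure of $C_c^\infty((0,T);C^{0,\beta}(\mathbb{R}^d))$ in this norm; membership of $m$ means that $m(\cdot,t)=M(t)$ a.e. in $\mathbb{R}^d$ for a.e. $t\in(0,T)$, for some such $M$. -/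

import Mathlib

open MeasureTheory Set
open scoped NNReal ENNReal ContDiff BoundedContinuousFunction

noncomputable section

namespace ViscousLaw

/-- Euclidean space `ℝ^d`. -/
abbrev Space (d : ℕ) : Type := EuclideanSpace ℝ (Fin d)

/-- Lebesgue measure on the time interval `(0, T)`. -/
def timeMeasure (T : ℝ) : Measure ℝ := volume.restrict (Ioo 0 T)

/-- Lebesgue measure on `ℝ^d × (0, T)`. -/
def spaceTimeMeasure (d : ℕ) (T : ℝ) : Measure (Space d × ℝ) :=
  (volume : Measure (Space d)).prod (timeMeasure T)

/-- Test functions `φ ∈ C_c^∞(ℝ^d × [0, T))`, that is, the restrictions to `ℝ^d × [0, T)` of smooth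
functions with compact support in `ℝ^d × (-∞, T)`; they need not vanish at time `0`. -/
structure IsTestFunction (d : ℕ) (T : ℝ) (φ : Space d × ℝ → ℝ) : Prop where
  smooth : ContDiff ℝ ∞ φ
  compact : HasCompactSupport φ
  support : tsupport φ ⊆ univ ×ˢ Iio T

/-- `m ∈ L^∞(ℝ^d × (0, T))` is a weak solution of `∂ₜ m + ∇ · f(m) = (ε² / 2) Δ m` on
`ℝ^d × (0, T)` with initial datum `uin`. -/
structure IsWeakSolution (d : ℕ) (T ε : ℝ) (f : ℝ → Space d) (uin : Space d → ℝ)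
    (m : Space d × ℝ → ℝ) : Prop where
  memLp : MemLp m ∞ (spaceTimeMeasure d T)
  weak : ∀ φ : Space d × ℝ → ℝ, IsTestFunction d T φ →
    (∫ p, (m p * deriv (fun s => φ (p.1, s)) p.2
        + inner ℝ (f (m p)) (gradient (fun y => φ (y, p.2)) p.1)
        + ε ^ 2 / 2 * m p * Laplacian.laplacian (fun y => φ (y, p.2)) p.1)
          ∂(spaceTimeMeasure d T))
      + ∫ x, uin x * φ (x, 0) = 0

/-- The Hölder space `C^{0,β}(ℝ^d)` of bounded `β`-Hölder continuous real functions on `ℝ^d`. -/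
@[ext]
structure Holder (d : ℕ) (β : ℝ≥0) where
  toBCF : Space d →ᵇ ℝ
  memHolder : MemHolder β toBCF

namespace Holder

variable {d : ℕ} {β : ℝ≥0}

instance : CoeFun (Holder d β) (fun _ => Space d → ℝ) := ⟨fun g => g.toBCF⟩

instance : Zero (Holder d β) := ⟨⟨0, memHolder_zero⟩⟩
instance : Add (Holder d β) := ⟨fun g h => ⟨g.toBCF + h.toBCF, g.memHolder.add h.memHolder⟩⟩
instance : SMul ℝ (Holder d β) := ⟨fun c g => ⟨c • g.toBCF, g.memHolder.smul⟩⟩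
instance : Neg (Holder d β) := ⟨fun g => ⟨-g.toBCF, by
  have h := g.memHolder.smul (c := (-1 : ℝ))
  have e : ((-g.toBCF : Space d →ᵇ ℝ) : Space d → ℝ) = (-1 : ℝ) • (g.toBCF : Space d → ℝ) := by
    ext x; simp
  rw [e]; exact h⟩⟩

instance : AddCommGroup (Holder d β) where
  add_assoc a b c := Holder.ext (add_assoc a.toBCF b.toBCF c.toBCF)
  zero_add a := Holder.ext (zero_add a.toBCF)
  add_zero a := Holder.ext (add_zero a.toBCF)
  add_comm a b := Holder.ext (add_comm a.toBCF b.toBCF)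
  neg_add_cancel a := Holder.ext (neg_add_cancel a.toBCF)
  nsmul := nsmulRec
  zsmul := zsmulRec

/-- The Hölder norm: the supremum norm plus the Hölder seminorm
`sup_{x ≠ y} |g x - g y| / |x - y| ^ β`. -/
instance : Norm (Holder d β) := ⟨fun g => ‖g.toBCF‖ + (nnHolderNorm β g.toBCF : ℝ)⟩

instance : Module ℝ (Holder d β) where
  one_smul a := Holder.ext (one_smul ℝ a.toBCF)
  mul_smul r s a := Holder.ext (mul_smul r s a.toBCF)
  smul_zero r := Holder.ext (smul_zero r)
  smul_add r a b := Holder.ext (smul_add r a.toBCF b.toBCF)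
  add_smul r s a := Holder.ext (add_smul r s a.toBCF)
  zero_smul a := Holder.ext (zero_smul ℝ a.toBCF)

theorem norm_def (g : Holder d β) : ‖g‖ = ‖g.toBCF‖ + (nnHolderNorm β g.toBCF : ℝ) := rfl

theorem core : NormedSpace.Core ℝ (Holder d β) where
  norm_nonneg g := by rw [norm_def]; positivity
  norm_smul c g := by
    have h1 : ‖(c • g).toBCF‖ = ‖c‖ * ‖g.toBCF‖ := norm_smul c g.toBCF
    have h2 : nnHolderNorm β (c • g).toBCF = ‖c‖₊ * nnHolderNorm β g.toBCF :=
      g.memHolder.nnHolderNorm_smul c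
    rw [norm_def, norm_def, h1, h2]
    push_cast
    ring
  norm_triangle g h := by
    have h1 : ‖(g + h).toBCF‖ ≤ ‖g.toBCF‖ + ‖h.toBCF‖ := norm_add_le g.toBCF h.toBCF
    have h2 : (nnHolderNorm β (g + h).toBCF : ℝ)
        ≤ nnHolderNorm β g.toBCF + nnHolderNorm β h.toBCF := by
      exact_mod_cast g.memHolder.nnHolderNorm_add_le h.memHolder
    rw [norm_def, norm_def, norm_def]
    linarith
  norm_eq_zero_iff g := by
    constructor
    · intro h
      rw [norm_def] at h
      have h1 : ‖g.toBCF‖ = 0 :=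
        le_antisymm (by linarith [(nnHolderNorm β g.toBCF).coe_nonneg]) (norm_nonneg _)
      exact Holder.ext (norm_eq_zero.1 h1)
    · rintro rfl
      have h1 : ‖(0 : Holder d β).toBCF‖ = 0 := norm_zero (E := Space d →ᵇ ℝ)
      have h2 : nnHolderNorm β (0 : Holder d β).toBCF = 0 := nnHolderNorm_zero (X := Space d) β
      rw [norm_def, h1, h2]
      simp

instance : NormedAddCommGroup (Holder d β) := NormedAddCommGroup.ofCore core
instance : NormedSpace ℝ (Holder d β) := NormedSpace.ofCore core

end Holder

/-- `m ∈ L^q((0, T); C^{0,β}(ℝ^d))`: for almost every `t ∈ (0, T)` the slice `m(·, t)` agrees almost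
everywhere with `M t ∈ C^{0,β}(ℝ^d)`, where `M` is strongly measurable with
`∫₀ᵀ ‖M t‖^q dt < ∞` and lies in the closure of `C_c^∞((0, T); C^{0,β}(ℝ^d))` in this norm. -/
def MemLqHolder (d : ℕ) (T q : ℝ) (β : ℝ≥0) (m : Space d × ℝ → ℝ) : Prop :=
  ∃ M : ℝ → Holder d β,
    (∀ᵐ t ∂(timeMeasure T), (fun x => m (x, t)) =ᵐ[volume] M t) ∧
    MemLp M (ENNReal.ofReal q) (timeMeasure T) ∧
    ∀ δ : ℝ, 0 < δ → ∃ g : ℝ → Holder d β,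
      ContDiff ℝ ∞ g ∧ HasCompactSupport g ∧ tsupport g ⊆ Ioo 0 T ∧
        eLpNorm (M - g) (ENNReal.ofReal q) (timeMeasure T) ≤ ENNReal.ofReal δ

end ViscousLaw

end

/-! Let `R` be the sup norm of the datum and truncate the argument of `f` to [-R, R]; the resulting
flux is bounded and Lipschitz. The equation is then solved in mild form: heat flow of the datum
minus the time integral of the divergence of the heat flow of `f (m s)`. The divergence costs a
factor (t - s)^(-1/2), which is integrable, so the Picard map halves distances in a sup norm
weighted by exp(-l t) for large `l` (`exists_mild_contraction`, `exists_mild_fixedPoint`,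
`exists_mild_stability`). Every heat operator is an average over a standard Gaussian vector:
rotation invariance of a Gaussian pair gives the semigroup laws (`heat_heat`, `heat_flux`,
`flux_heat`), and Gaussian integration by parts moves derivatives.

The bound |m| ≤ R, which removes the truncation, comes from a splitting scheme with time step τ. One
step averages a + w · (f(a) - f(R)) with w a small multiple of the Gaussian vector; subtracting the
constant f(R) is free because the mean is zero. If L|w| ≤ 1 this quantity is at most R, and the
remaining w contribute O(τ²) by the fourth moment (`abs_splitStep_le`). Over a bounded time the
excess adds up to O(τ). The scheme is the exact mild solution of a linear equation whose flux
differs from f of the scheme by O(τ^(1/4) s^(-1/4)) (`mild_schemeFlux`, `exists_residual_le`), so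
stability lets τ tend to 0 (`abs_mild_fixedPoint_le`).

Weak and mild solutions agree by duality. Averaging a test function along forward Brownian
displacements inverts the backward heat operator up to sign (`backward_heatOp`). Pairing a mild
solution with that operator gives the weak formulation (`integral_mild_mul_heatOp`). Conversely, a
bounded function orthogonal to the image of all test functions vanishes
(`ae_eq_zero_of_integral_heatOp`), so every weak solution is mild for its own flux, and stability
with zero defect gives uniqueness.

The `β`-Hölder seminorm of the mild solution at time `t` is O(t^(-β/2)), which lies in L^q exactly
when βq < 2. Continuity in time into the Hölder space, by interpolation with a higher Hölder
exponent, supplies strong measurability (`memLqHolder_of_bounds`). -/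

noncomputable section

namespace ViscousLaw

open ProbabilityTheory Filter Topology

variable {d : ℕ}

section

variable {W : Type*} [NormedAddCommGroup W] [NormedSpace ℝ W]

/-! ### The standard Gaussian measure -/

/-- The standard Gaussian measure on `ℝ^d`. -/
abbrev gauss (d : ℕ) : Measure (Space d) := stdGaussian (Space d)

/-- The density of the standard Gaussian measure. -/
def gaussDensity (x : Space d) : ℝ :=
  (∫ y : Space d, Real.exp (-(1 / 2) * ‖y‖ ^ 2))⁻¹ * Real.exp (-(1 / 2) * ‖x‖ ^ 2)

theorem integral_exp_neg_half_pos :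
    0 < ∫ y : Space d, Real.exp (-(1 / 2) * ‖y‖ ^ 2) := by
  rw [GaussianFourier.integral_rexp_neg_mul_sq_norm (by norm_num)]
  positivity

theorem gaussDensity_pos (x : Space d) : 0 < gaussDensity x :=
  mul_pos (inv_pos.2 integral_exp_neg_half_pos) (Real.exp_pos _)

theorem continuous_gaussDensity : Continuous (gaussDensity : Space d → ℝ) := by
  unfold gaussDensity; fun_prop

theorem integrable_exp_neg_half :
    Integrable (fun y : Space d => Real.exp (-(1 / 2) * ‖y‖ ^ 2)) :=
  .of_integral_ne_zero integral_exp_neg_half_pos.ne'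

theorem integrable_gaussDensity : Integrable (gaussDensity : Space d → ℝ) :=
  integrable_exp_neg_half.const_mul _

theorem integral_gaussDensity : ∫ x : Space d, gaussDensity x = 1 := by
  unfold gaussDensity
  rw [integral_const_mul]
  exact inv_mul_cancel₀ integral_exp_neg_half_pos.ne'

/-- Both are finite measures with the same Fourier transform. The explicit density is needed to
compare translates and to integrate by parts. -/
theorem gauss_eq_withDensity :
    gauss d = (volume : Measure (Space d)).withDensity fun x => ENNReal.ofReal (gaussDensity x) := by
  have hfin : IsFiniteMeasure
      ((volume : Measure (Space d)).withDensity fun x => ENNReal.ofReal (gaussDensity x)) :=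
    isFiniteMeasure_withDensity_ofReal integrable_gaussDensity.2
  refine Measure.ext_of_charFun ?_
  ext t
  rw [charFun_stdGaussian, charFun_apply,
    integral_withDensity_eq_integral_toReal_smul
      (continuous_gaussDensity.measurable.ennreal_ofReal) (by simp)]
  have h1 := GaussianFourier.integral_cexp_neg_mul_sq_norm_add (V := Space d) (b := (1 / 2 : ℂ))
    (by norm_num) Complex.I t
  have h2 := GaussianFourier.integral_cexp_neg_mul_sq_norm (V := Space d) (b := (1 / 2 : ℂ))
    (by norm_num)
  rw [← h2] at h1
  have h3 : ((∫ y : Space d, Real.exp (-(1 / 2) * ‖y‖ ^ 2) : ℝ) : ℂ)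
      = ∫ y : Space d, Complex.exp (-(1 / 2) * ‖y‖ ^ 2) := by
    rw [← integral_complex_ofReal]
    congr with y
    push_cast
    rfl
  have h4 : ((∫ y : Space d, Real.exp (-(1 / 2) * ‖y‖ ^ 2) : ℝ) : ℂ) ≠ 0 := by
    exact_mod_cast integral_exp_neg_half_pos.ne'
  have h5 : ∀ x : Space d, (ENNReal.ofReal (gaussDensity x)).toReal •
      Complex.exp (inner ℝ x t * Complex.I)
      = ((∫ y : Space d, Real.exp (-(1 / 2) * ‖y‖ ^ 2) : ℝ) : ℂ)⁻¹ *
        Complex.exp (-(1 / 2) * ‖x‖ ^ 2 + Complex.I * inner ℝ t x) := by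
    intro x
    rw [ENNReal.toReal_ofReal (gaussDensity_pos x).le, gaussDensity, Complex.real_smul,
      Complex.exp_add, real_inner_comm, mul_comm Complex.I]
    push_cast
    ring
  simp_rw [h5]
  rw [integral_const_mul, h1, ← h3, ← mul_assoc, inv_mul_cancel₀ h4, one_mul]
  congr 1
  rw [Complex.I_sq]
  ring

theorem gauss_absolutelyContinuous : gauss d ≪ (volume : Measure (Space d)) := by
  rw [gauss_eq_withDensity]
  exact withDensity_absolutelyContinuous _ _

theorem integral_gauss_eq (g : Space d → W) :
    ∫ x, g x ∂(gauss d) = ∫ x, gaussDensity x • g x := by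
  rw [gauss_eq_withDensity, integral_withDensity_eq_integral_toReal_smul
      (continuous_gaussDensity.measurable.ennreal_ofReal) (by simp)]
  congr with x
  rw [ENNReal.toReal_ofReal (gaussDensity_pos x).le]

theorem integrable_gauss_iff (g : Space d → W) :
    Integrable g (gauss d) ↔ Integrable (fun x => gaussDensity x • g x) := by
  rw [gauss_eq_withDensity, integrable_withDensity_iff_integrable_smul'
      (continuous_gaussDensity.measurable.ennreal_ofReal) (by simp)]
  refine integrable_congr (.of_forall fun x => ?_)
  simp only
  rw [ENNReal.toReal_ofReal (gaussDensity_pos x).le]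

theorem integrable_norm_pow_gauss (k : ℕ) :
    Integrable (fun x : Space d => ‖x‖ ^ k) (gauss d) :=
  (IsGaussian.memLp_id (gauss d) k (by simp)).integrable_norm_pow'

/-- The first absolute moment of the standard Gaussian measure. -/
def gaussMoment (d : ℕ) : ℝ := ∫ x : Space d, ‖x‖ ∂(gauss d)

theorem gaussMoment_nonneg : 0 ≤ gaussMoment d := integral_nonneg fun _ => norm_nonneg _

theorem integrable_norm_gauss : Integrable (fun x : Space d => ‖x‖) (gauss d) := by
  simpa using integrable_norm_pow_gauss (d := d) 1

theorem integral_inner_gauss (c : Space d) : ∫ x : Space d, inner ℝ x c ∂(gauss d) = 0 := by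
  simpa [real_inner_comm] using integral_strongDual_stdGaussian (E := Space d) (innerSL ℝ c)

/-- A pair of independent standard Gaussian vectors is invariant in law under rotation. All the
semigroup identities below come from this. -/
theorem integral_rotation_gauss {c s : ℝ} (hcs : c ^ 2 + s ^ 2 = 1)
    {K : Space d × Space d → W} (hK : StronglyMeasurable K) :
    ∫ p, K (c • p.1 + s • p.2, -s • p.1 + c • p.2) ∂((gauss d).prod (gauss d))
      = ∫ p, K p ∂((gauss d).prod (gauss d)) := by
  -- The angle is the argument of the unit complex number c + is.
  obtain ⟨θ, hc, hs⟩ : ∃ θ : ℝ, c = Real.cos θ ∧ s = Real.sin θ := by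
    let z : ℂ := ⟨c, s⟩
    have hz : ‖z‖ = 1 := by
      rw [← sq_eq_sq₀ (norm_nonneg _) zero_le_one, Complex.sq_norm, Complex.normSq_apply]
      simp only [z]; linarith
    refine ⟨z.arg, ?_, ?_⟩
    · have := Complex.norm_mul_cos_arg z; rw [hz, one_mul] at this; rw [this]
    · have := Complex.norm_mul_sin_arg z; rw [hz, one_mul] at this; rw [this]
  have h := IsGaussian.map_rotation_eq_self (μ := gauss d) (by simp) θ
  conv_rhs => rw [← h]
  rw [integral_map (by fun_prop) hK.aestronglyMeasurable]
  simp only [ContinuousLinearMap.rotation_apply, ← hc, ← hs]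

/-- For a positive time lag the heat kernel charges no Lebesgue null set, so changing a flux on a
null set does not change its heat flow. -/
theorem quasiMeasurePreserving_sub_smul {c : ℝ} (hc : c ≠ 0) (x : Space d) :
    Measure.QuasiMeasurePreserving (fun ζ : Space d => x - c • ζ) (gauss d) volume := by
  have h1 : Measure.QuasiMeasurePreserving (fun ζ : Space d => x - c • ζ) volume volume := by
    have h2 : Measure.QuasiMeasurePreserving (fun ζ : Space d => c • ζ) volume volume := by
      refine ⟨by fun_prop, ?_⟩
      rw [Measure.map_addHaar_smul _ hc]
      exact Measure.smul_absolutelyContinuous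
    exact (Measure.measurePreserving_sub_left volume x).quasiMeasurePreserving.comp h2
  exact h1.mono_left gauss_absolutelyContinuous

/-! ### Translates of the Gaussian measure -/

theorem abs_exp_neg_sub_exp_neg_le (s t : ℝ) :
    |Real.exp (-s) - Real.exp (-t)| ≤ |s - t| * (Real.exp (-s) + Real.exp (-t)) := by
  wlog h : s ≤ t generalizing s t
  · have := this t s (by linarith)
    rwa [abs_sub_comm, abs_sub_comm s, add_comm (Real.exp (-s))]
  have h1 : Real.exp (-t) ≤ Real.exp (-s) := Real.exp_le_exp.2 (by linarith)
  rw [abs_of_nonneg (by linarith), abs_of_nonpos (by linarith)]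
  have h2 : Real.exp (-t) = Real.exp (-s) * Real.exp (s - t) := by
    rw [← Real.exp_add]; ring_nf
  have h3 := Real.add_one_le_exp (s - t)
  have h4 := Real.exp_pos (-s)
  have h5 := Real.exp_pos (-t)
  nlinarith [mul_le_mul_of_nonneg_left h3 h4.le, mul_nonneg (sub_nonneg.2 h) h5.le]

/-- The densities at both points stay on the right so that, after integration, each term is a mass
or a first moment of a translated Gaussian. -/
theorem abs_gaussDensity_sub_le (a b : Space d) :
    |gaussDensity a - gaussDensity b|
      ≤ ‖a - b‖ * ((‖a‖ + ‖a - b‖ / 2) * gaussDensity a + (‖b‖ + ‖a - b‖ / 2) * gaussDensity b) := by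
  unfold gaussDensity
  set c := (∫ y : Space d, Real.exp (-(1 / 2) * ‖y‖ ^ 2))⁻¹ with hc
  have hc0 : 0 < c := inv_pos.2 integral_exp_neg_half_pos
  have h1 := abs_exp_neg_sub_exp_neg_le (1 / 2 * ‖a‖ ^ 2) (1 / 2 * ‖b‖ ^ 2)
  simp only [← neg_mul] at h1
  set A := Real.exp (-(1 / 2) * ‖a‖ ^ 2) with hA
  set B := Real.exp (-(1 / 2) * ‖b‖ ^ 2) with hB
  have hA0 : 0 < A := Real.exp_pos _
  have hB0 : 0 < B := Real.exp_pos _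
  have h2 : |1 / 2 * ‖a‖ ^ 2 - 1 / 2 * ‖b‖ ^ 2| ≤ ‖a - b‖ * ((‖a‖ + ‖b‖) / 2) := by
    have : 1 / 2 * ‖a‖ ^ 2 - 1 / 2 * ‖b‖ ^ 2 = (‖a‖ - ‖b‖) * ((‖a‖ + ‖b‖) / 2) := by ring
    rw [this, abs_mul, abs_of_nonneg (by positivity : 0 ≤ (‖a‖ + ‖b‖) / 2)]
    gcongr
    exact abs_norm_sub_norm_le a b
  have h3 : ‖b‖ ≤ ‖a‖ + ‖a - b‖ := by
    rw [norm_sub_rev]; exact norm_le_norm_add_norm_sub' b a |>.trans (by linarith)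
  have h4 : ‖a‖ ≤ ‖b‖ + ‖a - b‖ := norm_le_norm_add_norm_sub' a b |>.trans (by linarith)
  rw [← mul_sub, abs_mul, abs_of_pos hc0]
  have h5 : |A - B| ≤ ‖a - b‖ * ((‖a‖ + ‖a - b‖ / 2) * A + (‖b‖ + ‖a - b‖ / 2) * B) := by
    refine h1.trans ((mul_le_mul_of_nonneg_right h2 (by positivity)).trans ?_)
    rw [mul_assoc]
    refine mul_le_mul_of_nonneg_left ?_ (norm_nonneg _)
    nlinarith
  calc c * |A - B| ≤ c * (‖a - b‖ * ((‖a‖ + ‖a - b‖ / 2) * A + (‖b‖ + ‖a - b‖ / 2) * B)) := by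
        gcongr
    _ = _ := by ring

/-- The constant in the estimate of the total variation between translates of the standard
Gaussian measure. -/
def shiftConst (d : ℕ) : ℝ := 2 * gaussMoment d + 2

theorem shiftConst_pos : 0 < shiftConst d := by
  have := gaussMoment_nonneg (d := d)
  unfold shiftConst; linarith

theorem integrable_of_bounded_gauss {V : Type*} [NormedAddCommGroup V] {g : Space d → V}
    (hg : StronglyMeasurable g) {A : ℝ}
    (hA : ∀ x, ‖g x‖ ≤ A) : Integrable g (gauss d) :=
  .of_bound hg.aestronglyMeasurable A (.of_forall hA)

/-- For |v| ≤ 1 the pointwise estimate is integrated; for |v| > 1 the total variation is at most 2,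
which the summand 2 in `shiftConst` covers. -/
theorem integral_gaussDensity_sub_le (v : Space d) :
    ∫ z : Space d, |gaussDensity (z - v) - gaussDensity z| ≤ shiftConst d * ‖v‖ := by
  have hi := integrable_gaussDensity (d := d)
  have hiv : Integrable fun z : Space d => gaussDensity (z - v) := hi.comp_sub_right v
  have h1 : ∫ z : Space d, gaussDensity (z - v) = 1 := by
    rw [integral_sub_right_eq_self (fun z : Space d => gaussDensity z) v, integral_gaussDensity]
  rcases le_or_gt ‖v‖ 1 with hv | hv
  · have hm : Integrable fun z : Space d => ‖z‖ * gaussDensity z := by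
      simpa [mul_comm] using (integrable_gauss_iff _).1 (integrable_norm_gauss (d := d))
    have hmv : Integrable fun z : Space d => ‖z - v‖ * gaussDensity (z - v) := hm.comp_sub_right v
    have e1 : ∫ z : Space d, ‖z‖ * gaussDensity z = gaussMoment d := by
      rw [gaussMoment, integral_gauss_eq]; simp [mul_comm]
    have e2 : ∫ z : Space d, ‖z - v‖ * gaussDensity (z - v) = gaussMoment d := by
      rw [integral_sub_right_eq_self (fun z : Space d => ‖z‖ * gaussDensity z) v, e1]
    calc ∫ z : Space d, |gaussDensity (z - v) - gaussDensity z|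
        ≤ ∫ z : Space d, ‖v‖ * ((‖z - v‖ * gaussDensity (z - v) + 1 / 2 * gaussDensity (z - v))
            + (‖z‖ * gaussDensity z + 1 / 2 * gaussDensity z)) := by
          refine integral_mono (hiv.sub hi).abs
            (((hmv.add (hiv.const_mul _)).add (hm.add (hi.const_mul _))).const_mul _) fun z => ?_
          refine (abs_gaussDensity_sub_le _ _).trans ?_
          have e : ‖z - v - z‖ = ‖v‖ := by rw [sub_sub_cancel_left, norm_neg]
          simp only [e]
          have := gaussDensity_pos z
          have := gaussDensity_pos (z - v)
          gcongr <;> nlinarith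
      _ = ‖v‖ * ((gaussMoment d + 1 / 2) + (gaussMoment d + 1 / 2)) := by
          rw [integral_const_mul, integral_add (f := fun z : Space d => ‖z - v‖ *
            gaussDensity (z - v) + 1 / 2 * gaussDensity (z - v))
            (g := fun z : Space d => ‖z‖ * gaussDensity z + 1 / 2 * gaussDensity z)
            (hmv.add (hiv.const_mul _)) (hm.add (hi.const_mul _)), integral_add hmv (hiv.const_mul _),
            integral_add hm (hi.const_mul _), integral_const_mul, integral_const_mul, e1, e2, h1,
            integral_gaussDensity, mul_one]
      _ ≤ _ := by
          unfold shiftConst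
          nlinarith [norm_nonneg v]
  · calc ∫ z : Space d, |gaussDensity (z - v) - gaussDensity z|
        ≤ ∫ z : Space d, (gaussDensity (z - v) + gaussDensity z) := by
          refine integral_mono (hiv.sub hi).abs (hiv.add hi) fun z => ?_
          have := gaussDensity_pos z
          have := gaussDensity_pos (z - v)
          simp only
          rw [abs_le]; constructor <;> linarith
      _ = 2 := by rw [integral_add hiv hi, h1, integral_gaussDensity]; norm_num
      _ ≤ _ := by
          have := gaussMoment_nonneg (d := d)
          unfold shiftConst
          nlinarith

theorem norm_integral_gauss_shift_sub_le {g : Space d → W} (hg : StronglyMeasurable g) {A : ℝ}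
    (hA : ∀ x, ‖g x‖ ≤ A) (v : Space d) :
    ‖∫ ζ, g (ζ + v) ∂(gauss d) - ∫ ζ, g ζ ∂(gauss d)‖ ≤ A * (shiftConst d * ‖v‖) := by
  have hA0 : 0 ≤ A := (norm_nonneg _).trans (hA 0)
  have hi := integrable_gaussDensity (d := d)
  have hiv : Integrable fun z : Space d => gaussDensity (z - v) := hi.comp_sub_right v
  have e1 : ∫ ζ, g (ζ + v) ∂(gauss d) = ∫ z : Space d, gaussDensity (z - v) • g z := by
    rw [integral_gauss_eq, ← integral_sub_right_eq_self _ v]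
    simp
  have i1 : Integrable fun z : Space d => gaussDensity (z - v) • g z :=
    hiv.smul_bdd A hg.aestronglyMeasurable (.of_forall hA)
  have i2 : Integrable fun z : Space d => gaussDensity z • g z :=
    hi.smul_bdd A hg.aestronglyMeasurable (.of_forall hA)
  rw [e1, integral_gauss_eq, ← integral_sub i1 i2]
  calc _ ≤ ∫ z : Space d, A * |gaussDensity (z - v) - gaussDensity z| := by
        refine norm_integral_le_of_norm_le ((hiv.sub hi).abs.const_mul _) (.of_forall fun z => ?_)
        rw [← sub_smul, norm_smul, Real.norm_eq_abs, mul_comm]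
        exact mul_le_mul_of_nonneg_right (hA z) (abs_nonneg _)
    _ ≤ _ := by
        rw [integral_const_mul]
        exact mul_le_mul_of_nonneg_left (integral_gaussDensity_sub_le v) hA0

/-! ### Gaussian integration by parts -/

theorem hasFDerivAt_gaussDensity (x : Space d) :
    HasFDerivAt (gaussDensity : Space d → ℝ) (-(gaussDensity x) • innerSL ℝ x) x := by
  have h := ((hasStrictFDerivAt_norm_sq x).hasFDerivAt.const_mul (-(1 / 2) : ℝ)).exp.const_mul
    ((∫ y : Space d, Real.exp (-(1 / 2) * ‖y‖ ^ 2))⁻¹)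
  refine h.congr_fderiv ?_
  ext y
  simp [gaussDensity]
  ring

/-- The density ρ satisfies ∇ρ(x) = -x ρ(x), so a factor ζ under the Gaussian average is traded for
a derivative. -/
theorem integral_inner_mul_gauss {g : Space d → ℝ} (hg : ContDiff ℝ 1 g)
    {A B : ℝ} (hA : ∀ x, |g x| ≤ A) (v : Space d) (hB : ∀ x, |fderiv ℝ g x v| ≤ B) :
    ∫ ζ, inner ℝ ζ v * g ζ ∂(gauss d) = ∫ ζ, fderiv ℝ g ζ v ∂(gauss d) := by
  have hi := integrable_gaussDensity (d := d)
  have hgc : Continuous fun x => fderiv ℝ g x v :=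
    (hg.continuous_fderiv one_ne_zero).clm_apply continuous_const
  have hm : Integrable fun z : Space d => gaussDensity z * inner ℝ z v := by
    refine ((((integrable_gauss_iff _).1 (integrable_norm_gauss (d := d))).mul_const
      ‖v‖)).mono' (continuous_gaussDensity.mul (by fun_prop)).aestronglyMeasurable
      (.of_forall fun z => ?_)
    rw [norm_mul, Real.norm_of_nonneg (gaussDensity_pos z).le, smul_eq_mul, mul_assoc]
    exact mul_le_mul_of_nonneg_left (norm_inner_le_norm z v) (gaussDensity_pos z).le
  have i1 : Integrable fun z : Space d => gaussDensity z * inner ℝ z v * g z :=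
    hm.mul_bdd (c := A) hg.continuous.aestronglyMeasurable (.of_forall hA)
  have e := integral_mul_fderiv_eq_neg_fderiv_mul_of_integrable (μ := (volume : Measure (Space d)))
    (f := gaussDensity) (g := g) (v := v) ?_ ?_ ?_
    (fun x _ => (hasFDerivAt_gaussDensity x).differentiableAt)
    (fun x _ => hg.differentiable one_ne_zero x)
  · rw [integral_gauss_eq, integral_gauss_eq]
    simp only [smul_eq_mul]
    rw [e, ← integral_neg]
    congr with z
    rw [(hasFDerivAt_gaussDensity z).fderiv]
    simp
    ring
  · refine i1.neg.congr (.of_forall fun z => ?_)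
    simp only [Pi.neg_apply]
    rw [(hasFDerivAt_gaussDensity z).fderiv]
    simp
  · exact hi.mul_bdd (c := B) hgc.aestronglyMeasurable (.of_forall hB)
  · exact hi.mul_bdd (c := A) hg.continuous.aestronglyMeasurable (.of_forall hA)

/-! ### The heat semigroup and its divergence -/

/-- The heat semigroup of `(ε² / 2) Δ`. -/
def heat (ε t : ℝ) (g : Space d → W) (x : Space d) : W :=
  ∫ ζ, g (x - (ε * √t) • ζ) ∂(gauss d)

/-- Minus the divergence of the heat semigroup of `(ε² / 2) Δ` applied to a vector field. -/
def flux (ε r : ℝ) (G : Space d → Space d) (x : Space d) : ℝ :=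
  ∫ ζ, (ε * √r)⁻¹ * inner ℝ ζ (G (x - (ε * √r) • ζ)) ∂(gauss d)

theorem heat_zero (ε : ℝ) [CompleteSpace W] (g : Space d → W) (x : Space d) :
    heat ε 0 g x = g x := by
  simp [heat]

theorem norm_heat_le (ε t : ℝ) {g : Space d → W} {A : ℝ} (hA : ∀ x, ‖g x‖ ≤ A) (x : Space d) :
    ‖heat ε t g x‖ ≤ A := by
  have := norm_integral_le_of_norm_le_const (μ := gauss d) (f := fun ζ => g (x - (ε * √t) • ζ))
    (.of_forall fun ζ => hA _)
  simpa [heat] using this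

theorem stronglyMeasurable_heat_param {α : Type*} [MeasurableSpace α] (ε : ℝ)
    {K : α × Space d → W} (hK : StronglyMeasurable K) {τ : α → ℝ} (hτ : Measurable τ)
    {x : α → Space d} (hx : Measurable x) :
    StronglyMeasurable fun a => heat ε (τ a) (fun y => K (a, y)) (x a) := by
  unfold heat
  refine StronglyMeasurable.integral_prod_right'
    (f := fun q : α × Space d => K (q.1, x q.1 - (ε * √(τ q.1)) • q.2)) ?_
  exact hK.comp_measurable (by fun_prop)

theorem stronglyMeasurable_flux_param {α : Type*} [MeasurableSpace α] (ε : ℝ)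
    {K : α × Space d → Space d} (hK : StronglyMeasurable K) {τ : α → ℝ} (hτ : Measurable τ)
    {x : α → Space d} (hx : Measurable x) :
    StronglyMeasurable fun a => flux ε (τ a) (fun y => K (a, y)) (x a) := by
  unfold flux
  refine StronglyMeasurable.integral_prod_right' (f := fun q : α × Space d =>
    (ε * √(τ q.1))⁻¹ * inner ℝ q.2 (K (q.1, x q.1 - (ε * √(τ q.1)) • q.2))) ?_
  have h : StronglyMeasurable fun q : α × Space d =>
      K (q.1, x q.1 - (ε * √(τ q.1)) • q.2) := hK.comp_measurable (by fun_prop)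
  have h2 : Measurable fun q : α × Space d => (ε * √(τ q.1))⁻¹ := by fun_prop
  exact h2.stronglyMeasurable.mul (measurable_snd.stronglyMeasurable.inner h)

theorem stronglyMeasurable_heat (ε t : ℝ) {g : Space d → W} (hg : StronglyMeasurable g) :
    StronglyMeasurable (heat ε t g) :=
  stronglyMeasurable_heat_param (α := Space d) ε (K := fun q => g q.2)
    (hg.comp_measurable measurable_snd) measurable_const measurable_id

theorem stronglyMeasurable_flux (ε t : ℝ) {G : Space d → Space d} (hG : StronglyMeasurable G) :
    StronglyMeasurable (flux ε t G) :=
  stronglyMeasurable_flux_param (α := Space d) ε (K := fun q => G q.2)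
    (hG.comp_measurable measurable_snd) measurable_const measurable_id

theorem stronglyMeasurable_comp_sub_smul {V : Type*} [TopologicalSpace V] {g : Space d → V}
    (hg : StronglyMeasurable g) (c : ℝ) (x : Space d) :
    StronglyMeasurable fun ζ => g (x - c • ζ) :=
  hg.comp_measurable (by fun_prop)

theorem integrable_inner_gauss {G : Space d → Space d} (hG : StronglyMeasurable G) {A : ℝ}
    (hA : ∀ x, ‖G x‖ ≤ A) : Integrable (fun ζ => inner ℝ ζ (G ζ)) (gauss d) := by
  refine (integrable_norm_gauss.mul_const A).mono'
    (measurable_id.stronglyMeasurable.inner hG).aestronglyMeasurable (.of_forall fun ζ => ?_)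
  exact (norm_inner_le_norm _ _).trans (mul_le_mul_of_nonneg_left (hA _) (norm_nonneg _))

/-- The singularity is only r^(-1/2), integrable at 0; the whole mild theory rests on this. -/
theorem abs_flux_le {ε : ℝ} (hε : 0 < ε) (r : ℝ) {G : Space d → Space d} {A : ℝ}
    (hA : ∀ x, ‖G x‖ ≤ A) (x : Space d) :
    |flux ε r G x| ≤ gaussMoment d / ε * (√r)⁻¹ * A := by
  have h := norm_integral_le_of_norm_le (μ := gauss d)
    (f := fun ζ => (ε * √r)⁻¹ * inner ℝ ζ (G (x - (ε * √r) • ζ)))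
    (g := fun ζ => ((ε * √r)⁻¹ * A) * ‖ζ‖) (integrable_norm_gauss.const_mul _)
    (.of_forall fun ζ => by
      have h0 : 0 ≤ (ε * √r)⁻¹ := by positivity
      rw [norm_mul, Real.norm_of_nonneg h0, mul_assoc]
      refine mul_le_mul_of_nonneg_left ((norm_inner_le_norm _ _).trans ?_) h0
      rw [mul_comm]
      exact mul_le_mul_of_nonneg_right (hA _) (norm_nonneg _))
  refine h.trans (le_of_eq ?_)
  rw [integral_const_mul, gaussMoment, mul_inv]
  ring

theorem heat_add (ε t : ℝ) {g h : Space d → W} (hg : StronglyMeasurable g)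
    (hh : StronglyMeasurable h) {A B : ℝ} (hA : ∀ x, ‖g x‖ ≤ A) (hB : ∀ x, ‖h x‖ ≤ B)
    (x : Space d) : heat ε t (fun y => g y + h y) x = heat ε t g x + heat ε t h x :=
  integral_add (integrable_of_bounded_gauss (stronglyMeasurable_comp_sub_smul hg _ _)
      fun _ => hA _)
    (integrable_of_bounded_gauss (stronglyMeasurable_comp_sub_smul hh _ _) fun _ => hB _)

theorem flux_sub (ε r : ℝ) {G H : Space d → Space d} (hG : StronglyMeasurable G)
    (hH : StronglyMeasurable H) {A B : ℝ} (hA : ∀ x, ‖G x‖ ≤ A) (hB : ∀ x, ‖H x‖ ≤ B)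
    (x : Space d) : flux ε r (fun y => G y - H y) x = flux ε r G x - flux ε r H x := by
  unfold flux
  simp only [inner_sub_right, mul_sub]
  exact integral_sub
    ((integrable_inner_gauss (stronglyMeasurable_comp_sub_smul hG _ _) fun _ => hA _).const_mul _)
    ((integrable_inner_gauss (stronglyMeasurable_comp_sub_smul hH _ _) fun _ => hB _).const_mul _)

/-! ### Semigroup identities -/

theorem sqrt_rotation {a b : ℝ} (ha : 0 ≤ a) (hb : 0 ≤ b) (hab : 0 < a + b) :
    (√a / √(a + b)) ^ 2 + (√b / √(a + b)) ^ 2 = 1 := by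
  rw [div_pow, div_pow, Real.sq_sqrt ha, Real.sq_sqrt hb, Real.sq_sqrt hab.le]
  field_simp

/-- Rotating the pair of Gaussian vectors turns √a ζ + √b ζ' into √(a+b) times the first vector of
the new pair. -/
theorem heat_heat (ε : ℝ) {a b : ℝ} (ha : 0 ≤ a) (hb : 0 ≤ b) (hab : 0 < a + b) [CompleteSpace W]
    {g : Space d → W} (hg : StronglyMeasurable g) {A : ℝ} (hA : ∀ x, ‖g x‖ ≤ A) (x : Space d) :
    heat ε a (heat ε b g) x = heat ε (a + b) g x := by
  have hs : 0 < √(a + b) := Real.sqrt_pos.2 hab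
  have hK : StronglyMeasurable fun p : Space d × Space d => g (x - (ε * √(a + b)) • p.1) :=
    hg.comp_measurable (by fun_prop)
  have hK2 : StronglyMeasurable fun p : Space d × Space d =>
      g (x - (ε * √a) • p.1 - (ε * √b) • p.2) := hg.comp_measurable (by fun_prop)
  have h := integral_rotation_gauss (sqrt_rotation ha hb hab) hK
  have e : ∀ p : Space d × Space d,
      x - (ε * √(a + b)) • ((√a / √(a + b)) • p.1 + (√b / √(a + b)) • p.2)
        = x - (ε * √a) • p.1 - (ε * √b) • p.2 := by
    intro p
    rw [smul_add, smul_smul, smul_smul, sub_sub]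
    congr 3 <;> field_simp
  simp only [e] at h
  have i1 : Integrable (fun p : Space d × Space d => g (x - (ε * √a) • p.1 - (ε * √b) • p.2))
      ((gauss d).prod (gauss d)) := .of_bound hK2.aestronglyMeasurable A (.of_forall fun _ => hA _)
  have i2 : Integrable (fun p : Space d × Space d => g (x - (ε * √(a + b)) • p.1))
      ((gauss d).prod (gauss d)) := .of_bound hK.aestronglyMeasurable A (.of_forall fun _ => hA _)
  rw [integral_prod _ i1, integral_prod _ i2] at h
  simpa [heat] using h

theorem integral_inner_gauss_prod {G : Space d → Space d} (hG : StronglyMeasurable G) {A : ℝ}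
    (hA : ∀ x, ‖G x‖ ≤ A) (α β : ℝ) :
    ∫ p : Space d × Space d, inner ℝ (α • p.1 + β • p.2) (G p.1) ∂((gauss d).prod (gauss d))
      = α * ∫ ζ, inner ℝ ζ (G ζ) ∂(gauss d) := by
  have i1 : Integrable (fun p : Space d × Space d => inner ℝ p.1 (G p.1))
      ((gauss d).prod (gauss d)) := (integrable_inner_gauss hG hA).comp_fst _
  have i2 : Integrable (fun p : Space d × Space d => inner ℝ p.2 (G p.1))
      ((gauss d).prod (gauss d)) := by
    refine ((integrable_norm_gauss.comp_snd (gauss d)).mul_const A).mono'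
      (measurable_snd.stronglyMeasurable.inner
        (hG.comp_measurable measurable_fst)).aestronglyMeasurable (.of_forall fun p => ?_)
    exact (norm_inner_le_norm _ _).trans (mul_le_mul_of_nonneg_left (hA _) (norm_nonneg _))
  simp only [inner_add_left, inner_smul_left, conj_trivial]
  rw [integral_add (i1.const_mul _) (i2.const_mul _), integral_const_mul, integral_const_mul,
    integral_prod _ i1, integral_prod _ i2]
  simp [integral_inner_gauss]

theorem integrable_inner_prod_gauss {P : Space d × Space d → Space d} (α β : ℝ)
    (hP : StronglyMeasurable P) {A : ℝ} (hA : ∀ p, ‖P p‖ ≤ A) :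
    Integrable (fun p : Space d × Space d => inner ℝ (α • p.1 + β • p.2) (P p))
      ((gauss d).prod (gauss d)) := by
  have hA0 : 0 ≤ A := (norm_nonneg _).trans (hA 0)
  refine ((((integrable_norm_gauss.comp_fst (gauss d)).const_mul |α|).add
    ((integrable_norm_gauss.comp_snd (gauss d)).const_mul |β|)).mul_const A).mono'
    ((by fun_prop : Measurable fun p : Space d × Space d =>
      α • p.1 + β • p.2).stronglyMeasurable.inner hP).aestronglyMeasurable
    (.of_forall fun p => (norm_inner_le_norm _ _).trans ?_)
  refine mul_le_mul ((norm_add_le _ _).trans ?_) (hA _) (norm_nonneg _)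
    (by simp only [Pi.add_apply]; positivity)
  simp [norm_smul]

/-- After the same rotation the weight vector splits into `s` times the vector on which G depends
and an independent part that averages to zero. Since s/√b = 1/√(a+b), the normalisation comes out
right. -/
theorem heat_flux {ε : ℝ} (hε : 0 < ε) {a b : ℝ} (ha : 0 ≤ a) (hb : 0 < b)
    {G : Space d → Space d} (hG : StronglyMeasurable G) {A : ℝ} (hA : ∀ x, ‖G x‖ ≤ A)
    (x : Space d) : heat ε a (flux ε b G) x = flux ε (a + b) G x := by
  have hab : 0 < a + b := by linarith
  have hs : 0 < √(a + b) := Real.sqrt_pos.2 hab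
  have hb' : 0 < √b := Real.sqrt_pos.2 hb
  set c := √a / √(a + b) with hc
  set s := √b / √(a + b) with hsd
  have hcs : c ^ 2 + s ^ 2 = 1 := sqrt_rotation ha hb.le hab
  have hG' := stronglyMeasurable_comp_sub_smul hG (ε * √(a + b)) x
  have hK : StronglyMeasurable fun p : Space d × Space d =>
      inner ℝ (s • p.1 + c • p.2) (G (x - (ε * √(a + b)) • p.1)) :=
    (by fun_prop : Measurable fun p : Space d × Space d =>
      s • p.1 + c • p.2).stronglyMeasurable.inner (hG'.comp_measurable measurable_fst)
  have h := integral_rotation_gauss hcs hK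
  have e : ∀ p : Space d × Space d,
      x - (ε * √(a + b)) • (c • p.1 + s • p.2) = x - (ε * √a) • p.1 - (ε * √b) • p.2 := by
    intro p
    rw [smul_add, smul_smul, smul_smul, sub_sub, hc, hsd]
    congr 3 <;> field_simp
  have e2 : ∀ p : Space d × Space d,
      s • (c • p.1 + s • p.2) + c • (-s • p.1 + c • p.2) = p.2 := by
    intro p
    have : s • (c • p.1 + s • p.2) + c • (-s • p.1 + c • p.2) = (c ^ 2 + s ^ 2) • p.2 := by module
    rw [this, hcs, one_smul]
  simp only [e, e2] at h
  rw [integral_inner_gauss_prod hG' (fun _ => hA _)] at h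
  have i1 := integrable_inner_prod_gauss (d := d) 0 1
    (P := fun p => G (x - (ε * √a) • p.1 - (ε * √b) • p.2))
    (hG.comp_measurable (by fun_prop)) (fun _ => hA _)
  simp only [zero_smul, one_smul, zero_add] at i1
  rw [integral_prod _ i1] at h
  simp only [heat, flux, integral_const_mul, h]
  rw [← mul_assoc, hsd]
  congr 1
  field_simp

/-- The rotation argument of `heat_flux` with the weight on the first vector, whose coefficient is c
= √a/√(a+b). -/
theorem flux_heat {ε : ℝ} (hε : 0 < ε) {a b : ℝ} (ha : 0 < a) (hb : 0 ≤ b)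
    {G : Space d → Space d} (hG : StronglyMeasurable G) {A : ℝ} (hA : ∀ x, ‖G x‖ ≤ A)
    (x : Space d) : flux ε a (heat ε b G) x = flux ε (a + b) G x := by
  have hab : 0 < a + b := by linarith
  have hs : 0 < √(a + b) := Real.sqrt_pos.2 hab
  have ha' : 0 < √a := Real.sqrt_pos.2 ha
  set c := √a / √(a + b) with hc
  set s := √b / √(a + b) with hsd
  have hcs : c ^ 2 + s ^ 2 = 1 := sqrt_rotation ha.le hb hab
  have hG' := stronglyMeasurable_comp_sub_smul hG (ε * √(a + b)) x
  have hK : StronglyMeasurable fun p : Space d × Space d =>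
      inner ℝ (c • p.1 + (-s) • p.2) (G (x - (ε * √(a + b)) • p.1)) :=
    (by fun_prop : Measurable fun p : Space d × Space d =>
      c • p.1 + (-s) • p.2).stronglyMeasurable.inner (hG'.comp_measurable measurable_fst)
  have h := integral_rotation_gauss hcs hK
  have e : ∀ p : Space d × Space d,
      x - (ε * √(a + b)) • (c • p.1 + s • p.2) = x - (ε * √a) • p.1 - (ε * √b) • p.2 := by
    intro p
    rw [smul_add, smul_smul, smul_smul, sub_sub, hc, hsd]
    congr 3 <;> field_simp
  have e2 : ∀ p : Space d × Space d,
      c • (c • p.1 + s • p.2) + (-s) • (-s • p.1 + c • p.2) = p.1 := by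
    intro p
    have : c • (c • p.1 + s • p.2) + (-s) • (-s • p.1 + c • p.2) = (c ^ 2 + s ^ 2) • p.1 := by
      module
    rw [this, hcs, one_smul]
  simp only [e, e2] at h
  rw [integral_inner_gauss_prod hG' (fun _ => hA _)] at h
  have i1 := integrable_inner_prod_gauss (d := d) 1 0
    (P := fun p => G (x - (ε * √a) • p.1 - (ε * √b) • p.2))
    (hG.comp_measurable (by fun_prop)) (fun _ => hA _)
  simp only [zero_smul, one_smul, add_zero] at i1
  rw [integral_prod _ i1] at h
  have e3 : ∀ ζ : Space d, inner ℝ ζ (heat ε b G (x - (ε * √a) • ζ))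
      = ∫ ζ', inner ℝ ζ (G (x - (ε * √a) • ζ - (ε * √b) • ζ')) ∂(gauss d) := by
    intro ζ
    rw [heat, integral_inner]
    exact integrable_of_bounded_gauss (stronglyMeasurable_comp_sub_smul hG _ _) fun _ => hA _
  simp only [flux, integral_const_mul, e3, h]
  rw [← mul_assoc, hc]
  congr 1
  field_simp

/-! ### Hölder estimates -/

theorem min_one_le_rpow {q β : ℝ} (hq : 0 ≤ q) (h0 : 0 ≤ β) (h1 : β ≤ 1) : min 1 q ≤ q ^ β := by
  rcases le_total q 1 with h | h
  · rw [min_eq_right h]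
    rcases hq.eq_or_lt with rfl | hq
    · exact Real.rpow_nonneg le_rfl _
    · simpa using Real.rpow_le_rpow_of_exponent_ge hq h h1
  · rw [min_eq_left h]
    exact Real.one_le_rpow h h0

/-- Moving the base point translates the Gaussian by (x - y)/(ε√t). The Lipschitz bound from total
variation and the trivial bound 2A together give every exponent between 0 and 1. -/
theorem norm_heat_sub_le {ε : ℝ} (hε : 0 < ε) {t : ℝ} (ht : 0 < t) {g : Space d → W}
    (hg : StronglyMeasurable g) {A : ℝ} (hA : ∀ x, ‖g x‖ ≤ A) {β : ℝ} (h0 : 0 ≤ β) (h1 : β ≤ 1)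
    (x y : Space d) :
    ‖heat ε t g x - heat ε t g y‖ ≤ A * (2 + shiftConst d) * (‖x - y‖ / (ε * √t)) ^ β := by
  have hA0 : 0 ≤ A := (norm_nonneg _).trans (hA 0)
  have hs : 0 < ε * √t := mul_pos hε (Real.sqrt_pos.2 ht)
  have b1 : ‖heat ε t g x - heat ε t g y‖ ≤ 2 * A := by
    refine (norm_sub_le _ _).trans ?_
    linarith [norm_heat_le ε t hA x, norm_heat_le ε t hA y]
  have b2 : ‖heat ε t g x - heat ε t g y‖ ≤ A * (shiftConst d * (‖x - y‖ / (ε * √t))) := by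
    have h := norm_integral_gauss_shift_sub_le
      (stronglyMeasurable_comp_sub_smul hg (ε * √t) y) (fun _ => hA _)
      (-(ε * √t)⁻¹ • (x - y))
    have e : ∀ ζ : Space d, y - (ε * √t) • (ζ + -(ε * √t)⁻¹ • (x - y)) = x - (ε * √t) • ζ := by
      intro ζ
      rw [smul_add, smul_smul, mul_neg, mul_inv_cancel₀ hs.ne']
      module
    simp only [e, norm_smul, norm_neg, norm_inv, Real.norm_of_nonneg hs.le] at h
    rwa [div_eq_inv_mul]
  have hq : 0 ≤ ‖x - y‖ / (ε * √t) := by positivity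
  have hS := shiftConst_pos (d := d)
  calc _ ≤ A * (2 + shiftConst d) * min 1 (‖x - y‖ / (ε * √t)) := by
        rcases le_total (‖x - y‖ / (ε * √t)) 1 with h | h
        · rw [min_eq_right h]
          refine b2.trans ?_
          rw [mul_assoc]
          gcongr
          linarith
        · rw [min_eq_left h]
          nlinarith [mul_nonneg hA0 hS.le]
    _ ≤ _ := by
        gcongr
        exact min_one_le_rpow hq h0 h1

theorem inv_sqrt_eq_rpow (r : ℝ) : (√r)⁻¹ = r ^ (-(1 / 2) : ℝ) := by
  rcases le_total 0 r with h | h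
  · rw [Real.rpow_neg h, Real.sqrt_eq_rpow]
  · rcases h.eq_or_lt with rfl | h
    · rw [Real.zero_rpow (by norm_num)]; simp
    -- For negative `r` the convention for real powers contains the factor cos(-π/2) = 0, which
    -- matches √r = 0.
    · rw [Real.sqrt_eq_zero_of_nonpos h.le, Real.rpow_def_of_neg h]
      have : Real.cos (-(1 / 2) * Real.pi) = 0 := by
        rw [neg_mul, Real.cos_neg, one_div_mul_eq_div, Real.cos_pi_div_two]
      rw [this]; simp

theorem div_mul_sqrt_rpow {q ε t β : ℝ} (hq : 0 ≤ q) (hε : 0 < ε) (ht : 0 < t) :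
    (q / (ε * √t)) ^ β = (ε ^ β)⁻¹ * t ^ (-(β / 2)) * q ^ β := by
  have hs : 0 < √t := Real.sqrt_pos.2 ht
  rw [Real.div_rpow hq (by positivity), Real.mul_rpow hε.le hs.le, Real.sqrt_eq_rpow,
    ← Real.rpow_mul ht.le, Real.rpow_neg ht.le]
  have : 1 / 2 * β = β / 2 := by ring
  rw [this]
  field_simp

theorem exists_norm_heat_sub_le (d : ℕ) {ε : ℝ} (hε : 0 < ε) {β : ℝ} (h0 : 0 ≤ β) (h1 : β ≤ 1) :
    ∃ K : ℝ, 0 ≤ K ∧ ∀ (t : ℝ) (_ : 0 < t) (g : Space d → ℝ) (_ : StronglyMeasurable g) (A : ℝ)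
      (_ : ∀ x, ‖g x‖ ≤ A) (x y : Space d),
      |heat ε t g x - heat ε t g y| ≤ K * A * t ^ (-(β / 2)) * ‖x - y‖ ^ β := by
  have hS := shiftConst_pos (d := d)
  refine ⟨(2 + shiftConst d) * (ε ^ β)⁻¹, by positivity, fun t ht g hg A hA x y => ?_⟩
  refine (norm_heat_sub_le hε ht hg hA h0 h1 x y).trans (le_of_eq ?_)
  rw [div_mul_sqrt_rpow (norm_nonneg _) hε ht]
  ring

/-- Half of the time pays for the divergence, r^(-1/2), and half for the Hölder smoothing, r^(-β/2).
The total exponent is above -1 when β < 1. -/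
theorem exists_abs_flux_sub_le (d : ℕ) {ε : ℝ} (hε : 0 < ε) {β : ℝ} (h0 : 0 ≤ β) (h1 : β ≤ 1) :
    ∃ K : ℝ, 0 ≤ K ∧ ∀ (r : ℝ) (_ : 0 < r) (G : Space d → Space d) (_ : StronglyMeasurable G)
      (A : ℝ) (_ : ∀ x, ‖G x‖ ≤ A) (x y : Space d),
      |flux ε r G x - flux ε r G y| ≤ K * A * r ^ (-((1 + β) / 2)) * ‖x - y‖ ^ β := by
  obtain ⟨K, hK0, hK⟩ := exists_norm_heat_sub_le d hε h0 h1
  have hM := gaussMoment_nonneg (d := d)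
  refine ⟨K * (gaussMoment d / ε) * (1 / 2) ^ (-((1 + β) / 2)), by positivity,
    fun r hr G hG A hA x y => ?_⟩
  have e : ∀ x, flux ε r G x = heat ε (r / 2) (flux ε (r / 2) G) x := by
    intro x
    rw [heat_flux hε (by positivity) (by positivity) hG hA, add_halves]
  rw [e, e]
  refine (hK (r / 2) (by positivity) _ (stronglyMeasurable_flux _ _ hG) _
    (abs_flux_le hε _ hA) x y).trans (le_of_eq ?_)
  rw [inv_sqrt_eq_rpow]
  have h2 : (r / 2) ^ (-(1 / 2) : ℝ) * (r / 2) ^ (-(β / 2))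
      = (1 / 2) ^ (-((1 + β) / 2)) * r ^ (-((1 + β) / 2)) := by
    rw [← Real.rpow_add (by positivity), ← Real.mul_rpow (by norm_num) hr.le]
    congr 1 <;> ring
  calc _ = K * (gaussMoment d / ε) * A * ((r / 2) ^ (-(1 / 2) : ℝ) * (r / 2) ^ (-(β / 2)))
          * ‖x - y‖ ^ β := by ring
    _ = _ := by rw [h2]; ring

end

/-! ### Weakly singular integrals -/

theorem integrableOn_sub_left_iff {g : ℝ → ℝ} {c t : ℝ} (h : c ≤ t) :
    IntegrableOn (fun s => g (t - s)) (Ioo c t) ↔ IntegrableOn g (Ioo 0 (t - c)) := by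
  rw [← intervalIntegrable_iff_integrableOn_Ioo_of_le h,
    ← intervalIntegrable_iff_integrableOn_Ioo_of_le (sub_nonneg.2 h)]
  constructor
  · intro hg
    have := hg.comp_sub_left t
    simp only [sub_sub_cancel, sub_self] at this
    exact this.symm
  · intro hg
    have := hg.comp_sub_left t
    simp only [sub_zero, sub_sub_cancel] at this
    exact this.symm

theorem setIntegral_sub_left (g : ℝ → ℝ) {c t : ℝ} (h : c ≤ t) :
    ∫ s in Ioo c t, g (t - s) = ∫ r in Ioo 0 (t - c), g r := by
  rw [← integral_Ioc_eq_integral_Ioo, ← integral_Ioc_eq_integral_Ioo,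
    ← intervalIntegral.integral_of_le h, ← intervalIntegral.integral_of_le (sub_nonneg.2 h),
    intervalIntegral.integral_comp_sub_left, sub_self]

theorem integrableOn_rpow_Ioo {a : ℝ} (ha : -1 < a) {t : ℝ} (ht : 0 ≤ t) :
    IntegrableOn (fun r : ℝ => r ^ a) (Ioo 0 t) := by
  rw [← intervalIntegrable_iff_integrableOn_Ioo_of_le ht]
  exact intervalIntegral.intervalIntegrable_rpow' ha

theorem setIntegral_rpow_Ioo {a : ℝ} (ha : -1 < a) {t : ℝ} (ht : 0 ≤ t) :
    ∫ r in Ioo 0 t, r ^ a = t ^ (a + 1) / (a + 1) := by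
  rw [← integral_Ioc_eq_integral_Ioo, ← intervalIntegral.integral_of_le ht,
    integral_rpow (Or.inl ha), Real.zero_rpow (by linarith), sub_zero]

theorem integrableOn_sub_rpow {a : ℝ} (ha : -1 < a) {c t : ℝ} (h : c ≤ t) :
    IntegrableOn (fun s => (t - s) ^ a) (Ioo c t) :=
  (integrableOn_sub_left_iff h).2 (integrableOn_rpow_Ioo ha (sub_nonneg.2 h))

theorem setIntegral_sub_rpow {a : ℝ} (ha : -1 < a) {c t : ℝ} (h : c ≤ t) :
    ∫ s in Ioo c t, (t - s) ^ a = (t - c) ^ (a + 1) / (a + 1) := by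
  rw [setIntegral_sub_left (fun r => r ^ a) h, setIntegral_rpow_Ioo ha (sub_nonneg.2 h)]

theorem integrableOn_rpow_mul_exp {l : ℝ} (hl : 0 < l) :
    IntegrableOn (fun r : ℝ => r ^ (-(1 / 2) : ℝ) * Real.exp (-(l * r))) (Ioi 0) := by
  -- Integrability is read off the nonzero value of the Gamma integral, since non-integrable
  -- functions have integral 0 by convention.
  have h1 : ∫ r in Ioi (0 : ℝ), r ^ ((1 / 2 : ℝ) - 1) * Real.exp (-(l * r)) ≠ 0 := by
    rw [Real.integral_rpow_mul_exp_neg_mul_Ioi (by norm_num) hl]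
    have := Real.Gamma_pos_of_pos (by norm_num : (0 : ℝ) < 1 / 2)
    positivity
  have := not_imp_comm.1 integral_undef h1
  rw [IntegrableOn]
  convert this using 4
  norm_num

/-- Comparison with the full Gamma integral gains l^(-1/2) against the exponential weight, the
source of the contraction. -/
theorem integrableOn_sub_rpow_mul_exp {l : ℝ} (hl : 0 < l) {t : ℝ} (ht : 0 ≤ t) :
    IntegrableOn (fun s => (t - s) ^ (-(1 / 2) : ℝ) * Real.exp (l * s)) (Ioo 0 t) ∧
    ∫ s in Ioo 0 t, (t - s) ^ (-(1 / 2) : ℝ) * Real.exp (l * s)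
      ≤ (1 / l) ^ (1 / 2 : ℝ) * Real.Gamma (1 / 2) * Real.exp (l * t) := by
  have e : ∀ s, (t - s) ^ (-(1 / 2) : ℝ) * Real.exp (l * s)
      = (fun r : ℝ => r ^ (-(1 / 2) : ℝ) * Real.exp (-(l * r)) * Real.exp (l * t)) (t - s) := by
    intro s
    simp only
    rw [mul_assoc, ← Real.exp_add]
    congr 2; ring
  have hi := integrableOn_rpow_mul_exp hl
  have hi2 : IntegrableOn (fun r : ℝ => r ^ (-(1 / 2) : ℝ) * Real.exp (-(l * r)) *
      Real.exp (l * t)) (Ioo 0 (t - 0)) := (hi.mono_set Ioo_subset_Ioi_self).mul_const _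
  simp only [e]
  refine ⟨(integrableOn_sub_left_iff ht).2 hi2, ?_⟩
  rw [setIntegral_sub_left (fun r : ℝ => r ^ (-(1 / 2) : ℝ) * Real.exp (-(l * r)) *
      Real.exp (l * t)) ht, integral_mul_const, sub_zero]
  refine mul_le_mul_of_nonneg_right ?_ (Real.exp_pos _).le
  rw [← Real.integral_rpow_mul_exp_neg_mul_Ioi (by norm_num) hl]
  norm_num only
  refine setIntegral_mono_set (by convert hi using 4) ?_
    Ioo_subset_Ioi_self.eventuallyLE
  filter_upwards [ae_restrict_mem measurableSet_Ioi] with r hr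
  have : (0 : ℝ) < r := hr
  simp only [Pi.zero_apply]
  positivity

/-! ### The Duhamel integral and mild solutions -/

/-- The Duhamel integral of the linear equation `∂ₜ m + ∇ · F = (ε² / 2) Δ m`. -/
def duhamel (ε : ℝ) (F : Space d × ℝ → Space d) (p : Space d × ℝ) : ℝ :=
  ∫ s in Ioo 0 p.2, flux ε (p.2 - s) (fun y => F (y, s)) p.1

/-- The mild solution of `∂ₜ m + ∇ · F = (ε² / 2) Δ m` with initial datum `u`. -/
def mild (ε : ℝ) (u : Space d → ℝ) (F : Space d × ℝ → Space d) (p : Space d × ℝ) : ℝ :=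
  heat ε p.2 u p.1 + duhamel ε F p

section

variable {F : Space d × ℝ → Space d}

theorem stronglyMeasurable_section (hF : StronglyMeasurable F) (s : ℝ) :
    StronglyMeasurable fun y => F (y, s) := hF.comp_measurable (by fun_prop)

theorem stronglyMeasurable_flux_section (ε : ℝ) (hF : StronglyMeasurable F) :
    StronglyMeasurable fun q : (Space d × ℝ) × ℝ =>
      flux ε (q.1.2 - q.2) (fun y => F (y, q.2)) q.1.1 :=
  stronglyMeasurable_flux_param ε (K := fun a : ((Space d × ℝ) × ℝ) × Space d => F (a.2, a.1.2))
    (hF.comp_measurable (by fun_prop)) (by fun_prop) (by fun_prop)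

theorem stronglyMeasurable_duhamel (ε : ℝ) (hF : StronglyMeasurable F) :
    StronglyMeasurable (duhamel ε F) := by
  have h := stronglyMeasurable_flux_section ε hF
  have hS : MeasurableSet {q : (Space d × ℝ) × ℝ | q.2 ∈ Ioo 0 q.1.2} :=
    (measurableSet_lt measurable_const measurable_snd).inter
      (measurableSet_lt measurable_snd (by fun_prop))
  have h2 := (h.indicator hS).integral_prod_right' (ν := (volume : Measure ℝ))
  convert h2 using 2 with p
  rw [duhamel, ← integral_indicator measurableSet_Ioo]
  rfl

theorem stronglyMeasurable_mild (ε : ℝ) {u : Space d → ℝ} (hu : StronglyMeasurable u)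
    (hF : StronglyMeasurable F) : StronglyMeasurable (mild ε u F) := by
  refine StronglyMeasurable.add ?_ (stronglyMeasurable_duhamel ε hF)
  exact stronglyMeasurable_heat_param (α := Space d × ℝ) ε (K := fun a => u a.2)
    (hu.comp_measurable measurable_snd) measurable_snd measurable_fst

theorem integrableOn_flux {ε : ℝ} (hε : 0 < ε) (hF : StronglyMeasurable F) {A : ℝ}
    (hA : ∀ p, ‖F p‖ ≤ A) (x : Space d) {c t : ℝ} (h : c ≤ t) :
    IntegrableOn (fun s => flux ε (t - s) (fun y => F (y, s)) x) (Ioo c t) := by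
  refine (((integrableOn_sub_rpow (a := -(1 / 2)) (by norm_num) h).const_mul
    (gaussMoment d / ε)).mul_const A).mono'
    ((stronglyMeasurable_flux_section ε hF).comp_measurable
      (by fun_prop : Measurable fun s : ℝ => ((x, t), s))).aestronglyMeasurable
    (.of_forall fun s => ?_)
  rw [← inv_sqrt_eq_rpow]
  exact abs_flux_le hε _ (fun y => hA (y, s)) x

theorem abs_setIntegral_flux_le {ε : ℝ} (hε : 0 < ε)
    {A : ℝ} (hA : ∀ p, ‖F p‖ ≤ A) (x : Space d) {c t : ℝ} (h : c ≤ t) :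
    |∫ s in Ioo c t, flux ε (t - s) (fun y => F (y, s)) x|
      ≤ gaussMoment d / ε * (2 * √(t - c)) * A := by
  have h1 := norm_integral_le_of_norm_le (μ := volume.restrict (Ioo c t))
    (f := fun s => flux ε (t - s) (fun y => F (y, s)) x)
    (((integrableOn_sub_rpow (a := -(1 / 2)) (by norm_num) h).const_mul
      (gaussMoment d / ε)).mul_const A)
    (.of_forall fun s => by
      rw [← inv_sqrt_eq_rpow]
      exact abs_flux_le hε _ (fun y => hA (y, s)) x)
  refine h1.trans (le_of_eq ?_)
  rw [integral_mul_const, integral_const_mul, setIntegral_sub_rpow (by norm_num) h,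
    Real.sqrt_eq_rpow, (by norm_num : -(1 / 2 : ℝ) + 1 = 1 / 2)]
  ring

theorem abs_duhamel_le {ε : ℝ} (hε : 0 < ε) {A : ℝ} (hA : ∀ p, ‖F p‖ ≤ A) (x : Space d) {t : ℝ}
    (ht : 0 ≤ t) : |duhamel ε F (x, t)| ≤ gaussMoment d / ε * (2 * √t) * A := by
  simpa [duhamel] using abs_setIntegral_flux_le hε hA x ht

theorem abs_duhamel_sub_le {ε : ℝ} (hε : 0 < ε) {G : Space d × ℝ → Space d}
    (hF : StronglyMeasurable F) (hG : StronglyMeasurable G) {A B : ℝ} (hA : ∀ p, ‖F p‖ ≤ A)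
    (hB : ∀ p, ‖G p‖ ≤ B) {t : ℝ} (ht : 0 ≤ t) {a : ℝ → ℝ}
    (ha : ∀ s ∈ Ioo 0 t, ∀ y, ‖F (y, s) - G (y, s)‖ ≤ a s)
    (hi : IntegrableOn (fun s => (t - s) ^ (-(1 / 2) : ℝ) * a s) (Ioo 0 t)) (x : Space d) :
    |duhamel ε F (x, t) - duhamel ε G (x, t)|
      ≤ gaussMoment d / ε * ∫ s in Ioo 0 t, (t - s) ^ (-(1 / 2) : ℝ) * a s := by
  unfold duhamel
  simp only
  rw [← integral_sub (integrableOn_flux hε hF hA x ht) (integrableOn_flux hε hG hB x ht),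
    ← integral_const_mul, ← Real.norm_eq_abs]
  refine norm_integral_le_of_norm_le (hi.const_mul _) ?_
  filter_upwards [ae_restrict_mem measurableSet_Ioo] with s hs
  rw [← flux_sub ε _ (stronglyMeasurable_section hF s) (stronglyMeasurable_section hG s)
    (fun y => hA (y, s)) (fun y => hB (y, s)), ← mul_assoc, ← inv_sqrt_eq_rpow]
  exact abs_flux_le hε _ (ha s hs) x

/-- The semigroup laws and Fubini carry the heat flow from time `c` to `t` through the Duhamel
integral over (0, c). -/
theorem mild_restart {ε : ℝ} (hε : 0 < ε) {u : Space d → ℝ} (hu : StronglyMeasurable u) {A B : ℝ}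
    (hA : ∀ x, ‖u x‖ ≤ A) (hF : StronglyMeasurable F) (hB : ∀ p, ‖F p‖ ≤ B) (x : Space d)
    {c t : ℝ} (hc : 0 ≤ c) (hct : c < t) :
    mild ε u F (x, t) = heat ε (t - c) (fun y => mild ε u F (y, c)) x
      + ∫ s in Ioo c t, flux ε (t - s) (fun y => F (y, s)) x := by
  have hd : StronglyMeasurable fun y => duhamel ε F (y, c) :=
    (stronglyMeasurable_duhamel ε hF).comp_measurable (by fun_prop)
  have e1 : heat ε (t - c) (fun y => mild ε u F (y, c)) x
      = heat ε (t - c) (heat ε c u) x + heat ε (t - c) (fun y => duhamel ε F (y, c)) x :=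
    heat_add ε _ (stronglyMeasurable_heat ε c hu) hd (norm_heat_le ε c hA)
      (fun y => abs_duhamel_le hε hB y hc) x
  have e2 : heat ε (t - c) (heat ε c u) x = heat ε t u x := by
    rw [heat_heat ε (sub_pos.2 hct).le hc (by linarith) hu hA, sub_add_cancel]
  have e3 : heat ε (t - c) (fun y => duhamel ε F (y, c)) x
      = ∫ s in Ioo 0 c, flux ε (t - s) (fun y => F (y, s)) x := by
    simp only [heat, duhamel]
    rw [integral_integral_swap]
    · refine setIntegral_congr_fun measurableSet_Ioo fun s hs => ?_
      have := heat_flux hε (a := t - c) (b := c - s) (sub_pos.2 hct).le (sub_pos.2 hs.2)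
        (stronglyMeasurable_section hF s) (fun y => hB (y, s)) x
      rwa [sub_add_sub_cancel] at this
    · refine ((((integrableOn_sub_rpow (a := -(1 / 2)) (by norm_num) hc).const_mul
        (gaussMoment d / ε)).mul_const B).comp_snd (gauss d)).mono' ?_ (.of_forall fun q => ?_)
      · exact ((stronglyMeasurable_flux_section ε hF).comp_measurable
          (by fun_prop : Measurable fun q : Space d × ℝ =>
            ((x - (ε * √(t - c)) • q.1, c), q.2))).aestronglyMeasurable
      · simp only [Function.uncurry]
        rw [← inv_sqrt_eq_rpow]
        exact abs_flux_le hε _ (fun y => hB (y, _)) _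
  have e4 : duhamel ε F (x, t) = (∫ s in Ioo 0 c, flux ε (t - s) (fun y => F (y, s)) x)
      + ∫ s in Ioo c t, flux ε (t - s) (fun y => F (y, s)) x := by
    have hi := integrableOn_flux hε hF hB x (hc.trans hct.le)
    rw [duhamel, ← integral_Ioc_eq_integral_Ioo (x := 0) (y := c), ← setIntegral_union
      (disjoint_left.2 fun s h1 h2 => not_lt.2 h1.2 h2.1) measurableSet_Ioo
      (hi.mono_set fun s hs => ⟨hs.1, hs.2.trans_lt hct⟩)
      (hi.mono_set fun s hs => ⟨hc.trans_lt hs.1, hs.2⟩), Ioc_union_Ioo_eq_Ioo hc hct]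
  rw [e1, e2, e3, mild, e4]
  ring

theorem exists_abs_mild_sub_le (d : ℕ) {ε : ℝ} (hε : 0 < ε) {β : ℝ} (h0 : 0 ≤ β) (h1 : β < 1) :
    ∃ K : ℝ, 0 ≤ K ∧ ∀ (u : Space d → ℝ) (_ : StronglyMeasurable u) (F : Space d × ℝ → Space d)
      (_ : StronglyMeasurable F) (A B : ℝ) (_ : ∀ x, ‖u x‖ ≤ A) (_ : ∀ p, ‖F p‖ ≤ B)
      (t : ℝ) (_ : 0 < t) (x y : Space d),
      |mild ε u F (x, t) - mild ε u F (y, t)|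
        ≤ K * (A * t ^ (-(β / 2)) + B * t ^ ((1 - β) / 2)) * ‖x - y‖ ^ β := by
  obtain ⟨K1, hK1, h1'⟩ := exists_norm_heat_sub_le d hε h0 h1.le
  obtain ⟨K2, hK2, h2'⟩ := exists_abs_flux_sub_le d hε h0 h1.le
  have hb : 0 < (1 - β) / 2 := by linarith
  refine ⟨K1 + K2 / ((1 - β) / 2), by positivity, fun u hu F hF A B hA hB t ht x y => ?_⟩
  have hA0 : 0 ≤ A := (norm_nonneg _).trans (hA 0)
  have hB0 : 0 ≤ B := (norm_nonneg _).trans (hB 0)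
  have b2 : |duhamel ε F (x, t) - duhamel ε F (y, t)|
      ≤ K2 / ((1 - β) / 2) * (B * t ^ ((1 - β) / 2)) * ‖x - y‖ ^ β := by
    unfold duhamel
    simp only
    rw [← integral_sub (integrableOn_flux hε hF hB x ht.le) (integrableOn_flux hε hF hB y ht.le)]
    have h3 := norm_integral_le_of_norm_le (μ := volume.restrict (Ioo 0 t))
      (f := fun s => flux ε (t - s) (fun y => F (y, s)) x - flux ε (t - s) (fun y => F (y, s)) y)
      (((integrableOn_sub_rpow (a := -((1 + β) / 2)) (by linarith) ht.le).const_mul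
        (K2 * B)).mul_const (‖x - y‖ ^ β)) (by
        filter_upwards [ae_restrict_mem measurableSet_Ioo] with s hs
        exact h2' (t - s) (sub_pos.2 hs.2) _ (stronglyMeasurable_section hF s) B
          (fun z => hB (z, s)) x y)
    refine h3.trans (le_of_eq ?_)
    have e : -((1 + β) / 2) + 1 = (1 - β) / 2 := by ring
    rw [integral_mul_const, integral_const_mul, setIntegral_sub_rpow (by linarith) ht.le, sub_zero,
      e]
    ring
  have b1 := h1' t ht u hu A hA x y
  have e : mild ε u F (x, t) - mild ε u F (y, t) = (heat ε t u x - heat ε t u y)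
      + (duhamel ε F (x, t) - duhamel ε F (y, t)) := by simp only [mild]; ring
  rw [e]
  refine (abs_add_le _ _).trans ((add_le_add b1 b2).trans ?_)
  -- These are the two nonnegative cross terms created by using the sum of the constants for both
  -- contributions.
  have p1 : 0 ≤ K1 * (B * t ^ ((1 - β) / 2)) * ‖x - y‖ ^ β := by positivity
  have p2 : 0 ≤ K2 / ((1 - β) / 2) * (A * t ^ (-(β / 2))) * ‖x - y‖ ^ β := by positivity
  nlinarith

end

/-! ### The fixed point equation -/

/-- `f` is bounded by `B` and Lipschitz continuous with constant `L`. -/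
structure BoundedLipschitz (f : ℝ → Space d) (B L : ℝ) : Prop where
  bound : ∀ a, ‖f a‖ ≤ B
  lip : ∀ a b, ‖f a - f b‖ ≤ L * |a - b|

namespace BoundedLipschitz

variable {f : ℝ → Space d} {B L : ℝ}

theorem nonneg_bound (hf : BoundedLipschitz f B L) : 0 ≤ B := (norm_nonneg _).trans (hf.bound 0)

theorem nonneg_lip (hf : BoundedLipschitz f B L) : 0 ≤ L := by
  have := (norm_nonneg _).trans (hf.lip 1 0)
  simpa using this

theorem continuous (hf : BoundedLipschitz f B L) : Continuous f := by
  refine LipschitzWith.continuous (K := L.toNNReal) (LipschitzWith.of_dist_le_mul fun a b => ?_)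
  rw [dist_eq_norm, Real.dist_eq, Real.coe_toNNReal _ hf.nonneg_lip]
  exact hf.lip a b

theorem stronglyMeasurable_comp (hf : BoundedLipschitz f B L) {α : Type*} [MeasurableSpace α]
    {v : α → ℝ} (hv : StronglyMeasurable v) : StronglyMeasurable fun a => f (v a) :=
  hf.continuous.comp_stronglyMeasurable hv

end BoundedLipschitz

section

variable {f : ℝ → Space d} {B L ε : ℝ}

/-- The exponential weight makes the contraction factor 1/2 uniform in time. Only earlier times
enter, so the bound is assumed on (0, t) alone. -/
theorem exists_mild_contraction (hε : 0 < ε) (hf : BoundedLipschitz f B L) :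
    ∃ l : ℝ, 0 < l ∧ ∀ (u : Space d → ℝ) (v w : Space d × ℝ → ℝ) (_ : StronglyMeasurable v)
      (_ : StronglyMeasurable w) (K t : ℝ) (_ : 0 < t)
      (_ : ∀ s ∈ Ioo 0 t, ∀ y, |v (y, s) - w (y, s)| ≤ K * Real.exp (l * s)) (x : Space d),
      |mild ε u (fun p => f (v p)) (x, t) - mild ε u (fun p => f (w p)) (x, t)|
        ≤ K / 2 * Real.exp (l * t) := by
  set κ := gaussMoment d / ε with hκ
  have hκ0 : 0 ≤ κ := div_nonneg gaussMoment_nonneg hε.le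
  have hL0 := hf.nonneg_lip
  have hG := Real.Gamma_pos_of_pos (by norm_num : (0 : ℝ) < 1 / 2)
  -- With l = (q + 1)², the gain l^(-1/2) is 1/(q + 1) and the factor becomes q/(2(q + 1)) ≤ 1/2.
  set q := 2 * (κ * (L * Real.Gamma (1 / 2))) with hq
  have hq0 : 0 ≤ q := by positivity
  refine ⟨(q + 1) ^ 2, by positivity, fun u v w hv hw K t ht h x => ?_⟩
  set l := (q + 1) ^ 2 with hl
  have hl0 : 0 < l := by positivity
  obtain ⟨hi, hle⟩ := integrableOn_sub_rpow_mul_exp hl0 ht.le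
  have hK0 : 0 ≤ K := by
    have := (abs_nonneg _).trans (h (t / 2) ⟨by linarith, by linarith⟩ 0)
    exact nonneg_of_mul_nonneg_left this (Real.exp_pos _)
  have e : ∀ s, (t - s) ^ (-(1 / 2) : ℝ) * (L * K * Real.exp (l * s))
      = L * K * ((t - s) ^ (-(1 / 2) : ℝ) * Real.exp (l * s)) := fun s => by ring
  have h1 := abs_duhamel_sub_le hε (hf.stronglyMeasurable_comp hv) (hf.stronglyMeasurable_comp hw)
    (fun p => hf.bound _) (fun p => hf.bound _) ht.le (a := fun s => L * K * Real.exp (l * s))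
    (fun s hs y => (hf.lip _ _).trans (by
      rw [mul_assoc]; exact mul_le_mul_of_nonneg_left (h s hs y) hL0))
    (by simp only [e]; exact hi.const_mul _) x
  simp only [e] at h1
  rw [integral_const_mul] at h1
  simp only [mild, add_sub_add_left_eq_sub]
  refine h1.trans ?_
  have hs : (1 / l) ^ (1 / 2 : ℝ) = (q + 1)⁻¹ := by
    rw [← Real.sqrt_eq_rpow, hl, one_div, Real.sqrt_inv, Real.sqrt_sq (by positivity)]
  rw [hs] at hle
  calc κ * (L * K * ∫ s in Ioo 0 t, (t - s) ^ (-(1 / 2) : ℝ) * Real.exp (l * s))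
      ≤ κ * (L * K * ((q + 1)⁻¹ * Real.Gamma (1 / 2) * Real.exp (l * t))) := by gcongr
    _ = (q * (q + 1)⁻¹) * (K / 2 * Real.exp (l * t)) := by rw [hq]; ring
    _ ≤ 1 * (K / 2 * Real.exp (l * t)) := by
        gcongr
        rw [← div_eq_mul_inv, div_le_one (by positivity)]
        linarith
    _ = _ := one_mul _

theorem abs_mild_le (hε : 0 < ε) {u : Space d → ℝ} {A : ℝ} (hA : ∀ x, ‖u x‖ ≤ A)
    {F : Space d × ℝ → Space d} (hB : ∀ p, ‖F p‖ ≤ B) {t : ℝ} (ht : 0 ≤ t) (x : Space d) :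
    |mild ε u F (x, t)| ≤ A + gaussMoment d / ε * (2 * √t) * B :=
  (abs_add_le _ _).trans (add_le_add (norm_heat_le ε t hA x) (abs_duhamel_le hε hB x ht))

/-- The Picard iterates of the mild formulation. -/
def picard (ε : ℝ) (u : Space d → ℝ) (f : ℝ → Space d) : ℕ → Space d × ℝ → ℝ
  | 0 => fun _ => 0
  | n + 1 => mild ε u fun p => f (picard ε u f n p)

theorem exists_mild_fixedPoint (hε : 0 < ε) (hf : BoundedLipschitz f B L) {u : Space d → ℝ}
    (hu : StronglyMeasurable u) {A : ℝ} (hA : ∀ x, ‖u x‖ ≤ A) :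
    ∃ m : Space d × ℝ → ℝ, StronglyMeasurable m ∧
      ∀ x t, 0 < t → m (x, t) = mild ε u (fun p => f (m p)) (x, t) := by
  obtain ⟨l, hl, hc⟩ := exists_mild_contraction hε hf
  have hA0 : 0 ≤ A := (norm_nonneg _).trans (hA 0)
  have hB0 := hf.nonneg_bound
  have hκ0 : 0 ≤ gaussMoment d / ε := div_nonneg gaussMoment_nonneg hε.le
  have hm : ∀ n, StronglyMeasurable (picard ε u f n) := by
    intro n
    induction n with
    | zero => exact stronglyMeasurable_const
    | succ n ih => exact stronglyMeasurable_mild ε hu (hf.stronglyMeasurable_comp ih)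
  -- Since √t ≤ 1 + t ≤ (1 + l⁻¹) exp(l t), this constant absorbs the growth of the first iterate
  -- into the weight.
  set C := A + gaussMoment d / ε * 2 * B * (1 + l⁻¹) with hC
  have hC0 : 0 ≤ C := by positivity
  have step : ∀ n x t, 0 < t → |picard ε u f n (x, t) - picard ε u f (n + 1) (x, t)|
      ≤ C / 2 ^ n * Real.exp (l * t) := by
    intro n
    induction n with
    | zero =>
      intro x t ht
      simp only [picard, zero_sub, abs_neg, pow_zero, div_one]
      refine (abs_mild_le hε hA (fun p => hf.bound _) ht.le x).trans ?_
      have h1 : 1 ≤ Real.exp (l * t) := Real.one_le_exp (by positivity)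
      have h2 : l * t ≤ Real.exp (l * t) := by linarith [Real.add_one_le_exp (l * t)]
      have h3 : √t ≤ 1 + t := by
        rw [Real.sqrt_le_left (by linarith)]; nlinarith
      have h4 : √t ≤ (1 + l⁻¹) * Real.exp (l * t) := by
        have : t ≤ l⁻¹ * Real.exp (l * t) := by
          rw [← div_eq_inv_mul, le_div_iff₀ hl, mul_comm]; exact h2
        linarith
      calc A + gaussMoment d / ε * (2 * √t) * B
          ≤ A * Real.exp (l * t)
            + gaussMoment d / ε * (2 * ((1 + l⁻¹) * Real.exp (l * t))) * B := by
            gcongr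
            exact le_mul_of_one_le_right hA0 h1
        _ = _ := by rw [hC]; ring
    | succ n ih =>
      intro x t ht
      refine (hc u _ _ (hm n) (hm (n + 1)) (C / 2 ^ n) t ht
        (fun s hs y => ih y s hs.1) x).trans (le_of_eq ?_)
      rw [pow_succ]; ring
  have hdist : ∀ x t, 0 < t → ∀ n,
      dist (picard ε u f n (x, t)) (picard ε u f (n + 1) (x, t))
        ≤ 2 * (C * Real.exp (l * t)) / 2 / 2 ^ n := by
    intro x t ht n
    rw [Real.dist_eq]
    refine (step n x t ht).trans (le_of_eq (by ring))
  -- The geometric bound is available for positive times only. Cutting off elsewhere gives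
  -- convergence at every point, hence a measurable limit.
  set S : Set (Space d × ℝ) := univ ×ˢ Ioi 0 with hS
  have hSm : MeasurableSet S := MeasurableSet.univ.prod measurableSet_Ioi
  have hlim : ∀ p : Space d × ℝ, ∃ y, Tendsto (fun n => S.indicator (picard ε u f n) p) atTop (𝓝 y) := by
    rintro ⟨x, t⟩
    by_cases ht : 0 < t
    · have hp : (x, t) ∈ S := ⟨mem_univ _, ht⟩
      simp only [indicator_of_mem hp]
      exact cauchySeq_tendsto_of_complete (cauchySeq_of_le_geometric_two (hdist x t ht))
    · have hp : (x, t) ∉ S := fun h => ht h.2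
      simp only [indicator_of_notMem hp]
      exact ⟨0, tendsto_const_nhds⟩
  choose m hmt using hlim
  have hmm : StronglyMeasurable m :=
    stronglyMeasurable_of_tendsto atTop (fun n => (hm n).indicator hSm)
      (tendsto_pi_nhds.2 hmt)
  have hmt' : ∀ x t, 0 < t → Tendsto (fun n => picard ε u f n (x, t)) atTop (𝓝 (m (x, t))) := by
    intro x t ht
    have hp : (x, t) ∈ S := ⟨mem_univ _, ht⟩
    simpa only [indicator_of_mem hp] using hmt (x, t)
  have hclose : ∀ n x t, 0 < t → |picard ε u f n (x, t) - m (x, t)|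
      ≤ 2 * C / 2 ^ n * Real.exp (l * t) := by
    intro n x t ht
    have := dist_le_of_le_geometric_two_of_tendsto (hdist x t ht) (hmt' x t ht) n
    rw [Real.dist_eq] at this
    exact this.trans (le_of_eq (by ring))
  refine ⟨m, hmm, fun x t ht => ?_⟩
  refine tendsto_nhds_unique ((hmt' x t ht).comp (tendsto_add_atTop_nat 1)) ?_
  rw [tendsto_iff_dist_tendsto_zero]
  have h0 : Tendsto (fun n : ℕ => 2 * C * (1 / 2) ^ n / 2 * Real.exp (l * t)) atTop (𝓝 0) := by
    have := tendsto_pow_atTop_nhds_zero_of_lt_one (r := (1 / 2 : ℝ)) (by norm_num) (by norm_num)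
    have := ((this.const_mul (2 * C)).div_const 2).mul_const (Real.exp (l * t))
    simpa using this
  refine squeeze_zero (fun _ => dist_nonneg) (fun n => ?_) h0
  rw [Real.dist_eq]
  refine (hc u _ _ (hm n) hmm (2 * C / 2 ^ n) t ht (fun s hs y => hclose n y s hs.1) x).trans
    (le_of_eq ?_)
  rw [one_div, inv_pow]
  ring

/-- The contraction is iterated from the crude bound `K`, which is halved each time while the
defects sum to 2δ. Thus `K` only has to be finite and does not enter the constant. -/
theorem exists_mild_stability (hε : 0 < ε) (hf : BoundedLipschitz f B L) (T : ℝ) :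
    ∃ C : ℝ, 0 ≤ C ∧ ∀ (u : Space d → ℝ) (v w : Space d × ℝ → ℝ) (_ : StronglyMeasurable v)
      (_ : StronglyMeasurable w) (K δ : ℝ) (_ : 0 ≤ δ)
      (_ : ∀ x, ∀ t ∈ Ioo 0 T, |v (x, t) - w (x, t)| ≤ K)
      (_ : ∀ x, ∀ t ∈ Ioo 0 T, |v (x, t) - mild ε u (fun p => f (v p)) (x, t)| ≤ δ)
      (_ : ∀ x, ∀ t ∈ Ioo 0 T, w (x, t) = mild ε u (fun p => f (w p)) (x, t)),
      ∀ x, ∀ t ∈ Ioo 0 T, |v (x, t) - w (x, t)| ≤ C * δ := by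
  obtain ⟨l, hl, hc⟩ := exists_mild_contraction hε hf
  refine ⟨2 * Real.exp (l * T), by positivity, fun u v w hv hw K δ hδ hK h1 h2 x t ht => ?_⟩
  have hK0 : 0 ≤ K := (abs_nonneg _).trans (hK x t ht)
  have key : ∀ n : ℕ, ∀ x, ∀ t ∈ Ioo 0 T,
      |v (x, t) - w (x, t)| ≤ (2 * δ + K * (1 / 2) ^ n) * Real.exp (l * t) := by
    intro n
    induction n with
    | zero =>
      intro x t ht
      have h3 : 1 ≤ Real.exp (l * t) := Real.one_le_exp (mul_nonneg hl.le ht.1.le)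
      refine (hK x t ht).trans ?_
      rw [pow_zero, mul_one]
      nlinarith
    | succ n ih =>
      intro x t ht
      have h3 : 1 ≤ Real.exp (l * t) := Real.one_le_exp (mul_nonneg hl.le ht.1.le)
      have h4 := hc u v w hv hw _ t ht.1 (fun s hs y => ih y s ⟨hs.1, hs.2.trans ht.2⟩) x
      have h5 := h1 x t ht
      rw [h2 x t ht]
      have h6 := abs_sub_le (v (x, t)) (mild ε u (fun p => f (v p)) (x, t))
        (mild ε u (fun p => f (w p)) (x, t))
      refine h6.trans ((add_le_add h5 h4).trans ?_)
      rw [pow_succ]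
      nlinarith
  have hlim : Tendsto (fun n : ℕ => (2 * δ + K * (1 / 2) ^ n) * Real.exp (l * t)) atTop
      (𝓝 ((2 * δ + K * 0) * Real.exp (l * t))) :=
    (((tendsto_pow_atTop_nhds_zero_of_lt_one (r := (1 / 2 : ℝ)) (by norm_num)
      (by norm_num)).const_mul K).const_add _).mul_const _
  have h7 := ge_of_tendsto' hlim fun n => key n x t ht
  refine h7.trans ?_
  rw [mul_zero, add_zero, mul_right_comm]
  gcongr
  exact ht.2.le

end

/-! ### The maximum principle -/

theorem norm_heat_sub_self_le {W : Type*} [NormedAddCommGroup W] [NormedSpace ℝ W]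
    [CompleteSpace W] {ε : ℝ} (hε : 0 < ε) (σ : ℝ) {g : Space d → W} (hg : StronglyMeasurable g)
    {A : ℝ} (hA : ∀ x, ‖g x‖ ≤ A) {H β : ℝ} (hH0 : 0 ≤ H) (h0 : 0 ≤ β) (h1 : β ≤ 1)
    (hH : ∀ x y, ‖g x - g y‖ ≤ H * ‖x - y‖ ^ β) (x : Space d) :
    ‖heat ε σ g x - g x‖ ≤ H * (ε * √σ) ^ β * (1 + gaussMoment d) := by
  have i1 : Integrable (fun ζ => g (x - (ε * √σ) • ζ)) (gauss d) :=
    integrable_of_bounded_gauss (stronglyMeasurable_comp_sub_smul hg _ _) fun _ => hA _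
  have e : heat ε σ g x - g x = ∫ ζ, (g (x - (ε * √σ) • ζ) - g x) ∂(gauss d) := by
    rw [integral_sub i1 (integrable_const _)]
    simp [heat]
  have hc : 0 ≤ ε * √σ := by positivity
  rw [e]
  refine (norm_integral_le_of_norm_le (g := fun ζ => H * (ε * √σ) ^ β * (1 + ‖ζ‖))
    (((integrable_const _).add integrable_norm_gauss).const_mul _)
    (.of_forall fun ζ => (hH _ _).trans ?_)).trans (le_of_eq ?_)
  · rw [sub_sub_cancel_left, norm_neg, norm_smul, Real.norm_of_nonneg hc,
      Real.mul_rpow hc (norm_nonneg _), mul_assoc]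
    gcongr
    rcases le_total ‖ζ‖ 1 with h | h
    -- The bound |ζ|^β ≤ 1 + |ζ| reduces the fractional moment to the first moment.
    · exact (Real.rpow_le_one (norm_nonneg _) h h0).trans (by linarith [norm_nonneg ζ])
    · calc ‖ζ‖ ^ β ≤ ‖ζ‖ ^ (1 : ℝ) := Real.rpow_le_rpow_of_exponent_le h h1
        _ ≤ _ := by rw [Real.rpow_one]; linarith
  · rw [integral_const_mul, integral_add (integrable_const _) integrable_norm_gauss]
    simp [gaussMoment]

/-- One step of the splitting scheme. -/
def splitStep (ε : ℝ) (f : ℝ → Space d) (σ : ℝ) (g : Space d → ℝ) (x : Space d) : ℝ :=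
  heat ε σ g x + σ * flux ε σ (fun y => f (g y)) x

/-- The splitting scheme with time step `τ`. -/
def scheme (ε : ℝ) (f : ℝ → Space d) (τ : ℝ) (u : Space d → ℝ) : ℕ → Space d → ℝ
  | 0 => u
  | n + 1 => splitStep ε f τ (scheme ε f τ u n)

/-- The flux of the splitting scheme. -/
def schemeFlux (ε : ℝ) (f : ℝ → Space d) (τ : ℝ) (u : Space d → ℝ) (p : Space d × ℝ) : Space d :=
  heat ε (p.2 - ⌊p.2 / τ⌋₊ * τ) (fun y => f (scheme ε f τ u ⌊p.2 / τ⌋₊ y)) p.1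

/-! ### Growth of the splitting scheme and its exact mild representation -/

section

variable {f : ℝ → Space d} {B L ε : ℝ}

/-- If L|w| ≤ 1, the inner product is at most M - a and there is no excess. Otherwise it is at most
2B|w|, and multiplying by (L|w|)³ ≥ 1 gives the quartic term. -/
theorem inner_flux_upper (hf : BoundedLipschitz f B L) {a M : ℝ} (ha : |a| ≤ M) (w : Space d) :
    a + inner ℝ w (f a - f M) ≤ M + 2 * B * L ^ 3 * ‖w‖ ^ 4 := by
  have hB := hf.nonneg_bound
  have hL := hf.nonneg_lip
  have haM : a ≤ M := (le_abs_self a).trans ha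
  have h1 : inner ℝ w (f a - f M) ≤ ‖w‖ * ‖f a - f M‖ := real_inner_le_norm _ _
  have h2 : ‖f a - f M‖ ≤ L * (M - a) := by
    refine (hf.lip a M).trans (le_of_eq ?_)
    rw [abs_sub_comm, abs_of_nonneg (by linarith)]
  have h3 : ‖f a - f M‖ ≤ 2 * B := (norm_sub_le _ _).trans (by linarith [hf.bound a, hf.bound M])
  have hw := norm_nonneg w
  have h4 : 0 ≤ 2 * B * L ^ 3 * ‖w‖ ^ 4 := by positivity
  rcases le_total (‖w‖ * L) 1 with h | h
  · nlinarith [mul_le_mul_of_nonneg_left h2 hw, mul_le_mul_of_nonneg_right h (sub_nonneg.2 haM)]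
  · have h5 : 1 ≤ (‖w‖ * L) ^ 3 := one_le_pow₀ h
    have h6 : ‖w‖ * (2 * B) ≤ 2 * B * L ^ 3 * ‖w‖ ^ 4 := by
      calc ‖w‖ * (2 * B) = ‖w‖ * (2 * B) * 1 := (mul_one _).symm
        _ ≤ ‖w‖ * (2 * B) * (‖w‖ * L) ^ 3 := by gcongr
        _ = _ := by ring
    nlinarith [mul_le_mul_of_nonneg_left h3 hw]

/-- The upper estimate applied to -a and the reflected flux -f(-·). -/
theorem inner_flux_lower (hf : BoundedLipschitz f B L) {a M : ℝ} (ha : |a| ≤ M) (w : Space d) :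
    -(M + 2 * B * L ^ 3 * ‖w‖ ^ 4) ≤ a + inner ℝ w (f a - f (-M)) := by
  have hf' : BoundedLipschitz (fun a => -f (-a)) B L :=
    ⟨fun a => by simpa using hf.bound (-a), fun a b => by
      have := hf.lip (-a) (-b)
      rw [← neg_sub', abs_neg] at this
      rwa [← neg_sub', norm_neg]⟩
  have h := inner_flux_upper hf' (a := -a) (M := M) (by rwa [abs_neg]) w
  have e : inner ℝ w (-f (- -a) - -f (-M)) = -inner ℝ w (f a - f (-M)) := by
    rw [← inner_neg_right, neg_neg, neg_sub']
  rw [e] at h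
  linarith

/-- The Gaussian mean is zero, so any constant `c` may be subtracted from the flux; `f M` and `f
(-M)` will be used. The weight is σ/(ε√σ) = √σ/ε. -/
theorem splitStep_eq (hε : 0 < ε) (hf : BoundedLipschitz f B L) {σ : ℝ} (hσ : 0 ≤ σ)
    {g : Space d → ℝ} (hg : StronglyMeasurable g) {M : ℝ} (hM : ∀ x, ‖g x‖ ≤ M) (c : Space d)
    (x : Space d) :
    Integrable (fun ζ => g (x - (ε * √σ) • ζ)
      + inner ℝ ((√σ / ε) • ζ) (f (g (x - (ε * √σ) • ζ)) - c)) (gauss d) ∧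
    splitStep ε f σ g x = ∫ ζ, (g (x - (ε * √σ) • ζ)
      + inner ℝ ((√σ / ε) • ζ) (f (g (x - (ε * √σ) • ζ)) - c)) ∂(gauss d) := by
  have hg' := stronglyMeasurable_comp_sub_smul hg (ε * √σ) x
  have i1 : Integrable (fun ζ => g (x - (ε * √σ) • ζ)) (gauss d) :=
    integrable_of_bounded_gauss hg' fun _ => hM _
  have i2 : Integrable (fun ζ => inner ℝ ζ (f (g (x - (ε * √σ) • ζ)))) (gauss d) :=
    integrable_inner_gauss (hf.stronglyMeasurable_comp hg') fun _ => hf.bound _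
  have i3 : Integrable (fun ζ : Space d => inner ℝ ζ c) (gauss d) :=
    integrable_inner_gauss stronglyMeasurable_const fun _ => le_rfl
  have i4 : Integrable (fun ζ : Space d =>
      √σ / ε * (inner ℝ ζ (f (g (x - (ε * √σ) • ζ))) - inner ℝ ζ c)) (gauss d) :=
    (i2.sub i3).const_mul (√σ / ε)
  have e : ∀ ζ : Space d, inner ℝ ((√σ / ε) • ζ) (f (g (x - (ε * √σ) • ζ)) - c)
      = √σ / ε * (inner ℝ ζ (f (g (x - (ε * √σ) • ζ))) - inner ℝ ζ c) := by
    intro ζ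
    rw [real_inner_smul_left, inner_sub_right]
  simp only [e]
  refine ⟨i1.add i4, ?_⟩
  rw [integral_add i1 i4, integral_const_mul, integral_sub i2 i3, integral_inner_gauss, sub_zero,
    splitStep, heat, flux, integral_const_mul, ← mul_assoc]
  congr 2
  rcases hσ.eq_or_lt with rfl | h
  · simp
  · have : 0 < √σ := Real.sqrt_pos.2 h
    field_simp
    rw [Real.sq_sqrt hσ]

/-- The constant in the growth estimate of the splitting scheme. -/
def splitConst (d : ℕ) (ε B L : ℝ) : ℝ :=
  2 * B * L ^ 3 / ε ^ 4 * ∫ x : Space d, ‖x‖ ^ 4 ∂(gauss d)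

/-- The fourth power of √σ makes the excess quadratic in the step, so over T/τ steps it adds up to
O(τ). -/
theorem abs_splitStep_le (hε : 0 < ε) (hf : BoundedLipschitz f B L) {σ : ℝ} (hσ : 0 ≤ σ)
    {g : Space d → ℝ} (hg : StronglyMeasurable g) {M : ℝ} (hM : ∀ x, ‖g x‖ ≤ M) (x : Space d) :
    |splitStep ε f σ g x| ≤ M + splitConst d ε B L * σ ^ 2 := by
  have hi : Integrable (fun ζ : Space d => M + 2 * B * L ^ 3 * ‖(√σ / ε) • ζ‖ ^ 4) (gauss d) := by
    simp only [norm_smul, mul_pow]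
    exact (integrable_const _).add (((integrable_norm_pow_gauss 4).const_mul _).const_mul _)
  have he : ∫ ζ : Space d, (M + 2 * B * L ^ 3 * ‖(√σ / ε) • ζ‖ ^ 4) ∂(gauss d)
      = M + splitConst d ε B L * σ ^ 2 := by
    simp only [norm_smul, mul_pow]
    rw [integral_add (integrable_const _)
      (((integrable_norm_pow_gauss 4).const_mul _).const_mul _), integral_const_mul,
      integral_const_mul, Real.norm_of_nonneg (by positivity), div_pow,
      (by rw [← Real.sq_sqrt hσ, ← pow_mul, Real.sqrt_sq (Real.sqrt_nonneg _)] : √σ ^ 4 = σ ^ 2),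
      splitConst]
    simp
    ring
  rw [abs_le]
  constructor
  · obtain ⟨i, e⟩ := splitStep_eq hε hf hσ hg hM (f (-M)) x
    rw [e, ← he, ← integral_neg]
    exact integral_mono hi.neg i fun ζ => inner_flux_lower hf (hM _) _
  · obtain ⟨i, e⟩ := splitStep_eq hε hf hσ hg hM (f M) x
    rw [e, ← he]
    exact integral_mono i hi fun ζ => inner_flux_upper hf (hM _) _

theorem splitConst_nonneg (hε : 0 < ε) (hf : BoundedLipschitz f B L) :
    0 ≤ splitConst d ε B L := by
  have hB := hf.nonneg_bound
  have hL := hf.nonneg_lip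
  have : 0 ≤ ∫ x : Space d, ‖x‖ ^ 4 ∂(gauss d) := integral_nonneg fun _ => by positivity
  unfold splitConst
  positivity

theorem stronglyMeasurable_scheme (hf : BoundedLipschitz f B L) (τ : ℝ) {u : Space d → ℝ}
    (hu : StronglyMeasurable u) (n : ℕ) : StronglyMeasurable (scheme ε f τ u n) := by
  induction n with
  | zero => exact hu
  | succ n ih =>
    exact (stronglyMeasurable_heat ε τ ih).add
      ((stronglyMeasurable_flux ε τ (hf.stronglyMeasurable_comp ih)).const_mul τ)

theorem abs_scheme_le (hε : 0 < ε) (hf : BoundedLipschitz f B L) {τ : ℝ} (hτ : 0 ≤ τ)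
    {u : Space d → ℝ} (hu : StronglyMeasurable u) {A : ℝ} (hA : ∀ x, ‖u x‖ ≤ A) (n : ℕ)
    (x : Space d) : ‖scheme ε f τ u n x‖ ≤ A + n * (splitConst d ε B L * τ ^ 2) := by
  induction n generalizing x with
  | zero => simpa [scheme] using hA x
  | succ n ih =>
    refine (abs_splitStep_le hε hf hτ (stronglyMeasurable_scheme hf τ hu n) ih x).trans
      (le_of_eq ?_)
    push_cast
    ring

theorem stronglyMeasurable_schemeFlux (hf : BoundedLipschitz f B L) (τ : ℝ) {u : Space d → ℝ}
    (hu : StronglyMeasurable u) : StronglyMeasurable (schemeFlux ε f τ u) := by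
  have h1 : Measurable fun q : ℕ × Space d => f (scheme ε f τ u q.1 q.2) :=
    measurable_from_prod_countable_right fun n =>
      (hf.stronglyMeasurable_comp (stronglyMeasurable_scheme hf τ hu n)).measurable
  have h2 : Measurable fun p : Space d × ℝ => ⌊p.2 / τ⌋₊ := by fun_prop
  exact stronglyMeasurable_heat_param (α := Space d × ℝ) ε
    (K := fun a => f (scheme ε f τ u ⌊a.1.2 / τ⌋₊ a.2))
    ((h1.comp ((h2.comp measurable_fst).prodMk measurable_snd)).stronglyMeasurable)
    (measurable_snd.sub ((measurable_from_nat.comp h2).mul_const _)) measurable_fst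

theorem norm_schemeFlux_le (hf : BoundedLipschitz f B L) (τ : ℝ) (u : Space d → ℝ)
    (p : Space d × ℝ) : ‖schemeFlux ε f τ u p‖ ≤ B :=
  norm_heat_le ε _ (fun _ => hf.bound _) _

theorem floor_div_eq {τ : ℝ} (hτ : 0 < τ) {k : ℕ} {s : ℝ} (h1 : k * τ ≤ s) (h2 : s < (k + 1) * τ) :
    ⌊s / τ⌋₊ = k := by
  rw [Nat.floor_eq_iff (div_nonneg ((by positivity : (0 : ℝ) ≤ k * τ).trans h1) hτ.le),
    le_div_iff₀ hτ, div_lt_iff₀ hτ]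
  exact ⟨h1, h2⟩

/-- Within a time cell, `flux_heat` makes the Duhamel integrand independent of s: the smoothing
already in `schemeFlux` complements the remaining lag. Its integral is therefore the elapsed time
times one flux. -/
theorem mild_schemeFlux_of_eq (hε : 0 < ε) (hf : BoundedLipschitz f B L) {τ : ℝ} (hτ : 0 < τ)
    {u : Space d → ℝ} (hu : StronglyMeasurable u) {A : ℝ} (hA : ∀ x, ‖u x‖ ≤ A) (k : ℕ)
    (hk : ∀ x, mild ε u (schemeFlux ε f τ u) (x, k * τ) = scheme ε f τ u k x) (x : Space d) {t : ℝ}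
    (h1 : k * τ ≤ t) (h2 : t ≤ (k + 1) * τ) :
    mild ε u (schemeFlux ε f τ u) (x, t)
      = splitStep ε f (t - k * τ) (scheme ε f τ u k) x := by
  rcases h1.eq_or_lt with rfl | h1
  · simp [hk, splitStep, heat_zero]
  have hk0 : (0 : ℝ) ≤ k * τ := by positivity
  rw [mild_restart hε hu hA (stronglyMeasurable_schemeFlux hf τ hu) (norm_schemeFlux_le hf τ u) x
    hk0 h1, splitStep]
  simp only [hk]
  congr 1
  have e : ∀ s ∈ Ioo (k * τ) t, flux ε (t - s) (fun y => schemeFlux ε f τ u (y, s)) x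
      = flux ε (t - k * τ) (fun y => f (scheme ε f τ u k y)) x := by
    intro s hs
    have hfl := floor_div_eq hτ hs.1.le (hs.2.trans_le h2)
    have h3 := flux_heat hε (a := t - s) (b := s - k * τ) (sub_pos.2 hs.2) (sub_pos.2 hs.1).le
      (hf.stronglyMeasurable_comp (stronglyMeasurable_scheme (ε := ε) hf τ hu k))
      (fun y => hf.bound _) x
    rw [sub_add_sub_cancel] at h3
    rw [← h3]
    simp only [schemeFlux, hfl]
  rw [setIntegral_congr_fun measurableSet_Ioo e, setIntegral_const, Measure.real,
    Real.volume_Ioo, ENNReal.toReal_ofReal (sub_pos.2 h1).le, smul_eq_mul]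

theorem mild_schemeFlux_mul (hε : 0 < ε) (hf : BoundedLipschitz f B L) {τ : ℝ} (hτ : 0 < τ)
    {u : Space d → ℝ} (hu : StronglyMeasurable u) {A : ℝ} (hA : ∀ x, ‖u x‖ ≤ A) (k : ℕ)
    (x : Space d) : mild ε u (schemeFlux ε f τ u) (x, k * τ) = scheme ε f τ u k x := by
  induction k generalizing x with
  | zero => simp [mild, heat_zero, duhamel, scheme]
  | succ k ih =>
    have := mild_schemeFlux_of_eq hε hf hτ hu hA k ih x (t := (k + 1) * τ) (by nlinarith) le_rfl
    push_cast
    rw [this, scheme]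
    congr 1
    ring

theorem mild_schemeFlux (hε : 0 < ε) (hf : BoundedLipschitz f B L) {τ : ℝ} (hτ : 0 < τ)
    {u : Space d → ℝ} (hu : StronglyMeasurable u) {A : ℝ} (hA : ∀ x, ‖u x‖ ≤ A) (x : Space d)
    {t : ℝ} (ht : 0 ≤ t) :
    mild ε u (schemeFlux ε f τ u) (x, t)
      = splitStep ε f (t - ⌊t / τ⌋₊ * τ) (scheme ε f τ u ⌊t / τ⌋₊) x := by
  refine mild_schemeFlux_of_eq hε hf hτ hu hA _ (mild_schemeFlux_mul hε hf hτ hu hA _) x ?_ ?_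
  · rw [← le_div_iff₀ hτ]; exact Nat.floor_le (by positivity)
  · rw [← div_le_iff₀ hτ]; exact (Nat.lt_floor_add_one _).le

theorem abs_mild_schemeFlux_le (hε : 0 < ε) (hf : BoundedLipschitz f B L) {τ : ℝ} (hτ : 0 < τ)
    {u : Space d → ℝ} (hu : StronglyMeasurable u) {A : ℝ} (hA : ∀ x, ‖u x‖ ≤ A) (x : Space d)
    {t : ℝ} (ht : 0 ≤ t) :
    |mild ε u (schemeFlux ε f τ u) (x, t)| ≤ A + splitConst d ε B L * (t + τ) * τ := by
  have hC := splitConst_nonneg hε hf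
  have h1 : (⌊t / τ⌋₊ : ℝ) * τ ≤ t := by
    rw [← le_div_iff₀ hτ]; exact Nat.floor_le (by positivity)
  have h2 : t ≤ (⌊t / τ⌋₊ + 1) * τ := by
    rw [← div_le_iff₀ hτ]; exact (Nat.lt_floor_add_one _).le
  rw [mild_schemeFlux hε hf hτ hu hA x ht]
  refine (abs_splitStep_le hε hf (sub_nonneg.2 h1) (stronglyMeasurable_scheme hf τ hu _)
    (abs_scheme_le hε hf hτ.le hu hA _) x).trans ?_
  have h3 : (t - ⌊t / τ⌋₊ * τ) ^ 2 ≤ τ ^ 2 := pow_le_pow_left₀ (sub_nonneg.2 h1) (by linarith) 2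
  have h4 : ⌊t / τ⌋₊ * τ ^ 2 + (t - ⌊t / τ⌋₊ * τ) ^ 2 ≤ (t + τ) * τ := by nlinarith
  nlinarith [mul_le_mul_of_nonneg_left h4 hC]

/-! ### Consistency of the scheme and the limit of vanishing time step -/

theorem norm_residual_le_of_holder (hε : 0 < ε) (hf : BoundedLipschitz f B L) {σ : ℝ}
    (hσ : 0 ≤ σ) {g : Space d → ℝ} (hg : StronglyMeasurable g) {M : ℝ} (hM : ∀ x, ‖g x‖ ≤ M)
    {H : ℝ} (hH0 : 0 ≤ H) (hH : ∀ x y, |g x - g y| ≤ H * ‖x - y‖ ^ (1 / 2 : ℝ)) (x : Space d) :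
    ‖f (splitStep ε f σ g x) - heat ε σ (fun y => f (g y)) x‖
      ≤ 2 * L * (H * (ε * √σ) ^ (1 / 2 : ℝ) * (1 + gaussMoment d))
        + L * (gaussMoment d / ε * √σ * B) := by
  have hL := hf.nonneg_lip
  have h1 := norm_heat_sub_self_le hε σ hg hM hH0 (by norm_num) (by norm_num) hH x
  have h2 := norm_heat_sub_self_le hε σ (hf.stronglyMeasurable_comp hg) (fun _ => hf.bound _)
    (mul_nonneg hL hH0) (β := 1 / 2) (by norm_num) (by norm_num)
    (fun x y => (hf.lip _ _).trans (by
      rw [mul_assoc]; exact mul_le_mul_of_nonneg_left (hH x y) hL)) x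
  have h3 : |σ * flux ε σ (fun y => f (g y)) x| ≤ gaussMoment d / ε * √σ * B := by
    rw [abs_mul, abs_of_nonneg hσ]
    refine (mul_le_mul_of_nonneg_left (abs_flux_le hε σ (fun y => hf.bound (g y)) x) hσ).trans
      (le_of_eq ?_)
    have : σ * (√σ)⁻¹ = √σ := by rw [← div_eq_mul_inv, Real.div_sqrt]
    linear_combination (gaussMoment d / ε * B) * this
  have h4 : |splitStep ε f σ g x - g x| ≤ H * (ε * √σ) ^ (1 / 2 : ℝ) * (1 + gaussMoment d)
      + gaussMoment d / ε * √σ * B := by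
    have e : splitStep ε f σ g x - g x
        = (heat ε σ g x - g x) + σ * flux ε σ (fun y => f (g y)) x := by
      unfold splitStep; ring
    rw [e]
    exact (abs_add_le _ _).trans (add_le_add h1 h3)
  -- Both terms of the residual are compared with `f (g x)`, which Hölder continuity of `g` keeps
  -- close to each.
  have h5 := norm_sub_le_norm_sub_add_norm_sub (f (splitStep ε f σ g x)) (f (g x))
    (heat ε σ (fun y => f (g y)) x)
  rw [norm_sub_rev (f (g x))] at h5
  have h6 := (hf.lip (splitStep ε f σ g x) (g x)).trans (mul_le_mul_of_nonneg_left h4 hL)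
  linarith

/-- Smoothing makes the iterates 1/2-Hölder with constant of order s^(-1/4), and a displacement of
order √τ costs τ^(1/4). The weight in s remains integrable against the Duhamel kernel. -/
theorem exists_residual_le (hε : 0 < ε) (hf : BoundedLipschitz f B L) {u : Space d → ℝ}
    (hu : StronglyMeasurable u) {A : ℝ} (hA : ∀ x, ‖u x‖ ≤ A) {T : ℝ} (hT : 0 < T) :
    ∃ C : ℝ, 0 ≤ C ∧ ∀ τ : ℝ, 0 < τ → ∀ s ∈ Ioo 0 T, ∀ x : Space d,
      ‖schemeFlux ε f τ u (x, s) - f (mild ε u (schemeFlux ε f τ u) (x, s))‖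
        ≤ C * τ ^ (1 / 4 : ℝ) * s ^ (-(1 / 4) : ℝ) := by
  obtain ⟨K, hK0, hK⟩ := exists_abs_mild_sub_le d hε (β := 1 / 2) (by norm_num) (by norm_num)
  have hB := hf.nonneg_bound
  have hL := hf.nonneg_lip
  have hA0 : 0 ≤ A := (norm_nonneg _).trans (hA 0)
  have hM := gaussMoment_nonneg (d := d)
  set c1 := 2 * L * (K * (A * 2 + B * T ^ (1 / 2 : ℝ)) * ε ^ (1 / 2 : ℝ) * (1 + gaussMoment d))
    with hc1
  set c2 := L * (gaussMoment d / ε * T ^ (1 / 2 : ℝ) * B) with hc2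
  have hc10 : 0 ≤ c1 := by positivity
  have hc20 : 0 ≤ c2 := by positivity
  refine ⟨2 * B + (c1 + c2), by positivity, fun τ hτ s hs x => ?_⟩
  have hs0 : 0 < s := hs.1
  have hq : 0 ≤ τ ^ (1 / 4 : ℝ) * s ^ (-(1 / 4) : ℝ) := by positivity
  set k := ⌊s / τ⌋₊ with hk
  have h1 : (k : ℝ) * τ ≤ s := by
    rw [← le_div_iff₀ hτ]; exact Nat.floor_le (by positivity)
  have h2 : s < (k + 1) * τ := by
    rw [← div_lt_iff₀ hτ]; exact Nat.lt_floor_add_one _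
  -- In the first cell the datum has no modulus of continuity, but s ≤ τ makes the weight at least 1
  -- and the trivial bound 2B suffices. In later cells kτ ≥ s/2.
  rcases Nat.eq_zero_or_pos k with h0 | h0
  · have hsτ : s ≤ τ := by rw [h0] at h2; push_cast at h2; linarith
    have h3 : 1 ≤ τ ^ (1 / 4 : ℝ) * s ^ (-(1 / 4) : ℝ) := by
      rw [Real.rpow_neg hs0.le, ← div_eq_mul_inv, one_le_div (by positivity)]
      exact Real.rpow_le_rpow hs0.le hsτ (by norm_num)
    refine (norm_sub_le _ _).trans ((add_le_add (norm_schemeFlux_le hf τ u _)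
      (hf.bound _)).trans ?_)
    rw [mul_assoc]
    nlinarith [mul_nonneg hB hq, mul_nonneg (add_nonneg hc10 hc20) hq]
  · have hk1 : (1 : ℝ) ≤ k := by exact_mod_cast h0
    set tk := (k : ℝ) * τ with htk
    have htk0 : 0 < tk := by positivity
    have htk2 : s / 2 ≤ tk := by nlinarith
    set σ := s - tk with hσ
    have hσ0 : 0 ≤ σ := sub_nonneg.2 h1
    have hστ : σ ≤ τ := by rw [hσ, htk]; linarith
    have hσs : σ ≤ s := by linarith
    have hH : ∀ x y, |scheme ε f τ u k x - scheme ε f τ u k y|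
        ≤ K * (A * tk ^ (-(1 / 4) : ℝ) + B * tk ^ (1 / 4 : ℝ)) * ‖x - y‖ ^ (1 / 2 : ℝ) := by
      intro x y
      rw [← mild_schemeFlux_mul hε hf hτ hu hA, ← mild_schemeFlux_mul hε hf hτ hu hA]
      have := hK u hu _ (stronglyMeasurable_schemeFlux (ε := ε) hf τ hu) A B hA
        (norm_schemeFlux_le hf τ u) tk htk0 x y
      norm_num at this ⊢
      exact this
    have h3 := norm_residual_le_of_holder hε hf hσ0 (stronglyMeasurable_scheme (ε := ε) hf τ hu k)
      (abs_scheme_le hε hf hτ.le hu hA k) (by positivity) hH x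
    rw [mild_schemeFlux hε hf hτ hu hA x hs0.le, norm_sub_rev]
    refine h3.trans ?_
    have e1 : tk ^ (-(1 / 4) : ℝ) ≤ 2 * s ^ (-(1 / 4) : ℝ) := by
      calc tk ^ (-(1 / 4) : ℝ) ≤ (s / 2) ^ (-(1 / 4) : ℝ) :=
            Real.rpow_le_rpow_of_nonpos (by positivity) htk2 (by norm_num)
        _ = 2 ^ (1 / 4 : ℝ) * s ^ (-(1 / 4) : ℝ) := by
            rw [Real.div_rpow hs0.le (by norm_num), Real.rpow_neg (by norm_num : (0 : ℝ) ≤ 2)]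
            field_simp
        _ ≤ 2 ^ (1 : ℝ) * s ^ (-(1 / 4) : ℝ) := by
            gcongr <;> norm_num
        _ = _ := by rw [Real.rpow_one]
    have e2 : s ^ (1 / 4 : ℝ) ≤ T ^ (1 / 2 : ℝ) * s ^ (-(1 / 4) : ℝ) := by
      calc s ^ (1 / 4 : ℝ) = s ^ (1 / 2 : ℝ) * s ^ (-(1 / 4) : ℝ) := by
            rw [← Real.rpow_add hs0]; norm_num
        _ ≤ _ := by gcongr; exact hs.2.le
    have e3 : tk ^ (1 / 4 : ℝ) ≤ T ^ (1 / 2 : ℝ) * s ^ (-(1 / 4) : ℝ) :=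
      (Real.rpow_le_rpow htk0.le h1 (by norm_num)).trans e2
    have e4 : √σ ≤ τ ^ (1 / 4 : ℝ) * (T ^ (1 / 2 : ℝ) * s ^ (-(1 / 4) : ℝ)) := by
      have : √σ = σ ^ (1 / 4 : ℝ) * σ ^ (1 / 4 : ℝ) := by
        rw [Real.sqrt_eq_rpow, ← Real.rpow_add_of_nonneg hσ0 (by norm_num) (by norm_num)]
        norm_num
      rw [this]
      refine mul_le_mul (Real.rpow_le_rpow hσ0 hστ (by norm_num))
        ((Real.rpow_le_rpow hσ0 hσs (by norm_num)).trans e2) (by positivity) (by positivity)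
    have e5 : (ε * √σ) ^ (1 / 2 : ℝ) ≤ ε ^ (1 / 2 : ℝ) * τ ^ (1 / 4 : ℝ) := by
      rw [Real.mul_rpow hε.le (Real.sqrt_nonneg _), Real.sqrt_eq_rpow σ, ← Real.rpow_mul hσ0]
      gcongr
      norm_num only
      exact Real.rpow_le_rpow hσ0 hστ (by norm_num)
    calc _ ≤ 2 * L * (K * (A * (2 * s ^ (-(1 / 4) : ℝ))
            + B * (T ^ (1 / 2 : ℝ) * s ^ (-(1 / 4) : ℝ))) * (ε ^ (1 / 2 : ℝ) * τ ^ (1 / 4 : ℝ))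
            * (1 + gaussMoment d))
          + L * (gaussMoment d / ε * (τ ^ (1 / 4 : ℝ) * (T ^ (1 / 2 : ℝ) * s ^ (-(1 / 4) : ℝ)))
            * B) := by gcongr
      _ = (c1 + c2) * (τ ^ (1 / 4 : ℝ) * s ^ (-(1 / 4) : ℝ)) := by rw [hc1, hc2]; ring
      _ ≤ (2 * B + (c1 + c2)) * (τ ^ (1 / 4 : ℝ) * s ^ (-(1 / 4) : ℝ)) := by
          refine mul_le_mul_of_nonneg_right ?_ hq
          linarith
      _ = _ := by ring

/-- The product is at most the power -3/4 of the smaller of s and t - s. The two resulting integrals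
are 4 t^(1/4) each. -/
theorem setIntegral_beta_le {t : ℝ} (ht : 0 < t) :
    IntegrableOn (fun s : ℝ => (t - s) ^ (-(1 / 2) : ℝ) * s ^ (-(1 / 4) : ℝ)) (Ioo 0 t) ∧
    ∫ s in Ioo 0 t, (t - s) ^ (-(1 / 2) : ℝ) * s ^ (-(1 / 4) : ℝ) ≤ 8 * t ^ (1 / 4 : ℝ) := by
  have hi : IntegrableOn (fun s : ℝ => (t - s) ^ (-(3 / 4) : ℝ) + s ^ (-(3 / 4) : ℝ))
      (Ioo 0 t) :=
    (integrableOn_sub_rpow (by norm_num) ht.le).add (integrableOn_rpow_Ioo (by norm_num) ht.le)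
  have hle : ∀ s ∈ Ioo 0 t, (t - s) ^ (-(1 / 2) : ℝ) * s ^ (-(1 / 4) : ℝ)
      ≤ (t - s) ^ (-(3 / 4) : ℝ) + s ^ (-(3 / 4) : ℝ) := by
    intro s hs
    have hs1 : 0 < t - s := sub_pos.2 hs.2
    have hs0 : 0 < s := hs.1
    rcases le_total s (t - s) with h | h
    · have h1 := Real.rpow_le_rpow_of_nonpos hs0 h (by norm_num : (-(1 / 2) : ℝ) ≤ 0)
      calc _ ≤ s ^ (-(1 / 2) : ℝ) * s ^ (-(1 / 4) : ℝ) := by gcongr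
        _ = s ^ (-(3 / 4) : ℝ) := by rw [← Real.rpow_add hs0]; norm_num
        _ ≤ _ := le_add_of_nonneg_left (by positivity)
    · have h1 := Real.rpow_le_rpow_of_nonpos hs1 h (by norm_num : (-(1 / 4) : ℝ) ≤ 0)
      calc _ ≤ (t - s) ^ (-(1 / 2) : ℝ) * (t - s) ^ (-(1 / 4) : ℝ) := by gcongr
        _ = (t - s) ^ (-(3 / 4) : ℝ) := by rw [← Real.rpow_add hs1]; norm_num
        _ ≤ _ := le_add_of_nonneg_right (by positivity)
  have hint : IntegrableOn (fun s : ℝ => (t - s) ^ (-(1 / 2) : ℝ) * s ^ (-(1 / 4) : ℝ))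
      (Ioo 0 t) := by
    refine hi.mono' (by fun_prop : Measurable fun s : ℝ =>
      (t - s) ^ (-(1 / 2) : ℝ) * s ^ (-(1 / 4) : ℝ)).aestronglyMeasurable ?_
    filter_upwards [ae_restrict_mem measurableSet_Ioo] with s hs
    have hs1 : 0 < t - s := sub_pos.2 hs.2
    have hs0 : 0 < s := hs.1
    rw [Real.norm_of_nonneg (by positivity)]
    exact hle s hs
  refine ⟨hint, (setIntegral_mono_on hint hi measurableSet_Ioo hle).trans (le_of_eq ?_)⟩
  rw [integral_add (integrableOn_sub_rpow (by norm_num) ht.le)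
    (integrableOn_rpow_Ioo (by norm_num) ht.le), setIntegral_sub_rpow (by norm_num) ht.le,
    setIntegral_rpow_Ioo (by norm_num) ht.le, sub_zero]
  norm_num
  ring

theorem abs_mild_fixedPoint_le (hε : 0 < ε) (hf : BoundedLipschitz f B L) {u : Space d → ℝ}
    (hu : StronglyMeasurable u) {A : ℝ} (hA : ∀ x, ‖u x‖ ≤ A) {m : Space d × ℝ → ℝ}
    (hm : StronglyMeasurable m)
    (hfix : ∀ x t, 0 < t → m (x, t) = mild ε u (fun p => f (m p)) (x, t)) (x : Space d) {t : ℝ}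
    (ht : 0 < t) : |m (x, t)| ≤ A := by
  -- Any horizon beyond `t` would do, since the stability estimate is stated on an open interval.
  set T := t + 1 with hT
  have hT0 : 0 < T := by linarith
  have hB := hf.nonneg_bound
  have hκ : 0 ≤ gaussMoment d / ε := div_nonneg gaussMoment_nonneg hε.le
  obtain ⟨C1, hC1, h1⟩ := exists_residual_le hε hf hu hA hT0
  obtain ⟨C2, hC2, h2⟩ := exists_mild_stability hε hf T
  set D := gaussMoment d / ε * (C1 * (8 * T ^ (1 / 4 : ℝ))) with hD
  have hD0 : 0 ≤ D := by positivity
  set R := A + gaussMoment d / ε * (2 * √T) * B with hR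
  have bound : ∀ (F : Space d × ℝ → Space d), (∀ p, ‖F p‖ ≤ B) → ∀ x, ∀ t ∈ Ioo 0 T,
      |mild ε u F (x, t)| ≤ R := by
    intro F hF x t ht
    refine (abs_mild_le hε hA hF ht.1.le x).trans ?_
    rw [hR]
    gcongr
    exact ht.2.le
  have key : ∀ τ : ℝ, 0 < τ →
      |m (x, t)| ≤ A + splitConst d ε B L * (t + τ) * τ + C2 * (D * τ ^ (1 / 4 : ℝ)) := by
    intro τ hτ
    have hv := stronglyMeasurable_mild ε hu (stronglyMeasurable_schemeFlux (ε := ε) hf τ hu)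
    have h3 := h2 u (mild ε u (schemeFlux ε f τ u)) m hv hm (2 * R) (D * τ ^ (1 / 4 : ℝ))
      (by positivity) ?_ ?_ (fun x t ht => hfix x t ht.1) x t ⟨ht, by linarith⟩
    · have h4 := abs_mild_schemeFlux_le hε hf hτ hu hA x ht.le
      have h5 : |m (x, t)| ≤ |mild ε u (schemeFlux ε f τ u) (x, t)|
          + |mild ε u (schemeFlux ε f τ u) (x, t) - m (x, t)| := by
        have := abs_sub_abs_le_abs_sub (m (x, t)) (mild ε u (schemeFlux ε f τ u) (x, t))
        rw [abs_sub_comm] at this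
        linarith
      linarith
    · intro x t ht
      have a1 := bound _ (norm_schemeFlux_le (ε := ε) hf τ u) x t ht
      have a2 := bound (fun p => f (m p)) (fun p => hf.bound _) x t ht
      rw [← hfix x t ht.1] at a2
      refine (abs_sub _ _).trans ?_
      linarith
    · intro x t ht
      obtain ⟨b1, b2⟩ := setIntegral_beta_le ht.1
      have e : ∀ s, (t - s) ^ (-(1 / 2) : ℝ) * (C1 * τ ^ (1 / 4 : ℝ) * s ^ (-(1 / 4) : ℝ))
          = C1 * τ ^ (1 / 4 : ℝ) * ((t - s) ^ (-(1 / 2) : ℝ) * s ^ (-(1 / 4) : ℝ)) :=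
        fun s => by ring
      have h3 := abs_duhamel_sub_le hε (stronglyMeasurable_schemeFlux (ε := ε) hf τ hu)
        (hf.stronglyMeasurable_comp hv) (norm_schemeFlux_le hf τ u) (fun p => hf.bound _) ht.1.le
        (a := fun s => C1 * τ ^ (1 / 4 : ℝ) * s ^ (-(1 / 4) : ℝ))
        (fun s hs y => h1 τ hτ s ⟨hs.1, hs.2.trans ht.2⟩ y)
        (by simp only [e]; exact b1.const_mul _) x
      simp only [e] at h3
      rw [integral_const_mul] at h3
      have e2 : mild ε u (schemeFlux ε f τ u) (x, t)
          - mild ε u (fun p => f (mild ε u (schemeFlux ε f τ u) p)) (x, t)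
          = duhamel ε (schemeFlux ε f τ u) (x, t)
            - duhamel ε (fun p => f (mild ε u (schemeFlux ε f τ u) p)) (x, t) := by
        simp only [mild]; ring
      rw [e2]
      refine h3.trans ?_
      calc _ ≤ gaussMoment d / ε * (C1 * τ ^ (1 / 4 : ℝ) * (8 * T ^ (1 / 4 : ℝ))) := by
            have : t ^ (1 / 4 : ℝ) ≤ T ^ (1 / 4 : ℝ) :=
              Real.rpow_le_rpow ht.1.le ht.2.le (by norm_num)
            gcongr
            linarith
        _ = _ := by rw [hD]; ring
  have hlim : Tendsto (fun τ : ℝ => A + splitConst d ε B L * (t + τ) * τ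
      + C2 * (D * τ ^ (1 / 4 : ℝ))) (𝓝[>] 0) (𝓝 A) := by
    have hc : ContinuousAt (fun τ : ℝ => A + splitConst d ε B L * (t + τ) * τ
      + C2 * (D * τ ^ (1 / 4 : ℝ))) 0 := by
      have : ContinuousAt (fun τ : ℝ => τ ^ (1 / 4 : ℝ)) 0 :=
        Real.continuousAt_rpow_const _ _ (Or.inr (by norm_num))
      fun_prop
    have h := hc.tendsto.mono_left (nhdsWithin_le_nhds (s := Ioi 0))
    simpa using h
  exact ge_of_tendsto hlim (by filter_upwards [self_mem_nhdsWithin] with τ hτ using key τ hτ)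

end

/-! ### The backward heat operator on test functions -/

/-- The directional derivative on space-time. -/
def dder (v : Space d × ℝ) (φ : Space d × ℝ → ℝ) (p : Space d × ℝ) : ℝ := fderiv ℝ φ p v

/-- The `i`-th spatial basis vector of space-time. -/
def basisVec (i : Fin d) : Space d × ℝ := (EuclideanSpace.single i 1, 0)

/-- The backward heat operator `∂ₜ + (ε² / 2) Δ`. -/
def heatOp (ε : ℝ) (φ : Space d × ℝ → ℝ) (p : Space d × ℝ) : ℝ :=
  dder (0, 1) φ p + ε ^ 2 / 2 * ∑ i, dder (basisVec i) (dder (basisVec i) φ) p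

/-- Smooth functions with compact support on space-time. -/
structure IsBump (φ : Space d × ℝ → ℝ) : Prop where
  smooth : ContDiff ℝ ∞ φ
  compact : HasCompactSupport φ

theorem contDiff_dder {φ : Space d × ℝ → ℝ} (hφ : ContDiff ℝ ∞ φ) (v : Space d × ℝ) :
    ContDiff ℝ ∞ (dder v φ) :=
  (hφ.fderiv_right (by simp)).clm_apply contDiff_const

theorem tsupport_dder_subset (φ : Space d × ℝ → ℝ) (v : Space d × ℝ) :
    tsupport (dder v φ) ⊆ tsupport φ := by
  refine (closure_mono fun p hp => ?_).trans (tsupport_fderiv_subset ℝ (f := φ))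
  intro h
  exact hp (by simp [dder, h])

theorem contDiff_heatOp {φ : Space d × ℝ → ℝ} (hφ : ContDiff ℝ ∞ φ) (ε : ℝ) :
    ContDiff ℝ ∞ (heatOp ε φ) :=
  (contDiff_dder hφ _).add
    (contDiff_const.mul (ContDiff.sum fun _ _ => contDiff_dder (contDiff_dder hφ _) _))

theorem support_heatOp_subset (φ : Space d × ℝ → ℝ) (ε : ℝ) :
    Function.support (heatOp ε φ) ⊆ tsupport φ := by
  intro p hp
  by_contra h
  refine hp ?_
  have h1 : ∀ v, dder v φ p = 0 := fun v =>
    image_eq_zero_of_notMem_tsupport fun h2 => h (tsupport_dder_subset _ _ h2)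
  have h2 : ∀ v w, dder v (dder w φ) p = 0 := fun v w =>
    image_eq_zero_of_notMem_tsupport fun h2 =>
      h (tsupport_dder_subset _ _ (tsupport_dder_subset _ _ h2))
  simp [heatOp, h1, h2]

theorem tsupport_heatOp_subset (φ : Space d × ℝ → ℝ) (ε : ℝ) :
    tsupport (heatOp ε φ) ⊆ tsupport φ :=
  closure_minimal (support_heatOp_subset φ ε) (isClosed_tsupport _)

namespace IsBump

variable {φ : Space d × ℝ → ℝ}

theorem dder (hφ : IsBump φ) (v : Space d × ℝ) : IsBump (dder v φ) :=
  ⟨contDiff_dder hφ.smooth v, hφ.compact.mono' ((subset_tsupport _).trans (tsupport_dder_subset φ v))⟩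

theorem heatOp (hφ : IsBump φ) (ε : ℝ) : IsBump (heatOp ε φ) :=
  ⟨contDiff_heatOp hφ.smooth ε, hφ.compact.mono' (support_heatOp_subset φ ε)⟩

theorem exists_bound (hφ : IsBump φ) : ∃ C, 0 ≤ C ∧ ∀ p, |φ p| ≤ C := by
  obtain ⟨C, hC⟩ := hφ.compact.exists_bound_of_continuous hφ.smooth.continuous
  exact ⟨C, (norm_nonneg _).trans (hC 0), hC⟩

theorem exists_bound_fderiv (hφ : IsBump φ) : ∃ C, 0 ≤ C ∧ ∀ p, ‖fderiv ℝ φ p‖ ≤ C := by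
  obtain ⟨C, hC⟩ := (hφ.compact.fderiv ℝ).exists_bound_of_continuous
    (hφ.smooth.continuous_fderiv (by simp))
  exact ⟨C, (norm_nonneg _).trans (hC 0), hC⟩

theorem integrable (hφ : IsBump φ) : Integrable φ :=
  hφ.smooth.continuous.integrable_of_hasCompactSupport hφ.compact

end IsBump

theorem dder_comm {φ : Space d × ℝ → ℝ} (hφ : ContDiff ℝ ∞ φ) (v w : Space d × ℝ) :
    dder v (dder w φ) = dder w (dder v φ) := by
  ext p
  have hd : DifferentiableAt ℝ (fderiv ℝ φ) p :=
    (hφ.fderiv_right (m := ∞) (by simp)).differentiable (by simp) p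
  have e : ∀ v w, dder v (dder w φ) p = fderiv ℝ (fderiv ℝ φ) p v w := by
    intro v w
    change fderiv ℝ (fun q => fderiv ℝ φ q w) p v = _
    rw [fderiv_clm_apply hd (differentiableAt_const w)]
    simp
  rw [e, e]
  exact (hφ.contDiffAt.isSymmSndFDerivAt
    (by simp; exact WithTop.coe_le_coe.2 (le_top : (2 : ℕ∞) ≤ ⊤))).eq v w

theorem dder_add {φ ψ : Space d × ℝ → ℝ} (hφ : ContDiff ℝ ∞ φ) (hψ : ContDiff ℝ ∞ ψ)
    (v : Space d × ℝ) : dder v (fun p => φ p + ψ p) = fun p => dder v φ p + dder v ψ p := by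
  ext p
  unfold dder
  rw [fderiv_fun_add (hφ.differentiable (by simp) p) (hψ.differentiable (by simp) p)]
  rfl

theorem dder_mul {φ ψ : Space d × ℝ → ℝ} (hφ : ContDiff ℝ ∞ φ) (hψ : ContDiff ℝ ∞ ψ)
    (v : Space d × ℝ) :
    dder v (fun p => φ p * ψ p) = fun p => φ p * dder v ψ p + ψ p * dder v φ p := by
  ext p
  unfold dder
  rw [fderiv_fun_mul (hφ.differentiable (by simp) p) (hψ.differentiable (by simp) p)]
  simp

theorem dder_heatOp {φ : Space d × ℝ → ℝ} (hφ : ContDiff ℝ ∞ φ) (ε : ℝ) (v : Space d × ℝ) :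
    dder v (heatOp ε φ) = heatOp ε (dder v φ) := by
  ext p
  have h1 : ∀ w, DifferentiableAt ℝ (dder w φ) p := fun w =>
    (contDiff_dder hφ w).differentiable (by simp) p
  have h2 : ∀ i, DifferentiableAt ℝ (dder (basisVec i) (dder (basisVec i) φ)) p := fun i =>
    (contDiff_dder (contDiff_dder hφ _) _).differentiable (by simp) p
  have e : dder v (heatOp ε φ) p = dder v (dder (0, 1) φ) p
      + ε ^ 2 / 2 * ∑ i, dder v (dder (basisVec i) (dder (basisVec i) φ)) p := by
    change fderiv ℝ (fun q => dder (0, 1) φ q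
      + ε ^ 2 / 2 * ∑ i, dder (basisVec i) (dder (basisVec i) φ) q) p v = _
    rw [fderiv_fun_add (h1 _) ((DifferentiableAt.fun_sum fun i _ => h2 i).const_mul _),
      fderiv_const_mul (DifferentiableAt.fun_sum fun i _ => h2 i),
      fderiv_fun_sum fun i _ => h2 i]
    simp [dder]
  rw [e, heatOp, dder_comm hφ v]
  congr 2
  refine Finset.sum_congr rfl fun i _ => ?_
  rw [dder_comm (contDiff_dder hφ _) v, dder_comm hφ v]

/-! ### Averages of translates -/

theorem hasFDerivAt_integral_translate {V F Θ : Type*} [NormedAddCommGroup V] [NormedSpace ℝ V]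
    [NormedAddCommGroup F] [NormedSpace ℝ F] [MeasurableSpace Θ] [MeasurableSpace V] [BorelSpace V]
    [SecondCountableTopology V] (μ : Measure Θ) [IsFiniteMeasure μ] {a : Θ → V} (ha : Measurable a)
    {ψ : V → F} (hψ : ContDiff ℝ 1 ψ) (hc : HasCompactSupport ψ) (p : V) :
    HasFDerivAt (fun p => ∫ θ, ψ (p + a θ) ∂μ) (∫ θ, fderiv ℝ ψ (p + a θ) ∂μ) p := by
  obtain ⟨C, hC⟩ := hc.exists_bound_of_continuous hψ.continuous
  have hψ' : Continuous (fderiv ℝ ψ) := hψ.continuous_fderiv one_ne_zero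
  obtain ⟨C', hC'⟩ := (hc.fderiv ℝ).exists_bound_of_continuous hψ'
  have hm : ∀ q, AEStronglyMeasurable (fun θ => ψ (q + a θ)) μ := fun q =>
    (hψ.continuous.stronglyMeasurable.comp_measurable (by fun_prop)).aestronglyMeasurable
  refine hasFDerivAt_integral_of_dominated_of_fderiv_le (s := univ) (bound := fun _ => C')
    (F' := fun q θ => fderiv ℝ ψ (q + a θ)) univ_mem (.of_forall hm)
    (.of_bound (hm p) C (.of_forall fun θ => hC _))
    (hψ'.stronglyMeasurable.comp_measurable (by fun_prop)).aestronglyMeasurable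
    (.of_forall fun θ q _ => hC' _) (integrable_const _) (.of_forall fun θ q _ => ?_)
  exact (hasFDerivAt_comp_add_right (a θ)).2
    (hψ.differentiable one_ne_zero (q + a θ)).hasFDerivAt

/-- The derivative is the same average of the derivative, so induction works once the target space
varies. All types lie in one universe so that spaces of continuous linear maps are again admissible
targets. -/
theorem contDiff_integral_translate {V Θ : Type} [NormedAddCommGroup V] [NormedSpace ℝ V]
    [MeasurableSpace Θ] [MeasurableSpace V] [BorelSpace V]
    [SecondCountableTopology V] (μ : Measure Θ) [IsFiniteMeasure μ] {a : Θ → V} (ha : Measurable a)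
    (n : ℕ) : ∀ {F : Type} [NormedAddCommGroup F] [NormedSpace ℝ F] {ψ : V → F}
    (_ : ContDiff ℝ ∞ ψ) (_ : HasCompactSupport ψ),
      ContDiff ℝ n (fun p => ∫ θ, ψ (p + a θ) ∂μ) := by
  induction n with
  | zero =>
    intro F _ _ ψ hψ hc
    refine contDiff_zero.2 (continuous_iff_continuousAt.2 fun p => ?_)
    exact (hasFDerivAt_integral_translate μ ha (hψ.of_le (by simp)) hc p).continuousAt
  | succ n ih =>
    intro F _ _ ψ hψ hc
    push_cast
    rw [contDiff_succ_iff_hasFDerivAt]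
    exact ⟨_, ih (hψ.fderiv_right (by simp)) (hc.fderiv ℝ),
      hasFDerivAt_integral_translate μ ha (hψ.of_le (by simp)) hc⟩

/-! ### The fundamental solution of the backward heat equation -/

/-- The space-time displacement by a Brownian increment. -/
def displacement (ε : ℝ) (θ : ℝ × Space d) : Space d × ℝ := ((ε * √θ.1) • θ.2, θ.1)

theorem measurable_displacement (ε : ℝ) :
    Measurable (displacement ε : ℝ × Space d → Space d × ℝ) := by
  unfold displacement; fun_prop

/-- The product of Lebesgue measure on `(0, A)` and the Gaussian measure. -/
def pathMeasure (d : ℕ) (A : ℝ) : Measure (ℝ × Space d) := (timeMeasure A).prod (gauss d)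

instance (A : ℝ) : IsFiniteMeasure (timeMeasure A) :=
  ⟨by simp [timeMeasure]⟩

instance (A : ℝ) : IsFiniteMeasure (pathMeasure d A) := by
  unfold pathMeasure; infer_instance

/-- The solution operator of the backward heat equation, truncated at the time lag `A`. -/
def backward (ε A : ℝ) (ψ : Space d × ℝ → ℝ) (p : Space d × ℝ) : ℝ :=
  ∫ θ, ψ (p + displacement ε θ) ∂(pathMeasure d A)

theorem contDiff_backward (ε A : ℝ) {ψ : Space d × ℝ → ℝ} (hψ : IsBump ψ) :
    ContDiff ℝ ∞ (backward ε A ψ) :=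
  contDiff_infty.2 fun n => contDiff_integral_translate _ (measurable_displacement ε) n
    hψ.smooth hψ.compact

theorem integrable_pathMeasure_translate (ε A : ℝ) {ψ : Space d × ℝ → ℝ} (hψ : IsBump ψ)
    (p : Space d × ℝ) :
    Integrable (fun θ => ψ (p + displacement ε θ)) (pathMeasure d A) := by
  obtain ⟨C, -, hC⟩ := hψ.exists_bound
  have hd := measurable_displacement (d := d) ε
  exact .of_bound (hψ.smooth.continuous.measurable.comp
    (measurable_const.add hd)).aestronglyMeasurable C (.of_forall fun θ => hC _)

theorem dder_backward (ε A : ℝ) {ψ : Space d × ℝ → ℝ} (hψ : IsBump ψ) (v : Space d × ℝ) :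
    dder v (backward ε A ψ) = backward ε A (dder v ψ) := by
  ext p
  have h := hasFDerivAt_integral_translate (pathMeasure d A) (measurable_displacement ε)
    (hψ.smooth.of_le (by simp)) hψ.compact p
  obtain ⟨C, -, hC⟩ := hψ.exists_bound_fderiv
  have hd := measurable_displacement (d := d) ε
  have hi : Integrable (fun θ => fderiv ℝ ψ (p + displacement ε θ)) (pathMeasure d A) :=
    .of_bound ((hψ.smooth.continuous_fderiv (by simp)).stronglyMeasurable.comp_measurable
      (measurable_const.add hd)).aestronglyMeasurable C (.of_forall fun θ => hC _)
  change fderiv ℝ (fun p => ∫ θ, ψ (p + displacement ε θ) ∂(pathMeasure d A)) p v = _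
  rw [h.fderiv, ContinuousLinearMap.integral_apply hi]
  rfl

theorem heatOp_backward (ε A : ℝ) {ψ : Space d × ℝ → ℝ} (hψ : IsBump ψ) :
    heatOp ε (backward ε A ψ) = backward ε A (heatOp ε ψ) := by
  ext p
  have i1 := fun v => integrable_pathMeasure_translate ε A (hψ.dder v) p
  have i2 := fun v w => integrable_pathMeasure_translate ε A ((hψ.dder v).dder w) p
  simp only [heatOp, dder_backward ε A hψ, dder_backward ε A (hψ.dder _)]
  simp only [backward, heatOp]
  rw [integral_add (i1 _) ((integrable_finsetSum _ fun i _ => i2 _ _).const_mul _),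
    integral_const_mul, integral_finsetSum _ fun i _ => i2 _ _]

theorem dder_comp_displacement {φ : Space d × ℝ → ℝ} (hφ : ContDiff ℝ ∞ φ) (ε r : ℝ)
    (p : Space d × ℝ) (ζ v : Space d) :
    fderiv ℝ (fun ζ => φ (p + displacement ε (r, ζ))) ζ v
      = ε * √r * dder (v, 0) φ (p + displacement ε (r, ζ)) := by
  have h1 : HasFDerivAt (fun ζ : Space d => p + displacement ε (r, ζ))
      ((ε * √r) • (ContinuousLinearMap.inl ℝ (Space d) ℝ)) ζ := by
    have h2 : HasFDerivAt (fun ζ : Space d =>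
        (p + (0, r)) + ((ε * √r) • (ContinuousLinearMap.inl ℝ (Space d) ℝ)) ζ)
        ((ε * √r) • (ContinuousLinearMap.inl ℝ (Space d) ℝ)) ζ :=
      (ContinuousLinearMap.hasFDerivAt _).const_add _
    convert h2 using 2 with ζ
    ext <;> simp [displacement]
  have h3 := ((hφ.differentiable (by simp) (p + displacement ε (r, ζ))).hasFDerivAt).comp ζ h1
  have h4 : (fun ζ => φ (p + displacement ε (r, ζ)))
      = φ ∘ fun ζ => p + displacement ε (r, ζ) := rfl
  rw [h4, h3.fderiv]
  simp [dder]

theorem contDiff_comp_displacement {φ : Space d × ℝ → ℝ} (hφ : ContDiff ℝ ∞ φ) (ε r : ℝ)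
    (p : Space d × ℝ) : ContDiff ℝ ∞ (fun ζ => φ (p + displacement ε (r, ζ))) := by
  refine hφ.comp (contDiff_const.add ?_)
  exact (contDiff_const_smul (ε * √r)).prodMk contDiff_const

/-- Gaussian integration by parts; the factor ε√r is the chain rule for the displacement. -/
theorem integral_inner_mul_displacement {φ : Space d × ℝ → ℝ} (hφ : IsBump φ) (ε r : ℝ)
    (p : Space d × ℝ) (v : Space d) :
    ∫ ζ, inner ℝ ζ v * φ (p + displacement ε (r, ζ)) ∂(gauss d)
      = ε * √r * ∫ ζ, dder (v, 0) φ (p + displacement ε (r, ζ)) ∂(gauss d) := by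
  obtain ⟨C, -, hC⟩ := hφ.exists_bound
  obtain ⟨C', -, hC'⟩ := (hφ.dder (v, 0)).exists_bound
  have h := integral_inner_mul_gauss ((contDiff_comp_displacement hφ.smooth ε r p).of_le (by simp))
    (A := C) (fun ζ => hC _) v (B := |ε * √r| * C') (fun ζ => by
      rw [dder_comp_displacement hφ.smooth, abs_mul]
      exact mul_le_mul_of_nonneg_left (hC' _) (abs_nonneg _))
  rw [h]
  simp only [dder_comp_displacement hφ.smooth]
  rw [integral_const_mul]

theorem sum_basisVec (ζ : Space d) : ((ζ, 0) : Space d × ℝ) = ∑ i, inner ℝ ζ (EuclideanSpace.single i (1 : ℝ)) • basisVec i := by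
  have h : ζ = ∑ i, inner ℝ ζ (EuclideanSpace.single i (1 : ℝ)) • EuclideanSpace.single i (1 : ℝ) := by
    ext j
    simp [EuclideanSpace.inner_single_right, Pi.single_apply]
  refine Prod.ext ?_ ?_
  · rw [Prod.fst_sum]
    exact h
  · rw [Prod.snd_sum]
    simp [basisVec]

/-- The mean of a function of the Brownian path at the time lag `r`. -/
def pathMean (ε r : ℝ) (φ : Space d × ℝ → ℝ) (p : Space d × ℝ) : ℝ :=
  ∫ ζ, φ (p + displacement ε (r, ζ)) ∂(gauss d)

theorem integrable_gauss_displacement (ε r : ℝ) {φ : Space d × ℝ → ℝ} (hφ : IsBump φ)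
    (p : Space d × ℝ) :
    Integrable (fun ζ => φ (p + displacement ε (r, ζ))) (gauss d) := by
  obtain ⟨C, -, hC⟩ := hφ.exists_bound
  exact .of_bound (contDiff_comp_displacement hφ.smooth ε r p).continuous.aestronglyMeasurable C
    (.of_forall fun θ => hC _)

/-- Differentiating √r produces (ε/(2√r)) ζ · ∇φ. Integration by parts replaces ζ by ε√r ∇, and the
product of the factors is ε²/2, the coefficient of the Laplacian. -/
theorem hasDerivAt_pathMean {ε : ℝ} {φ : Space d × ℝ → ℝ} (hφ : IsBump φ)
    (p : Space d × ℝ) {r : ℝ} (hr : 0 < r) :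
    HasDerivAt (fun r => pathMean ε r φ p) (pathMean ε r (heatOp ε φ) p) r := by
  obtain ⟨C, hC0, hC⟩ := hφ.exists_bound_fderiv
  have hd : ∀ s : ℝ, 0 < s → ∀ ζ : Space d, HasDerivAt (fun r => φ (p + displacement ε (r, ζ)))
      (fderiv ℝ φ (p + displacement ε (s, ζ)) ((ε * (1 / (2 * √s))) • ζ, 1)) s := by
    intro s hs ζ
    have h1 : HasDerivAt (fun r => displacement ε (r, ζ)) ((ε * (1 / (2 * √s))) • ζ, 1) s :=
      (((Real.hasDerivAt_sqrt hs.ne').const_mul ε).smul_const ζ).prodMk (hasDerivAt_id s)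
    exact ((hφ.smooth.differentiable (by simp) _).hasFDerivAt).comp_hasDerivAt s (h1.const_add p)
  have key := hasDerivAt_integral_of_dominated_loc_of_deriv_le (μ := gauss d) (x₀ := r)
    -- Staying above r/2 keeps 1/√s bounded, as dominated differentiation requires.
    (s := Ioi (r / 2)) (F := fun r ζ => φ (p + displacement ε (r, ζ)))
    (F' := fun s ζ => fderiv ℝ φ (p + displacement ε (s, ζ)) ((ε * (1 / (2 * √s))) • ζ, 1))
    (bound := fun ζ => C * (|ε| * (1 / (2 * √(r / 2))) * ‖ζ‖ + 1))
    (Ioi_mem_nhds (by linarith))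
    (.of_forall fun s => (integrable_gauss_displacement ε s hφ p).aestronglyMeasurable)
    (integrable_gauss_displacement ε r hφ p) ?_ ?_ ?_ ?_
  · refine key.2.congr_deriv ?_
    have e1 : ∀ ζ : Space d, fderiv ℝ φ (p + displacement ε (r, ζ)) ((ε * (1 / (2 * √r))) • ζ, 1)
        = dder (0, 1) φ (p + displacement ε (r, ζ)) + ε * (1 / (2 * √r)) *
          ∑ i, inner ℝ ζ (EuclideanSpace.single i (1 : ℝ)) *
            dder (basisVec i) φ (p + displacement ε (r, ζ)) := by
      intro ζ
      have h2 : (((ε * (1 / (2 * √r))) • ζ, 1) : Space d × ℝ)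
          = (0, 1) + (ε * (1 / (2 * √r))) • (ζ, 0) := by ext <;> simp
      rw [h2, map_add, map_smul, sum_basisVec, map_sum]
      simp [dder, smul_eq_mul]
    have i1 : ∀ i, Integrable (fun ζ : Space d => inner ℝ ζ (EuclideanSpace.single i (1 : ℝ)) *
        dder (basisVec i) φ (p + displacement ε (r, ζ))) (gauss d) := by
      intro i
      obtain ⟨C', -, hC'⟩ := (hφ.dder (basisVec i)).exists_bound
      exact (integrable_inner_gauss stronglyMeasurable_const fun _ => le_rfl).mul_bdd (c := C')
        (integrable_gauss_displacement ε r (hφ.dder _) p).aestronglyMeasurable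
        (.of_forall fun ζ => hC' _)
    have i2 := fun v => integrable_gauss_displacement ε r (hφ.dder v) p
    have i3 := fun v w => integrable_gauss_displacement ε r ((hφ.dder v).dder w) p
    simp only [e1]
    rw [integral_add (i2 _) ((integrable_finsetSum _ fun i _ => i1 i).const_mul _),
      integral_const_mul, integral_finsetSum _ fun i _ => i1 i]
    simp only [integral_inner_mul_displacement (hφ.dder _)]
    simp only [pathMean, heatOp]
    rw [integral_add (i2 _) ((integrable_finsetSum _ fun i _ => i3 _ _).const_mul _),
      integral_const_mul, integral_finsetSum _ fun i _ => i3 _ _, ← Finset.mul_sum, ← mul_assoc]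
    have : 0 < √r := Real.sqrt_pos.2 hr
    congr 2
    field_simp
  · refine ((hφ.smooth.continuous_fderiv (by simp)).comp ?_).clm_apply ?_ |>.aestronglyMeasurable
    · unfold displacement; fun_prop
    · fun_prop
  · refine .of_forall fun ζ s hs => ?_
    have hs' : r / 2 < s := hs
    have hr2 : 0 < √(r / 2) := Real.sqrt_pos.2 (by linarith)
    have hss : √(r / 2) ≤ √s := Real.sqrt_le_sqrt hs'.le
    refine (ContinuousLinearMap.le_opNorm _ _).trans (mul_le_mul (hC _) ?_ (norm_nonneg _) hC0)
    rw [Prod.norm_def]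
    have h1 : ‖(ε * (1 / (2 * √s))) • ζ‖ ≤ |ε| * (1 / (2 * √(r / 2))) * ‖ζ‖ := by
      rw [norm_smul, norm_mul, Real.norm_eq_abs, Real.norm_of_nonneg (by positivity)]
      gcongr
    have h0 : 0 ≤ |ε| * (1 / (2 * √(r / 2))) * ‖ζ‖ := by positivity
    refine max_le (h1.trans (by linarith)) ?_
    rw [norm_one]; linarith
  · exact ((integrable_norm_gauss.const_mul _).add (integrable_const _)).const_mul _
  · refine .of_forall fun ζ s hs => hd s ?_ ζ
    have : r / 2 < s := hs
    linarith

theorem continuous_pathMean (ε : ℝ) {φ : Space d × ℝ → ℝ} (hφ : IsBump φ) (p : Space d × ℝ) :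
    Continuous fun r => pathMean ε r φ p := by
  obtain ⟨C, -, hC⟩ := hφ.exists_bound
  refine continuous_of_dominated (bound := fun _ => C)
    (fun r => (integrable_gauss_displacement ε r hφ p).aestronglyMeasurable)
    (fun r => .of_forall fun ζ => hC _) (integrable_const _) (.of_forall fun ζ => ?_)
  refine hφ.smooth.continuous.comp ?_
  unfold displacement
  fun_prop

theorem backward_eq_setIntegral (ε A : ℝ) {φ : Space d × ℝ → ℝ} (hφ : IsBump φ)
    (p : Space d × ℝ) : backward ε A φ p = ∫ r in Ioo 0 A, pathMean ε r φ p :=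
  integral_prod _ (integrable_pathMeasure_translate ε A hφ p)

/-- The fundamental theorem of calculus in the time lag. When lag `A` leads past the support, the
mean drops out and -φ remains. -/
theorem backward_heatOp (ε : ℝ) {A : ℝ} (hA : 0 ≤ A) {φ : Space d × ℝ → ℝ} (hφ : IsBump φ)
    (p : Space d × ℝ) : backward ε A (heatOp ε φ) p = pathMean ε A φ p - φ p := by
  rw [backward_eq_setIntegral ε A (hφ.heatOp ε), ← integral_Ioc_eq_integral_Ioo,
    ← intervalIntegral.integral_of_le hA,
    intervalIntegral.integral_eq_sub_of_hasDerivAt_of_le hA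
      (continuous_pathMean ε hφ p).continuousOn (fun r hr => hasDerivAt_pathMean hφ p hr.1)
      ((continuous_pathMean ε (hφ.heatOp ε) p).intervalIntegrable _ _)]
  simp [pathMean, displacement, Prod.mk_zero_zero]

theorem pathMean_eq_zero {ε r : ℝ} {φ : Space d × ℝ → ℝ} {p : Space d × ℝ} {T : ℝ}
    (hφ : tsupport φ ⊆ univ ×ˢ Iio T) (h : T ≤ p.2 + r) : pathMean ε r φ p = 0 := by
  refine integral_eq_zero_of_ae (.of_forall fun ζ => ?_)
  refine image_eq_zero_of_notMem_tsupport fun h2 => ?_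
  have := (hφ h2).2
  simp only [displacement, Prod.snd_add, mem_Iio] at this
  linarith

/-! ### Mild solutions are weak solutions -/

/-- Each slice is a translation, so this is Fubini. It moves a Gaussian displacement from the
solution onto the test function. -/
theorem measurePreserving_shear {G Θ : Type*} [AddCommGroup G] [MeasurableSpace G] [MeasurableAdd₂ G]
    [MeasurableSpace Θ] (ν : Measure G) [ν.IsAddLeftInvariant] [SFinite ν] (μ : Measure Θ)
    [SFinite μ] {a : Θ → G} (ha : Measurable a) :
    MeasurePreserving (fun q : G × Θ => (q.1 + a q.2, q.2)) (ν.prod μ) (ν.prod μ) := by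
  have h : MeasurePreserving (fun q : Θ × G => (q.1, q.2 + a q.1)) (μ.prod ν) (μ.prod ν) :=
    (MeasurePreserving.id μ).skew_product (g := fun θ x => x + a θ)
      (measurable_snd.add (ha.comp measurable_fst))
      (.of_forall fun θ => map_add_right_eq_self ν (a θ))
  exact Measure.measurePreserving_swap.comp (h.comp Measure.measurePreserving_swap)

instance : (volume : Measure (Space d × ℝ)).IsAddHaarMeasure :=
  inferInstanceAs ((volume : Measure (Space d)).prod (volume : Measure ℝ)).IsAddHaarMeasure

theorem timeMeasure_ae_mem (T : ℝ) : ∀ᵐ t ∂(timeMeasure T), t ∈ Ioo 0 T :=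
  ae_restrict_mem measurableSet_Ioo

theorem spaceTimeMeasure_eq (d : ℕ) (T : ℝ) :
    spaceTimeMeasure d T = (volume : Measure (Space d × ℝ)).restrict (univ ×ˢ Ioo 0 T) := by
  rw [spaceTimeMeasure, timeMeasure, Measure.volume_eq_prod, ← Measure.prod_restrict,
    Measure.restrict_univ]

theorem spaceTimeMeasure_ae_mem (d : ℕ) (T : ℝ) :
    ∀ᵐ p ∂(spaceTimeMeasure d T), p.2 ∈ Ioo 0 T := by
  rw [spaceTimeMeasure_eq]
  filter_upwards [ae_restrict_mem (MeasurableSet.univ.prod measurableSet_Ioo)] with p hp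
  exact hp.2

theorem IsBump.exists_integrable_bound {h : Space d × ℝ → ℝ} (hh : IsBump h) :
    ∃ k : Space d → ℝ, Integrable k ∧ ∀ x t, |h (x, t)| ≤ k x := by
  obtain ⟨C, hC0, hC⟩ := hh.exists_bound
  have hK : IsCompact (Prod.fst '' tsupport h) := hh.compact.isCompact.image continuous_fst
  refine ⟨(Prod.fst '' tsupport h).indicator fun _ => C,
    (integrable_indicator_iff hK.measurableSet).2 (integrableOn_const hK.measure_ne_top),
    fun x t => ?_⟩
  by_cases hx : x ∈ Prod.fst '' tsupport h
  · rw [indicator_of_mem hx]; exact hC _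
  · rw [indicator_of_notMem hx, image_eq_zero_of_notMem_tsupport fun h2 => hx ⟨_, h2, rfl⟩,
      abs_zero]

/-- The heat flow of the datum is adjoint to `backward` evaluated at time 0, by the change of
variables y = x - ε√t ζ. -/
theorem integral_heat_mul (ε T : ℝ) {u : Space d → ℝ} (hu : StronglyMeasurable u) {A : ℝ}
    (hA : ∀ x, ‖u x‖ ≤ A) {h : Space d × ℝ → ℝ} (hh : IsBump h) :
    Integrable (fun p : Space d × ℝ => heat ε p.2 u p.1 * h p) (spaceTimeMeasure d T) ∧
    ∫ p, heat ε p.2 u p.1 * h p ∂(spaceTimeMeasure d T)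
      = ∫ y, u y * backward ε T h (y, 0) := by
  obtain ⟨k, hk, hhk⟩ := hh.exists_integrable_bound
  have hcont := hh.smooth.continuous
  have hd := measurable_displacement (d := d) ε
  set a : ℝ × Space d → Space d := fun θ => (ε * √θ.1) • θ.2 with ha
  have ham : Measurable a := by fun_prop
  set Q : Space d × (ℝ × Space d) → ℝ := fun q => u (q.1 - a q.2) * h (q.1, q.2.1) with hQ
  have hQm : StronglyMeasurable Q :=
    (hu.comp_measurable (by fun_prop)).mul (hcont.stronglyMeasurable.comp_measurable (by fun_prop))
  have hQi : Integrable Q ((volume : Measure (Space d)).prod (pathMeasure d T)) := by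
    refine ((hk.const_mul A).comp_fst (pathMeasure d T)).mono' hQm.aestronglyMeasurable
      (.of_forall fun q => ?_)
    rw [norm_mul]
    exact mul_le_mul (hA _) (hhk _ _) (norm_nonneg _) ((norm_nonneg _).trans (hA 0))
  have hshear := measurePreserving_shear (volume : Measure (Space d)) (pathMeasure d T) ham
  have hQi2 := hshear.integrable_comp_of_integrable hQi
  have hi : Integrable (fun p : Space d × ℝ => heat ε p.2 u p.1 * h p) (spaceTimeMeasure d T) := by
    refine ((hk.const_mul A).comp_fst (timeMeasure T)).mono'
      ((stronglyMeasurable_heat_param (α := Space d × ℝ) ε (K := fun a => u a.2)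
        (hu.comp_measurable measurable_snd) measurable_snd measurable_fst).mul
          hcont.stronglyMeasurable).aestronglyMeasurable (.of_forall fun p => ?_)
    rw [norm_mul]
    exact mul_le_mul (norm_heat_le ε _ hA _) (hhk _ _) (norm_nonneg _)
      ((norm_nonneg _).trans (hA 0))
  refine ⟨hi, ?_⟩
  calc ∫ p, heat ε p.2 u p.1 * h p ∂(spaceTimeMeasure d T)
      = ∫ x, ∫ t, heat ε t u x * h (x, t) ∂(timeMeasure T) := integral_prod _ hi
    _ = ∫ x, ∫ θ, Q (x, θ) ∂(pathMeasure d T) := by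
        refine integral_congr_ae ?_
        filter_upwards [hQi.prod_right_ae] with x hx
        rw [pathMeasure, integral_prod _ hx]
        refine integral_congr_ae (.of_forall fun t => ?_)
        simp only [hQ, heat, ha]
        rw [integral_mul_const]
    _ = ∫ q, Q q ∂((volume : Measure (Space d)).prod (pathMeasure d T)) :=
        (integral_prod _ hQi).symm
    _ = ∫ q, Q (q.1 + a q.2, q.2) ∂((volume : Measure (Space d)).prod (pathMeasure d T)) := by
        conv_lhs => rw [← hshear.map_eq]
        exact integral_map hshear.aemeasurable hQm.aestronglyMeasurable
    _ = ∫ y, ∫ θ, Q (y + a θ, θ) ∂(pathMeasure d T) := integral_prod _ hQi2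
    _ = ∫ y, u y * backward ε T h (y, 0) := by
        congr with y
        rw [backward, ← integral_const_mul]
        congr with θ
        simp [hQ, displacement, ha]

theorem integral_mul_inner_displacement {ε : ℝ} (hε : 0 < ε) (T : ℝ) {h : Space d × ℝ → ℝ}
    (hh : IsBump h) (v : Space d) (p : Space d × ℝ)
    (hi : Integrable (fun θ : ℝ × Space d => (ε * √θ.1)⁻¹ * inner ℝ θ.2 v *
      h (p + displacement ε θ)) (pathMeasure d T)) :
    ∫ θ, (ε * √θ.1)⁻¹ * inner ℝ θ.2 v * h (p + displacement ε θ) ∂(pathMeasure d T)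
      = backward ε T (dder (v, 0) h) p := by
  rw [backward_eq_setIntegral ε T (hh.dder _), pathMeasure, integral_prod _ hi, timeMeasure]
  refine setIntegral_congr_fun measurableSet_Ioo fun r hr => ?_
  have hr' : 0 < √r := Real.sqrt_pos.2 hr.1
  simp only [mul_assoc]
  rw [integral_const_mul, integral_inner_mul_displacement hh, pathMean, mul_inv]
  field_simp

theorem integrable_pathMeasure_weight {ε : ℝ} (T : ℝ) :
    Integrable (fun θ : ℝ × Space d => (ε * √θ.1)⁻¹ * ‖θ.2‖) (pathMeasure d T) := by
  rcases le_or_gt T 0 with h | h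
  · rw [pathMeasure, timeMeasure, Ioo_eq_empty (by simpa using h)]
    simp
  · refine Integrable.mul_prod (f := fun r : ℝ => (ε * √r)⁻¹) (g := fun ζ : Space d => ‖ζ‖) ?_
      integrable_norm_gauss
    have := (integrableOn_rpow_Ioo (a := -(1 / 2)) (by norm_num) h.le).const_mul ε⁻¹
    simp only [mul_inv, inv_sqrt_eq_rpow]
    exact this

/-- Since `F` vanishes at nonpositive times, lags may run over all of (0, T) instead of (0, t). The
path measure then no longer depends on the point, as the shear requires. -/
theorem duhamel_eq_integral {ε : ℝ} (hε : 0 < ε) {F : Space d × ℝ → Space d}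
    (hF : StronglyMeasurable F) {B : ℝ} (hB : ∀ p, ‖F p‖ ≤ B) (hF0 : ∀ p, p.2 ≤ 0 → F p = 0)
    {T : ℝ} {p : Space d × ℝ} (hp : p.2 ∈ Ioo 0 T) :
    duhamel ε F p = ∫ θ, (ε * √θ.1)⁻¹ * inner ℝ θ.2 (F (p - displacement ε θ))
      ∂(pathMeasure d T) := by
  have hd := measurable_displacement (d := d) ε
  have hm : StronglyMeasurable fun θ : ℝ × Space d =>
      (ε * √θ.1)⁻¹ * inner ℝ θ.2 (F (p - displacement ε θ)) :=
    (by fun_prop : Measurable fun θ : ℝ × Space d => (ε * √θ.1)⁻¹).stronglyMeasurable.mul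
      (measurable_snd.stronglyMeasurable.inner (hF.comp_measurable (measurable_const.sub hd)))
  have hi : Integrable (fun θ : ℝ × Space d =>
      (ε * √θ.1)⁻¹ * inner ℝ θ.2 (F (p - displacement ε θ))) (pathMeasure d T) := by
    refine ((integrable_pathMeasure_weight (ε := ε) T).mul_const B).mono' hm.aestronglyMeasurable
      (.of_forall fun θ => ?_)
    rw [norm_mul, Real.norm_of_nonneg (by positivity), mul_assoc]
    gcongr
    exact (norm_inner_le_norm _ _).trans (by gcongr; exact hB _)
  rw [pathMeasure, integral_prod _ hi, duhamel, timeMeasure]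
  have e1 : ∫ s in Ioo 0 p.2, flux ε (p.2 - s) (fun y => F (y, s)) p.1
      = ∫ r in Ioo 0 p.2, flux ε r (fun y => F (y, p.2 - r)) p.1 := by
    have := setIntegral_sub_left (fun r => flux ε r (fun y => F (y, p.2 - r)) p.1) hp.1.le
    simpa using this
  rw [e1]
  have e2 : ∀ r, ∫ ζ, (ε * √r)⁻¹ * inner ℝ ζ (F (p - displacement ε (r, ζ))) ∂(gauss d)
      = flux ε r (fun y => F (y, p.2 - r)) p.1 := fun r => rfl
  simp only [e2]
  symm
  refine setIntegral_eq_of_subset_of_forall_sdiff_eq_zero measurableSet_Ioo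
    (Ioo_subset_Ioo_right hp.2.le) fun r hr => ?_
  have hr2 : p.2 - r ≤ 0 := by
    by_contra h
    exact hr.2 ⟨hr.1.1, by linarith⟩
  have hz : ∀ y, F (y, p.2 - r) = 0 := fun y => hF0 (y, p.2 - r) hr2
  simp [flux, hz]

/-- This is the adjoint of the Duhamel operator. The integral on the right may run over all times
because `F` vanishes before 0 and `h` after `T`. -/
theorem integral_duhamel_mul {ε : ℝ} (hε : 0 < ε) {T : ℝ} {F : Space d × ℝ → Space d}
    (hF : StronglyMeasurable F) {B : ℝ} (hB : ∀ p, ‖F p‖ ≤ B) (hF0 : ∀ p, p.2 ≤ 0 → F p = 0)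
    {h : Space d × ℝ → ℝ} (hh : IsBump h) (hT : tsupport h ⊆ univ ×ˢ Iio T) :
    Integrable (fun p => duhamel ε F p * h p) (spaceTimeMeasure d T) ∧
    ∫ p, duhamel ε F p * h p ∂(spaceTimeMeasure d T)
      = ∫ p, backward ε T (dder (F p, 0) h) p := by
  have hcont := hh.smooth.continuous
  have hd := measurable_displacement (d := d) ε
  have hwm : Measurable fun θ : ℝ × Space d => (ε * √θ.1)⁻¹ := by fun_prop
  set I : Space d × ℝ → ℝ := fun p => ∫ θ, (ε * √θ.1)⁻¹ * inner ℝ θ.2 (F (p - displacement ε θ))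
      ∂(pathMeasure d T) with hI
  set Q : (Space d × ℝ) × (ℝ × Space d) → ℝ := fun q =>
    (ε * √q.2.1)⁻¹ * inner ℝ q.2.2 (F (q.1 - displacement ε q.2)) * h q.1 with hQ
  have hQm : StronglyMeasurable Q :=
    (((hwm.comp measurable_snd).stronglyMeasurable).mul
      ((measurable_snd.comp measurable_snd).stronglyMeasurable.inner
        (hF.comp_measurable (measurable_fst.sub (hd.comp measurable_snd))))).mul
      (hcont.stronglyMeasurable.comp_measurable measurable_fst)
  have hQi : Integrable Q ((volume : Measure (Space d × ℝ)).prod (pathMeasure d T)) := by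
    refine ((hh.integrable.abs.mul_prod (integrable_pathMeasure_weight (ε := ε) T)).mul_const
      B).mono' hQm.aestronglyMeasurable (.of_forall fun q => ?_)
    rw [norm_mul, norm_mul, Real.norm_of_nonneg (by positivity : 0 ≤ (ε * √q.2.1)⁻¹)]
    have h1 : ‖inner ℝ q.2.2 (F (q.1 - displacement ε q.2))‖ ≤ ‖q.2.2‖ * B :=
      (norm_inner_le_norm _ _).trans (by gcongr; exact hB _)
    calc _ ≤ (ε * √q.2.1)⁻¹ * (‖q.2.2‖ * B) * ‖h q.1‖ := by gcongr
      _ = _ := by rw [Real.norm_eq_abs]; ring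
  have hshear := measurePreserving_shear (volume : Measure (Space d × ℝ)) (pathMeasure d T) hd
  have hQi2 := hshear.integrable_comp_of_integrable hQi
  have eI : ∀ p, ∫ θ, Q (p, θ) ∂(pathMeasure d T) = I p * h p := by
    intro p
    simp only [hQ, hI]
    rw [integral_mul_const]
  have hIi : Integrable fun p => I p * h p := by
    have := hQi.integral_prod_left
    simpa only [eI] using this
  have hzero : ∀ p ∉ (univ ×ˢ Ioo 0 T : Set (Space d × ℝ)), I p * h p = 0 := by
    intro p hp
    rcases le_or_gt p.2 0 with h0 | h0
    · have : I p = 0 := by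
        simp only [hI]
        refine integral_eq_zero_of_ae ?_
        have hae : ∀ᵐ θ ∂(pathMeasure d T), θ.1 ∈ Ioo 0 T :=
          Measure.quasiMeasurePreserving_fst.ae (timeMeasure_ae_mem T)
        filter_upwards [hae] with θ hθ
        rw [hF0 _ (by simp only [displacement, Prod.snd_sub]; linarith [hθ.1])]
        simp
      rw [this, zero_mul]
    · have : h p = 0 := by
        refine image_eq_zero_of_notMem_tsupport fun h2 => hp ⟨mem_univ _, h0, (hT h2).2⟩
      rw [this, mul_zero]
  have hae : (fun p => duhamel ε F p * h p) =ᵐ[spaceTimeMeasure d T] fun p => I p * h p := by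
    filter_upwards [spaceTimeMeasure_ae_mem d T] with p hp
    rw [duhamel_eq_integral hε hF hB hF0 hp]
  refine ⟨(integrable_congr hae).2 (by rw [spaceTimeMeasure_eq]; exact hIi.restrict), ?_⟩
  calc ∫ p, duhamel ε F p * h p ∂(spaceTimeMeasure d T)
      = ∫ p, I p * h p := by
        rw [integral_congr_ae hae, spaceTimeMeasure_eq]
        exact setIntegral_eq_integral_of_forall_compl_eq_zero hzero
    _ = ∫ p, ∫ θ, Q (p, θ) ∂(pathMeasure d T) := by simp only [eI]
    _ = ∫ q, Q q ∂((volume : Measure (Space d × ℝ)).prod (pathMeasure d T)) :=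
        (integral_prod _ hQi).symm
    -- The shear freezes `F` at the base point and leaves the singular weight against the smooth
    -- `h`, where integration by parts removes it.
    _ = ∫ q, Q (q.1 + displacement ε q.2, q.2)
          ∂((volume : Measure (Space d × ℝ)).prod (pathMeasure d T)) := by
        conv_lhs => rw [← hshear.map_eq]
        exact integral_map hshear.aemeasurable hQm.aestronglyMeasurable
    _ = ∫ p, ∫ θ, Q (p + displacement ε θ, θ) ∂(pathMeasure d T) := integral_prod _ hQi2
    _ = ∫ p, backward ε T (dder (F p, 0) h) p := by
        refine integral_congr_ae ?_
        filter_upwards [hQi2.prod_right_ae] with p hp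
        simp only [hQ, add_sub_cancel_right, Function.comp_def] at hp ⊢
        exact integral_mul_inner_displacement hε T hh (F p) p hp

/-- The two adjoint formulas with h = `heatOp ε φ`: directional derivatives commute with the heat
operator, and `backward` then returns -φ and minus its derivative. -/
theorem integral_mild_mul_heatOp {ε : ℝ} (hε : 0 < ε) {T : ℝ} (hT : 0 < T) {u : Space d → ℝ}
    (hu : StronglyMeasurable u) {A : ℝ} (hA : ∀ x, ‖u x‖ ≤ A) {F : Space d × ℝ → Space d}
    (hF : StronglyMeasurable F) {B : ℝ} (hB : ∀ p, ‖F p‖ ≤ B) {φ : Space d × ℝ → ℝ}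
    (hφ : IsBump φ) (hsupp : tsupport φ ⊆ univ ×ˢ Iio T) :
    Integrable (fun p => mild ε u F p * heatOp ε φ p) (spaceTimeMeasure d T) ∧
    ∫ p, mild ε u F p * heatOp ε φ p ∂(spaceTimeMeasure d T)
      = -(∫ p, dder (F p, 0) φ p ∂(spaceTimeMeasure d T)) - ∫ x, u x * φ (x, 0) := by
  -- Discarding nonpositive times leaves the Duhamel integral unchanged and supplies the vanishing
  -- hypothesis.
  set F0 : Space d × ℝ → Space d := (univ ×ˢ Ioi 0 : Set (Space d × ℝ)).indicator F with hF0
  have hS : MeasurableSet (univ ×ˢ Ioi 0 : Set (Space d × ℝ)) :=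
    MeasurableSet.univ.prod measurableSet_Ioi
  have hF0m : StronglyMeasurable F0 := hF.indicator hS
  have hF0B : ∀ p, ‖F0 p‖ ≤ B := fun p => (norm_indicator_le_norm_self _ _).trans (hB p)
  have hF0z : ∀ p : Space d × ℝ, p.2 ≤ 0 → F0 p = 0 := fun p hp =>
    indicator_of_notMem (fun h => not_lt.2 hp h.2) _
  have hF0e : ∀ p : Space d × ℝ, 0 < p.2 → F0 p = F p := fun p hp =>
    indicator_of_mem (show p ∈ (univ ×ˢ Ioi 0 : Set (Space d × ℝ)) from ⟨mem_univ _, hp⟩) _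
  have hdu : ∀ p : Space d × ℝ, duhamel ε F p = duhamel ε F0 p := by
    intro p
    refine setIntegral_congr_fun measurableSet_Ioo fun s hs => ?_
    simp only [flux, hF0e (_, s) hs.1]
  have hh := hφ.heatOp ε
  have hhs := (tsupport_heatOp_subset φ ε).trans hsupp
  obtain ⟨i1, e1⟩ := integral_heat_mul ε T hu hA hh
  obtain ⟨i2, e2⟩ := integral_duhamel_mul hε hF0m hF0B hF0z hh hhs
  have es : ∀ p, mild ε u F p * heatOp ε φ p
      = heat ε p.2 u p.1 * heatOp ε φ p + duhamel ε F0 p * heatOp ε φ p := by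
    intro p
    rw [mild, hdu, add_mul]
  simp only [es]
  refine ⟨i1.add i2, ?_⟩
  rw [integral_add i1 i2, e1, e2]
  have b1 : ∀ y, backward ε T (heatOp ε φ) (y, 0) = -φ (y, 0) := by
    intro y
    rw [backward_heatOp ε hT.le hφ, pathMean_eq_zero hsupp (by simp), zero_sub]
  have b2 : ∀ p, backward ε T (dder (F0 p, 0) (heatOp ε φ)) p
      = -((univ ×ˢ Ioo 0 T : Set (Space d × ℝ)).indicator (fun p => dder (F p, 0) φ p) p) := by
    intro p
    rcases le_or_gt p.2 0 with h0 | h0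
    · rw [hF0z p h0, indicator_of_notMem fun h => not_lt.2 h0 h.2.1]
      simp [backward, dder, ← Prod.zero_eq_mk]
    · rw [hF0e p h0, dder_heatOp hφ.smooth, backward_heatOp ε hT.le (hφ.dder _),
        pathMean_eq_zero ((tsupport_dder_subset φ _).trans hsupp) (by linarith), zero_sub]
      by_cases h1 : p.2 < T
      · rw [indicator_of_mem (show p ∈ (univ ×ˢ Ioo 0 T : Set (Space d × ℝ)) from
          ⟨mem_univ _, h0, h1⟩)]
      · rw [indicator_of_notMem fun h => h1 h.2.2]
        rw [image_eq_zero_of_notMem_tsupport fun h2 =>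
          h1 (hsupp (tsupport_dder_subset φ _ h2)).2]
  simp only [b1, b2, mul_neg, integral_neg]
  rw [integral_indicator (MeasurableSet.univ.prod measurableSet_Ioo), ← spaceTimeMeasure_eq]
  ring

/-! ### The differential operators of the weak formulation -/

theorem laplacian_section {φ : Space d × ℝ → ℝ} (hφ : ContDiff ℝ ∞ φ) (p : Space d × ℝ) :
    Laplacian.laplacian (fun y => φ (y, p.2)) p.1
      = ∑ i, dder (basisVec i) (dder (basisVec i) φ) p := by
  have h1 : ∀ (ψ : Space d × ℝ → ℝ), ContDiff ℝ ∞ ψ → ∀ y v,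
      fderiv ℝ (fun y => ψ (y, p.2)) y v = dder (v, 0) ψ (y, p.2) := by
    intro ψ hψ y v
    have h2 : HasFDerivAt (fun y : Space d => (y, p.2)) (ContinuousLinearMap.inl ℝ (Space d) ℝ) y :=
      hasFDerivAt_prodMk_left y p.2
    have h3 := ((hψ.differentiable (by simp) (y, p.2)).hasFDerivAt).comp y h2
    have h4 : (fun y => ψ (y, p.2)) = ψ ∘ fun y => (y, p.2) := rfl
    rw [h4, h3.fderiv]
    simp [dder]
  rw [InnerProductSpace.laplacian_eq_iteratedFDeriv_orthonormalBasis _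
    (EuclideanSpace.basisFun (Fin d) ℝ)]
  refine Finset.sum_congr rfl fun i _ => ?_
  have hc : ContDiff ℝ ∞ fun y => φ (y, p.2) := hφ.comp (contDiff_prodMk_left p.2)
  have hd : DifferentiableAt ℝ (fderiv ℝ fun y => φ (y, p.2)) p.1 :=
    (hc.fderiv_right (m := ∞) (by simp)).differentiable (by simp) _
  rw [iteratedFDeriv_two_apply]
  simp only [EuclideanSpace.basisFun_apply, Matrix.cons_val_zero, Matrix.cons_val_one]
  have h5 := h1 _ (contDiff_dder hφ (basisVec i)) p.1 (EuclideanSpace.single i 1)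
  have h6 : (fun y => dder (basisVec i) φ (y, p.2))
      = fun y => fderiv ℝ (fun y => φ (y, p.2)) y (EuclideanSpace.single i 1) := by
    ext y
    rw [h1 φ hφ]
    rfl
  rw [h6, fderiv_clm_apply hd (differentiableAt_const _)] at h5
  simpa [basisVec] using h5

theorem inner_gradient_section {φ : Space d × ℝ → ℝ} (hφ : ContDiff ℝ ∞ φ) (p : Space d × ℝ)
    (v : Space d) :
    inner ℝ v (gradient (fun y => φ (y, p.2)) p.1) = dder (v, 0) φ p := by
  have h2 : HasFDerivAt (fun y : Space d => (y, p.2)) (ContinuousLinearMap.inl ℝ (Space d) ℝ) p.1 :=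
    hasFDerivAt_prodMk_left p.1 p.2
  have h3 := ((hφ.differentiable (by simp) (p.1, p.2)).hasFDerivAt).comp p.1 h2
  have h4 : (fun y => φ (y, p.2)) = φ ∘ fun y => (y, p.2) := rfl
  rw [real_inner_comm, gradient, InnerProductSpace.toDual_symm_apply, h4, h3.fderiv]
  simp [dder]

theorem deriv_section {φ : Space d × ℝ → ℝ} (hφ : ContDiff ℝ ∞ φ) (p : Space d × ℝ) :
    deriv (fun s => φ (p.1, s)) p.2 = dder (0, 1) φ p := by
  have h2 : HasDerivAt (fun s : ℝ => (p.1, s)) ((0 : Space d), (1 : ℝ)) p.2 :=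
    (hasDerivAt_const _ _).prodMk (hasDerivAt_id _)
  exact (((hφ.differentiable (by simp) (p.1, p.2)).hasFDerivAt).comp_hasDerivAt p.2 h2).deriv

theorem weak_integrand_eq {φ : Space d × ℝ → ℝ} (hφ : ContDiff ℝ ∞ φ) (ε a : ℝ) (v : Space d)
    (p : Space d × ℝ) :
    a * deriv (fun s => φ (p.1, s)) p.2 + inner ℝ v (gradient (fun y => φ (y, p.2)) p.1)
      + ε ^ 2 / 2 * a * Laplacian.laplacian (fun y => φ (y, p.2)) p.1
      = a * heatOp ε φ p + dder (v, 0) φ p := by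
  rw [deriv_section hφ, inner_gradient_section hφ, laplacian_section hφ, heatOp]
  ring

theorem integrable_dder_section {T : ℝ} {F : Space d × ℝ → Space d}
    (hF : AEStronglyMeasurable F (spaceTimeMeasure d T)) {B : ℝ}
    (hB : ∀ᵐ p ∂(spaceTimeMeasure d T), ‖F p‖ ≤ B)
    {φ : Space d × ℝ → ℝ} (hφ : IsBump φ) :
    Integrable (fun p => dder (F p, 0) φ p) (spaceTimeMeasure d T) := by
  have hc : Continuous (fderiv ℝ φ) := hφ.smooth.continuous_fderiv (by simp)
  have hi : Integrable (fun p => ‖fderiv ℝ φ p‖) :=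
    (hc.integrable_of_hasCompactSupport (hφ.compact.fderiv ℝ)).norm
  have hi2 : Integrable (fun p => ‖fderiv ℝ φ p‖) (spaceTimeMeasure d T) := by
    rw [spaceTimeMeasure_eq]; exact hi.restrict
  refine (hi2.mul_const B).mono' ?_ ?_
  · exact (isBoundedBilinearMap_apply (𝕜 := ℝ) (E := Space d × ℝ)
      (F := ℝ)).continuous.comp_aestronglyMeasurable
      (hc.aestronglyMeasurable.prodMk (hF.prodMk aestronglyMeasurable_const))
  · filter_upwards [hB] with p hp
    refine (ContinuousLinearMap.le_opNorm _ _).trans ?_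
    gcongr
    rw [Prod.norm_def]
    simpa using hp

theorem isTestFunction_isBump {T : ℝ} {φ : Space d × ℝ → ℝ} (h : IsTestFunction d T φ) :
    IsBump φ := ⟨h.smooth, h.compact⟩

theorem isWeakSolution_of_eq_mild {ε T : ℝ} (hε : 0 < ε) (hT : 0 < T) {u : Space d → ℝ}
    (hu : StronglyMeasurable u) {A : ℝ} (hA : ∀ x, ‖u x‖ ≤ A) {f : ℝ → Space d}
    {F : Space d × ℝ → Space d} (hF : StronglyMeasurable F) {B : ℝ} (hB : ∀ p, ‖F p‖ ≤ B)
    {m : Space d × ℝ → ℝ} (hm : MemLp m ∞ (spaceTimeMeasure d T))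
    (hmF : ∀ᵐ p ∂(spaceTimeMeasure d T), f (m p) = F p)
    (hmm : ∀ᵐ p ∂(spaceTimeMeasure d T), m p = mild ε u F p) :
    IsWeakSolution d T ε f u m := by
  refine ⟨hm, fun φ hφ => ?_⟩
  have hb := isTestFunction_isBump hφ
  obtain ⟨i1, e1⟩ := integral_mild_mul_heatOp hε hT hu hA hF hB hb hφ.support
  have i2 := integrable_dder_section (T := T) hF.aestronglyMeasurable (.of_forall hB) hb
  simp only [weak_integrand_eq hφ.smooth]
  have e : ∫ p, (m p * heatOp ε φ p + dder (f (m p), 0) φ p) ∂(spaceTimeMeasure d T)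
      = ∫ p, (mild ε u F p * heatOp ε φ p + dder (F p, 0) φ p) ∂(spaceTimeMeasure d T) := by
    refine integral_congr_ae ?_
    filter_upwards [hmF, hmm] with p h1 h2
    rw [h1, h2]
  rw [e, integral_add i1 i2, e1]
  ring

/-! ### Weak solutions are mild solutions -/

theorem integrable_backward (ε A : ℝ) {ψ : Space d × ℝ → ℝ} (hψ : IsBump ψ) :
    Integrable (backward ε A ψ) := by
  have hd := measurable_displacement (d := d) ε
  have hshear := measurePreserving_shear (volume : Measure (Space d × ℝ)) (pathMeasure d A) hd
  exact (hshear.integrable_comp_of_integrable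
    (hψ.integrable.comp_fst (pathMeasure d A))).integral_prod_left

theorem heatOp_congr {ε : ℝ} {φ ψ : Space d × ℝ → ℝ} {p : Space d × ℝ} (h : φ =ᶠ[𝓝 p] ψ) :
    heatOp ε φ p = heatOp ε ψ p := by
  have h1 : ∀ {φ ψ : Space d × ℝ → ℝ} (v : Space d × ℝ), φ =ᶠ[𝓝 p] ψ →
      dder v φ =ᶠ[𝓝 p] dder v ψ := by
    intro φ ψ v h
    filter_upwards [h.fderiv (𝕜 := ℝ)] with q hq
    rw [dder, dder, hq]
  simp only [heatOp, (h1 _ h).eq_of_nhds, (h1 _ (h1 _ h)).eq_of_nhds]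

theorem heatOp_mul {φ χ : Space d × ℝ → ℝ} (hφ : ContDiff ℝ ∞ φ) (hχ : ContDiff ℝ ∞ χ) (ε : ℝ)
    (p : Space d × ℝ) :
    heatOp ε (fun p => χ p * φ p) p = χ p * heatOp ε φ p + φ p * heatOp ε χ p
      + ε ^ 2 * ∑ i, dder (basisVec i) χ p * dder (basisVec i) φ p := by
  have h : ∀ v, dder v (dder v (fun p => χ p * φ p)) p
      = χ p * dder v (dder v φ) p + φ p * dder v (dder v χ) p + 2 * (dder v χ p * dder v φ p) := by
    intro v
    rw [dder_mul hχ hφ, dder_add (hχ.mul (contDiff_dder hφ v)) (hφ.mul (contDiff_dder hχ v)),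
      dder_mul hχ (contDiff_dder hφ v), dder_mul hφ (contDiff_dder hχ v)]
    ring
  have h0 := congrFun (dder_mul hχ hφ (0, 1)) p
  simp only [heatOp, h, h0, Finset.sum_add_distrib, ← Finset.mul_sum]
  ring

theorem dder_comp_smul {g : Space d × ℝ → ℝ} (hg : ContDiff ℝ ∞ g) (c : ℝ) (v : Space d × ℝ) :
    dder v (fun p => g (c • p)) = fun p => c * dder v g (c • p) := by
  ext p
  have h1 : HasFDerivAt (fun p : Space d × ℝ => c • p)
      (c • ContinuousLinearMap.id ℝ (Space d × ℝ)) p := (hasFDerivAt_id p).const_smul c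
  have h2 := ((hg.differentiable (by simp) (c • p)).hasFDerivAt).comp p h1
  change fderiv ℝ (g ∘ fun p => c • p) p v = _
  rw [h2.fderiv]
  simp [dder]

theorem dder_const_mul {g : Space d × ℝ → ℝ} (hg : ContDiff ℝ ∞ g) (c : ℝ) (v : Space d × ℝ) :
    dder v (fun p => c * g p) = fun p => c * dder v g p := by
  ext p
  unfold dder
  rw [fderiv_const_mul (hg.differentiable (by simp) p)]
  rfl

/-- Dilations of one bump by n + 1. Each derivative brings a factor at most 1, so one constant
serves all n. -/
theorem exists_cutoff (d : ℕ) (ε : ℝ) : ∃ (χ : ℕ → Space d × ℝ → ℝ) (C : ℝ), 0 ≤ C ∧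
    (∀ n, IsBump (χ n)) ∧ (∀ p, ∀ᶠ n in atTop, χ n =ᶠ[𝓝 p] fun _ => 1) ∧
    (∀ n p, |χ n p| ≤ C) ∧ (∀ n p, |heatOp ε (χ n) p| ≤ C) ∧
    ∀ n p i, |dder (basisVec i) (χ n) p| ≤ C := by
  let b : ContDiffBump (0 : Space d × ℝ) := ⟨1, 2, one_pos, one_lt_two⟩
  have hb : IsBump (b : Space d × ℝ → ℝ) := ⟨b.contDiff, b.hasCompactSupport⟩
  have hsm : ∀ c : ℝ, ContDiff ℝ ∞ fun p : Space d × ℝ => b (c • p) := fun c =>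
    hb.smooth.comp (contDiff_const_smul c)
  have h1 : ∀ c : ℝ, 0 < c → IsBump fun p : Space d × ℝ => b (c • p) := fun c hc =>
    ⟨hsm c, hb.compact.comp_smul hc.ne'⟩
  obtain ⟨C0, hC0, hC0'⟩ := hb.exists_bound
  obtain ⟨C1, hC1, hC1'⟩ := (hb.dder (0, 1)).exists_bound
  have h2 : ∀ i : Fin d, ∃ C, 0 ≤ C ∧ ∀ p, |dder (basisVec i) b p| ≤ C := fun i =>
    (hb.dder (basisVec i)).exists_bound
  have h3 : ∀ i : Fin d, ∃ C, 0 ≤ C ∧ ∀ p, |dder (basisVec i) (dder (basisVec i) b) p| ≤ C :=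
    fun i => ((hb.dder (basisVec i)).dder (basisVec i)).exists_bound
  choose C2 hC2 hC2' using h2
  choose C3 hC3 hC3' using h3
  have s2 : 0 ≤ ∑ i, C2 i := Finset.sum_nonneg fun i _ => hC2 i
  have s3 : 0 ≤ ε ^ 2 / 2 * ∑ i, C3 i :=
    mul_nonneg (by positivity) (Finset.sum_nonneg fun i _ => hC3 i)
  have hc : ∀ n : ℕ, 0 < ((n : ℝ) + 1)⁻¹ := fun n => by positivity
  have hc1 : ∀ n : ℕ, |((n : ℝ) + 1)⁻¹| ≤ 1 := fun n => by
    rw [abs_of_pos (hc n)]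
    exact inv_le_one_of_one_le₀ (by linarith [(Nat.cast_nonneg n : (0 : ℝ) ≤ n)])
  have mulle : ∀ (n : ℕ) (a K : ℝ), |a| ≤ K → |((n : ℝ) + 1)⁻¹ * a| ≤ K := by
    intro n a K h
    rw [abs_mul]
    exact (mul_le_of_le_one_left (abs_nonneg _) (hc1 n)).trans h
  refine ⟨fun n p => b (((n : ℝ) + 1)⁻¹ • p), C0 + C1 + ∑ i, C2 i + ε ^ 2 / 2 * ∑ i, C3 i,
    by linarith, fun n => h1 _ (hc n), fun p => ?_, fun n p => (hC0' _).trans (by linarith),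
    fun n p => ?_, fun n p i => ?_⟩
  · obtain ⟨N, hN⟩ := exists_nat_gt ‖p‖
    filter_upwards [eventually_ge_atTop N] with n hn
    have hn' : ‖p‖ < (n : ℝ) + 1 := by
      have : (N : ℝ) ≤ n := by exact_mod_cast hn
      linarith
    filter_upwards [(continuous_norm.continuousAt (x := p)).eventually_lt_const hn'] with q hq
    refine b.one_of_mem_closedBall ?_
    rw [mem_closedBall_zero_iff, norm_smul, Real.norm_of_nonneg (hc n).le, ← div_eq_inv_mul]
    exact (div_le_one (by positivity)).2 hq.le
  · have e : ∀ i, dder (basisVec i) (dder (basisVec i)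
        (fun p : Space d × ℝ => b (((n : ℝ) + 1)⁻¹ • p))) p
        = ((n : ℝ) + 1)⁻¹ * (((n : ℝ) + 1)⁻¹ *
          dder (basisVec i) (dder (basisVec i) b) (((n : ℝ) + 1)⁻¹ • p)) := by
      intro i
      rw [dder_comp_smul hb.smooth, dder_const_mul
        (g := fun p => dder (basisVec i) b (((n : ℝ) + 1)⁻¹ • p)) ((contDiff_dder hb.smooth (basisVec i)).comp (contDiff_const_smul _)),
        dder_comp_smul (contDiff_dder hb.smooth _)]
    have e0 := congrFun (dder_comp_smul hb.smooth (((n : ℝ) + 1)⁻¹) (0, 1)) p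
    simp only [heatOp, e, e0]
    refine (abs_add_le _ _).trans ?_
    have b1 := mulle n _ _ (hC1' (((n : ℝ) + 1)⁻¹ • p))
    have b2 : |ε ^ 2 / 2 * ∑ i, ((n : ℝ) + 1)⁻¹ * (((n : ℝ) + 1)⁻¹ *
        dder (basisVec i) (dder (basisVec i) b) (((n : ℝ) + 1)⁻¹ • p))|
        ≤ ε ^ 2 / 2 * ∑ i, C3 i := by
      rw [abs_mul, abs_of_nonneg (by positivity : 0 ≤ ε ^ 2 / 2)]
      refine mul_le_mul_of_nonneg_left ((Finset.abs_sum_le_sum_abs _ _).trans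
        (Finset.sum_le_sum fun i _ => ?_)) (by positivity)
      exact mulle n _ _ (mulle n _ _ (hC3' i _))
    linarith
  · simp only [dder_comp_smul hb.smooth]
    refine (mulle n _ _ (hC2' i _)).trans ?_
    have := Finset.single_le_sum (f := C2) (fun i _ => hC2 i) (Finset.mem_univ i)
    linarith

/-! ### Uniqueness for the linear equation by duality -/

theorem tsupport_backward_subset (ε A : ℝ) {ψ : Space d × ℝ → ℝ} (hψ : IsBump ψ) {T : ℝ}
    (hs : tsupport ψ ⊆ univ ×ˢ Iio T) : tsupport (backward ε A ψ) ⊆ univ ×ˢ Iio T := by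
  -- Compactness leaves a gap below `T`, which survives taking closures; displacements only move
  -- forward in time.
  obtain ⟨T', hT', hle⟩ : ∃ T' < T, ∀ p ∈ tsupport ψ, p.2 ≤ T' := by
    rcases (tsupport ψ).eq_empty_or_nonempty with h | h
    · exact ⟨T - 1, by linarith, fun p hp => by simp [h] at hp⟩
    · obtain ⟨q, hq, hmax⟩ := hψ.compact.isCompact.exists_isMaxOn h continuous_snd.continuousOn
      exact ⟨q.2, (hs hq).2, fun p hp => hmax hp⟩
  have hcl : tsupport (backward ε A ψ) ⊆ {p | p.2 ≤ T'} := by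
    refine closure_minimal (fun p hp => ?_) (isClosed_le continuous_snd continuous_const)
    by_contra h
    refine hp (integral_eq_zero_of_ae ?_)
    have hae : ∀ᵐ θ ∂(pathMeasure d A), θ.1 ∈ Ioo 0 A :=
      Measure.quasiMeasurePreserving_fst.ae (timeMeasure_ae_mem A)
    filter_upwards [hae] with θ hθ
    refine image_eq_zero_of_notMem_tsupport fun h2 => h ?_
    have := hle _ h2
    simp only [displacement, Prod.snd_add] at this
    simp only [mem_ofPred_eq]
    linarith [hθ.1]
  exact fun p hp => ⟨mem_univ _, (hcl hp).trans_lt hT'⟩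

/-- For arbitrary ψ the function `backward ε T ψ` solves the backward equation with source -ψ on (0,
T). It need not have compact support, so it is tested through cut-offs, with dominated convergence
from the integrability of it and its derivatives. -/
theorem ae_eq_zero_of_integral_heatOp {ε T : ℝ} (hT : 0 < T) {w : Space d × ℝ → ℝ}
    (hw : AEStronglyMeasurable w (spaceTimeMeasure d T)) {A : ℝ}
    (hA : ∀ᵐ p ∂(spaceTimeMeasure d T), |w p| ≤ A)
    (h : ∀ φ, IsTestFunction d T φ → ∫ p, w p * heatOp ε φ p ∂(spaceTimeMeasure d T) = 0) :
    ∀ᵐ p ∂(spaceTimeMeasure d T), w p = 0 := by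
  have key : ∀ ψ : Space d × ℝ → ℝ, IsBump ψ → tsupport ψ ⊆ univ ×ˢ Iio T →
      ∫ p, w p * ψ p ∂(spaceTimeMeasure d T) = 0 := by
    intro ψ hψ hs
    set φ := backward ε T ψ with hφd
    have hφ : ContDiff ℝ ∞ φ := contDiff_backward ε T hψ
    have hφs := tsupport_backward_subset ε T hψ hs
    obtain ⟨χ, C, hC0, hχ, hlim, b0, b1, b2⟩ := exists_cutoff d ε
    have htest : ∀ n, IsTestFunction d T fun p => χ n p * φ p := fun n =>
      ⟨(hχ n).smooth.mul hφ, (hχ n).compact.mul_right,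
        (closure_mono fun p hp => right_ne_zero_of_mul hp).trans hφs⟩
    have res : ∀ {g : Space d × ℝ → ℝ}, Integrable g → Integrable g (spaceTimeMeasure d T) := by
      intro g hg
      rw [spaceTimeMeasure_eq]; exact hg.restrict
    have i0 : Integrable φ := integrable_backward ε T hψ
    have i1 : Integrable (heatOp ε φ) := by
      rw [heatOp_backward ε T hψ]; exact integrable_backward ε T (hψ.heatOp ε)
    have i2 : ∀ i, Integrable (dder (basisVec i) φ) := by
      intro i
      rw [dder_backward ε T hψ]; exact integrable_backward ε T (hψ.dder _)
    have hdom : Tendsto (fun n => ∫ p, w p * heatOp ε (fun p => χ n p * φ p) p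
        ∂(spaceTimeMeasure d T)) atTop
        (𝓝 (∫ p, w p * heatOp ε φ p ∂(spaceTimeMeasure d T))) := by
      refine tendsto_integral_of_dominated_convergence
        (fun p => A * (C * |heatOp ε φ p| + |φ p| * C
          + ε ^ 2 * ∑ i, C * |dder (basisVec i) φ p|))
        (fun n => hw.mul (contDiff_heatOp (htest n).smooth ε).continuous.aestronglyMeasurable)
        (((((res i1).abs.const_mul C).add ((res i0).abs.mul_const C)).add
          ((integrable_finsetSum _ fun i _ => (res (i2 i)).abs.const_mul C).const_mul _)).const_mul
            A) (fun n => ?_) (.of_forall fun p => ?_)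
      · filter_upwards [hA] with p hp
        rw [heatOp_mul hφ (hχ n).smooth, norm_mul, Real.norm_eq_abs, Real.norm_eq_abs]
        refine mul_le_mul hp ((abs_add_three _ _ _).trans ?_) (abs_nonneg _)
          ((abs_nonneg _).trans hp)
        simp only [abs_mul, abs_of_nonneg (sq_nonneg ε)]
        gcongr
        · exact b0 n p
        · exact b1 n p
        · refine (Finset.abs_sum_le_sum_abs _ _).trans (Finset.sum_le_sum fun i _ => ?_)
          rw [abs_mul]
          gcongr
          exact b2 n p i
      · refine tendsto_const_nhds.congr' ?_
        filter_upwards [hlim p] with n hn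
        rw [heatOp_congr (φ := fun p => χ n p * φ p) (ψ := φ)]
        filter_upwards [hn] with q hq
        rw [hq, one_mul]
    simp only [h _ (htest _)] at hdom
    have e := tendsto_nhds_unique hdom tendsto_const_nhds
    have e2 : ∫ p, w p * heatOp ε φ p ∂(spaceTimeMeasure d T)
        = ∫ p, -(w p * ψ p) ∂(spaceTimeMeasure d T) := by
      refine integral_congr_ae ?_
      filter_upwards [spaceTimeMeasure_ae_mem d T] with p hp
      rw [heatOp_backward ε T hψ, backward_heatOp ε hT.le hψ,
        pathMean_eq_zero hs (by linarith [hp.1])]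
      ring
    rw [e2, integral_neg] at e
    linarith
  have hU : IsOpen (univ ×ˢ Ioo 0 T : Set (Space d × ℝ)) := isOpen_univ.prod isOpen_Ioo
  have hloc : LocallyIntegrable w (spaceTimeMeasure d T) := by
    have : IsLocallyFiniteMeasure (spaceTimeMeasure d T) := by
      rw [spaceTimeMeasure_eq]; infer_instance
    refine (locallyIntegrable_const A).mono hw ?_
    filter_upwards [hA] with p hp
    exact hp.trans (le_abs_self A)
  have h2 := hU.ae_eq_zero_of_integral_contDiff_smul_eq_zero (μ := spaceTimeMeasure d T)
    (hloc.locallyIntegrableOn _) fun g hg hgc hgs => by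
      have := key g ⟨hg, hgc⟩ (hgs.trans (prod_mono_right Ioo_subset_Iio_self))
      simpa [mul_comm] using this
  filter_upwards [h2, spaceTimeMeasure_ae_mem d T] with p hp hp2
  exact hp ⟨mem_univ _, hp2⟩

/-- With the flux frozen as `F` the equation is linear, and the mild solution with the same flux and
datum satisfies the same weak identity. The difference is then orthogonal to every `heatOp ε φ`. -/
theorem IsWeakSolution.ae_eq_mild {ε T : ℝ} (hε : 0 < ε) (hT : 0 < T) {u : Space d → ℝ}
    (hu : StronglyMeasurable u) {A : ℝ} (hA : ∀ x, ‖u x‖ ≤ A) {f : ℝ → Space d}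
    {F : Space d × ℝ → Space d} (hF : StronglyMeasurable F) {B : ℝ} (hB : ∀ p, ‖F p‖ ≤ B)
    {m : Space d × ℝ → ℝ} (hm : IsWeakSolution d T ε f u m)
    (hmF : ∀ᵐ p ∂(spaceTimeMeasure d T), f (m p) = F p) {R : ℝ}
    (hR : ∀ᵐ p ∂(spaceTimeMeasure d T), |m p| ≤ R) :
    ∀ᵐ p ∂(spaceTimeMeasure d T), m p = mild ε u F p := by
  have hB0 : 0 ≤ B := (norm_nonneg _).trans (hB 0)
  have hκ : 0 ≤ gaussMoment d / ε := div_nonneg gaussMoment_nonneg hε.le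
  have hmm := stronglyMeasurable_mild ε hu hF
  have key := ae_eq_zero_of_integral_heatOp (ε := ε) hT (w := fun p => m p - mild ε u F p)
    (hm.memLp.1.sub hmm.aestronglyMeasurable)
    (A := R + (A + gaussMoment d / ε * (2 * √T) * B)) ?_ ?_
  · filter_upwards [key] with p hp using sub_eq_zero.1 hp
  · filter_upwards [hR, spaceTimeMeasure_ae_mem d T] with p h1 h2
    have h3 : |mild ε u F p| ≤ A + gaussMoment d / ε * (2 * √p.2) * B :=
      abs_mild_le hε hA hB h2.1.le p.1
    have h4 : √p.2 ≤ √T := Real.sqrt_le_sqrt h2.2.le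
    refine (abs_sub _ _).trans (add_le_add h1 (h3.trans ?_))
    gcongr
  · intro φ hφ
    have hb := isTestFunction_isBump hφ
    obtain ⟨i1, e1⟩ := integral_mild_mul_heatOp hε hT hu hA hF hB hb hφ.support
    have i2 := integrable_dder_section (T := T) hF.aestronglyMeasurable (.of_forall hB) hb
    have i3 : Integrable (fun p => m p * heatOp ε φ p) (spaceTimeMeasure d T) := by
      refine Integrable.bdd_mul (c := R) ?_ hm.memLp.1 hR
      rw [spaceTimeMeasure_eq]
      exact (hb.heatOp ε).integrable.restrict
    have e2 := hm.weak φ hφ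
    simp only [weak_integrand_eq hφ.smooth] at e2
    have e3 : ∫ p, (m p * heatOp ε φ p + dder (f (m p), 0) φ p) ∂(spaceTimeMeasure d T)
        = ∫ p, (m p * heatOp ε φ p + dder (F p, 0) φ p) ∂(spaceTimeMeasure d T) := by
      refine integral_congr_ae ?_
      filter_upwards [hmF] with p h1
      rw [h1]
    rw [e3, integral_add i3 i2] at e2
    simp only [sub_mul]
    rw [integral_sub i3 i1, e1]
    linarith

/-- Smooth functions with compact support in `(0, T)` are dense in `L^p((0, T); E)`. -/
theorem exists_contDiff_eLpNorm_sub_le {E : Type*} [NormedAddCommGroup E] [NormedSpace ℝ E]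
    {p : ℝ≥0∞} (hp : p ≠ ⊤) {T : ℝ} {f : ℝ → E} (hf : MemLp f p (timeMeasure T)) {δ : ℝ≥0∞}
    (hδ : δ ≠ 0) :
    ∃ g : ℝ → E, eLpNorm (f - g) p (timeMeasure T) ≤ δ ∧
      ContDiff ℝ ∞ g ∧ HasCompactSupport g ∧ tsupport g ⊆ Ioo 0 T := by
  refine hf.induction_dense hp _ ?_ ?_ ?_ hδ
  · intro c t ht _ δ hδ
    obtain ⟨η, ηpos, hη⟩ := exists_eLpNorm_indicator_le (μ := timeMeasure T) hp c hδ
    have hη2 : (η / 2 : ℝ≥0∞) ≠ 0 := by simpa using ηpos.ne'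
    have hI : MeasurableSet (t ∩ Ioo 0 T) := ht.inter measurableSet_Ioo
    obtain ⟨s, st, -, s_closed, μs⟩ := hI.exists_isCompact_isClosed_sdiff_lt
      (μ := timeMeasure T) (measure_ne_top _ _) hη2
    obtain ⟨V, sV, V_open, -, hV⟩ := s_closed.measurableSet.exists_isOpen_sdiff_lt
      (μ := timeMeasure T) (measure_ne_top _ _) hη2
    have v_open : IsOpen (V ∩ Ioo 0 T) := V_open.inter isOpen_Ioo
    obtain ⟨χ, χ0, χ1, χr⟩ := exists_contMDiffMap_zero_one_nhds_of_isClosed (n := ⊤)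
      (modelWithCornersSelf ℝ ℝ) v_open.isClosed_compl s_closed
      (disjoint_compl_left_iff_subset.2 (subset_inter sV (st.trans inter_subset_right)))
    have hχ : ContDiff ℝ ∞ (χ : ℝ → ℝ) := χ.contMDiff.contDiff
    have hsupp : tsupport (fun x => χ x • c) ⊆ V ∩ Ioo 0 T := by
      intro x hx
      by_contra hxv
      have h0 := eventually_nhdsSet_iff_forall.1 χ0 x hxv
      refine notMem_tsupport_iff_eventuallyEq.2 ?_ hx
      filter_upwards [h0] with y hy
      simp [hy]
    refine ⟨fun x => χ x • c, ?_, hχ.smul contDiff_const, ?_, hsupp.trans inter_subset_right⟩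
    -- The smooth cut-off and the indicator agree on `s` and off `(V ∩ Ioo 0 T) ∪ t`; elsewhere they
    -- differ by at most ‖c‖ in norm.
    · refine (eLpNorm_mono fun x => ?_).trans (hη (((V ∩ Ioo 0 T) ∪ t) \ s) ?_)
      · have hn : ‖χ x • c‖ ≤ ‖c‖ := by
          rw [norm_smul, Real.norm_of_nonneg (χr x).1]
          exact mul_le_of_le_one_left (norm_nonneg _) (χr x).2
        have hn' : ‖χ x • c - c‖ ≤ ‖c‖ := by
          have e : χ x • c - c = (χ x - 1) • c := by rw [sub_smul, one_smul]
          rw [e, norm_smul, Real.norm_eq_abs, abs_sub_comm, abs_of_nonneg (by linarith [(χr x).2])]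
          exact mul_le_of_le_one_left (norm_nonneg _) (by linarith [(χr x).1])
        by_cases hs : x ∈ s
        · simp [(st hs).1, χ1.self_of_nhdsSet x hs]
        · by_cases ht : x ∈ t
          · simpa [ht, hs] using hn'
          · by_cases hv : x ∈ V ∩ Ioo 0 T
            · simpa [ht, hs, hv.1, hv.2.1, hv.2.2] using hn
            · simp [ht, χ0.self_of_nhdsSet x hv]
      · have h1 : (timeMeasure T) (t \ s) ≤ η / 2 := by
          have e : (timeMeasure T) (t \ s) = (timeMeasure T) ((t ∩ Ioo 0 T) \ s) := by
            refine measure_congr ?_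
            filter_upwards [ae_restrict_mem measurableSet_Ioo] with x hx
            refine propext ⟨fun h => ⟨⟨h.1, hx⟩, h.2⟩, fun h => ⟨h.1.1, h.2⟩⟩
          rw [e]; exact μs.le
        rw [union_sdiff_distrib]
        refine (measure_union_le _ _).trans ?_
        rw [← ENNReal.add_halves (η : ℝ≥0∞)]
        exact add_le_add ((measure_mono (sdiff_subset_sdiff_left inter_subset_left)).trans hV.le) h1
    · exact isCompact_Icc.of_isClosed_subset (isClosed_tsupport _)
        ((hsupp.trans inter_subset_right).trans Ioo_subset_Icc_self)
  · rintro f g ⟨f1, f2, f3⟩ ⟨g1, g2, g3⟩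
    exact ⟨f1.add g1, f2.add g2, (tsupport_add _ _).trans (union_subset f3 g3)⟩
  · rintro f ⟨h, -, -⟩
    exact h.continuous.aestronglyMeasurable

/-! ### Hölder regularity and continuity in time -/

namespace Holder

variable {β : ℝ≥0}

theorem holderWith_of_abs_sub_le {g : Space d → ℝ} {H : ℝ} (hH : 0 ≤ H)
    (h : ∀ x y, |g x - g y| ≤ H * ‖x - y‖ ^ (β : ℝ)) : HolderWith H.toNNReal β g := by
  intro x y
  rw [edist_dist, edist_dist, ENNReal.ofReal_rpow_of_nonneg dist_nonneg β.coe_nonneg,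
    ← ENNReal.ofReal, ← ENNReal.ofReal_mul hH, Real.dist_eq, dist_eq_norm]
  exact ENNReal.ofReal_le_ofReal (h x y)

theorem norm_le (g : Holder d β) {S H : ℝ} (hS : 0 ≤ S) (hH : 0 ≤ H) (h1 : ∀ x, |g x| ≤ S)
    (h2 : ∀ x y, |g x - g y| ≤ H * ‖x - y‖ ^ (β : ℝ)) : ‖g‖ ≤ S + H := by
  rw [norm_def]
  have h3 : HolderWith H.toNNReal β g.toBCF := holderWith_of_abs_sub_le hH h2
  have h4 : (nnHolderNorm β g.toBCF : ℝ) ≤ H := by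
    have := NNReal.coe_le_coe.2 h3.nnholderNorm_le
    rwa [Real.coe_toNNReal _ hH] at this
  exact add_le_add ((BoundedContinuousFunction.norm_le hS).2 h1) h4

theorem exists_of_bound (hβ : 0 < β) {g : Space d → ℝ} {S H : ℝ} (hH : 0 ≤ H)
    (h1 : ∀ x, |g x| ≤ S) (h2 : ∀ x y, |g x - g y| ≤ H * ‖x - y‖ ^ (β : ℝ)) :
    ∃ G : Holder d β, ∀ x, G x = g x := by
  have h3 : HolderWith H.toNNReal β g := holderWith_of_abs_sub_le hH h2
  exact ⟨⟨BoundedContinuousFunction.ofNormedAddCommGroup g (h3.continuous hβ) S h1, ⟨_, h3⟩⟩,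
    fun x => rfl⟩

theorem sub_apply (g h : Holder d β) (x : Space d) : (g - h) x = g x - h x := by
  rw [sub_eq_add_neg, sub_eq_add_neg]
  rfl

end Holder

/-- Interpolation of Hölder seminorms. -/
theorem abs_le_interpolate {a η H r β γ : ℝ} (hβ : 0 < β) (hγ : β < γ) (hH : 0 ≤ H) (hr : 0 ≤ r)
    (h1 : |a| ≤ η) (h2 : |a| ≤ H * r ^ γ) :
    |a| ≤ η ^ (1 - β / γ) * H ^ (β / γ) * r ^ β := by
  have hγ0 : 0 < γ := hβ.trans hγ
  have hθ : 0 < β / γ := div_pos hβ hγ0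
  have hθ1 : β / γ < 1 := (div_lt_one hγ0).2 hγ
  have e : |a| = |a| ^ (1 - β / γ) * |a| ^ (β / γ) := by
    rw [← Real.rpow_add_of_nonneg (abs_nonneg a) (by linarith) hθ.le, sub_add_cancel,
      Real.rpow_one]
  have e2 : (H * r ^ γ) ^ (β / γ) = H ^ (β / γ) * r ^ β := by
    rw [Real.mul_rpow hH (by positivity), ← Real.rpow_mul hr, mul_div_cancel₀ _ hγ0.ne']
  rw [e, mul_assoc, ← e2]
  exact mul_le_mul (Real.rpow_le_rpow (abs_nonneg _) h1 (by linarith))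
    (Real.rpow_le_rpow (abs_nonneg _) h2 hθ.le) (by positivity)
    (Real.rpow_nonneg ((abs_nonneg _).trans h1) _)

theorem memLp_rpow_timeMeasure {q a : ℝ} (hq : 0 < q) (h : -1 < a * q) (T : ℝ) :
    MemLp (fun t : ℝ => t ^ a) (ENNReal.ofReal q) (timeMeasure T) := by
  have hm : Measurable fun t : ℝ => t ^ a := by fun_prop
  rw [← integrable_norm_rpow_iff hm.aestronglyMeasurable (by simpa using hq) ENNReal.ofReal_ne_top,
    ENNReal.toReal_ofReal hq.le]
  rcases le_or_gt T 0 with hT | hT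
  · simp [timeMeasure, Ioo_eq_empty hT.not_gt]
  refine IntegrableOn.congr_fun (integrableOn_rpow_Ioo h hT.le) (fun t ht => ?_) measurableSet_Ioo
  rw [Real.norm_of_nonneg (Real.rpow_nonneg ht.1.le _), ← Real.rpow_mul ht.1.le]

/-- The norm is dominated by A + C t^(-β/2), in L^q because βq < 2. Strong measurability in this
Hölder space is obtained from continuity in time. -/
theorem memLqHolder_of_bounds {T q : ℝ} {β : ℝ≥0} (hq : 1 ≤ q) (hβ : 0 < β)
    (hβq : (β : ℝ) < min 1 (2 / q)) {v : Space d × ℝ → ℝ} {A : ℝ} (hA0 : 0 ≤ A)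
    (hA : ∀ x, ∀ t ∈ Ioo 0 T, |v (x, t)| ≤ A)
    (hH : ∀ γ : ℝ, 0 ≤ γ → γ < 1 → ∃ C : ℝ, 0 ≤ C ∧ ∀ t ∈ Ioo 0 T, ∀ x y,
      |v (x, t) - v (y, t)| ≤ C * t ^ (-(γ / 2)) * ‖x - y‖ ^ γ)
    (hc : ∀ t₀ ∈ Ioo 0 T, ∀ η : ℝ, 0 < η → ∀ᶠ t in 𝓝 t₀, ∀ x, |v (x, t) - v (x, t₀)| ≤ η) :
    MemLqHolder d T q β v := by
  have hβ1 : (β : ℝ) < 1 := hβq.trans_le (min_le_left _ _)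
  have hβ0 : 0 < (β : ℝ) := hβ
  have hq0 : 0 < q := by linarith
  have hβ2 : (β : ℝ) * q < 2 := (lt_div_iff₀ hq0).1 (hβq.trans_le (min_le_right _ _))
  obtain ⟨C, hC, hCH⟩ := hH β hβ0.le hβ1
  have hex : ∀ t ∈ Ioo 0 T, ∃ G : Holder d β, ∀ x, G x = v (x, t) := fun t ht =>
    Holder.exists_of_bound hβ (mul_nonneg hC (Real.rpow_nonneg ht.1.le _)) (fun x => hA x t ht)
      (hCH t ht)
  choose! M hM using hex
  have hMn : ∀ t ∈ Ioo 0 T, ‖M t‖ ≤ A + C * t ^ (-((β : ℝ) / 2)) := fun t ht =>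
    (M t).norm_le hA0 (mul_nonneg hC (Real.rpow_nonneg ht.1.le _))
      (fun x => by rw [hM t ht]; exact hA x t ht)
      (fun x y => by rw [hM t ht, hM t ht]; exact hCH t ht x y)
  have hcont : ContinuousOn M (Ioo 0 T) := by
    intro t₀ ht₀
    refine ContinuousAt.continuousWithinAt ?_
    -- An exponent strictly between β and 1: sup-norm smallness interpolates with a bounded
    -- γ-seminorm to give smallness of the β-seminorm.
    set γ : ℝ := (β + 1) / 2 with hγ
    obtain ⟨D, hD, hDH⟩ := hH γ (by positivity) (by linarith)
    have hγβ : (β : ℝ) < γ := by linarith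
    set H : ℝ := 2 * (D * (t₀ / 2) ^ (-(γ / 2))) with hHdef
    have ht2 : 0 < t₀ / 2 := by linarith [ht₀.1]
    have hH0 : 0 ≤ H := by positivity
    have hθ : 0 < 1 - (β : ℝ) / γ := by
      have : (β : ℝ) / γ < 1 := (div_lt_one (hβ0.trans hγβ)).2 hγβ
      linarith
    have hlim : Tendsto (fun η : ℝ => η + (2 * η) ^ (1 - (β : ℝ) / γ) * H ^ ((β : ℝ) / γ))
        (𝓝[>] 0) (𝓝 0) := by
      have h1 : ContinuousAt
          (fun η : ℝ => η + (2 * η) ^ (1 - (β : ℝ) / γ) * H ^ ((β : ℝ) / γ)) 0 := by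
        refine continuousAt_id.add (ContinuousAt.mul ?_ continuousAt_const)
        exact (continuousAt_const.mul continuousAt_id).rpow_const (Or.inr hθ.le)
      have h2 := h1.tendsto
      simp only [mul_zero, Real.zero_rpow hθ.ne', zero_mul, add_zero] at h2
      exact h2.mono_left nhdsWithin_le_nhds
    rw [ContinuousAt, tendsto_iff_norm_sub_tendsto_zero, Metric.tendsto_nhds]
    intro e he
    obtain ⟨η, hη1, hη2⟩ := ((hlim.eventually_lt_const he).and self_mem_nhdsWithin).exists
    have hη0 : (0 : ℝ) < η := hη2
    filter_upwards [hc t₀ ht₀ η hη0, Ioo_mem_nhds ht₀.1 ht₀.2,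
      Ioi_mem_nhds (by linarith [ht₀.1] : t₀ / 2 < t₀)] with t h1 h2 h3
    rw [dist_zero_right, norm_norm]
    have hb : ∀ s ∈ Ioo 0 T, t₀ / 2 ≤ s → ∀ x y,
        |v (x, s) - v (y, s)| ≤ D * (t₀ / 2) ^ (-(γ / 2)) * ‖x - y‖ ^ γ := fun s hs hs2 x y =>
      (hDH s hs x y).trans (by
        have := Real.rpow_le_rpow_of_nonpos ht2 hs2 (by linarith : -(γ / 2) ≤ 0)
        gcongr)
    refine ((M t - M t₀).norm_le hη0.le (by positivity) (fun x => ?_) (fun x y => ?_)).trans_lt hη1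
    · rw [Holder.sub_apply, hM t h2, hM t₀ ht₀]
      exact h1 x
    · rw [Holder.sub_apply, Holder.sub_apply, hM t h2, hM t₀ ht₀, hM t h2, hM t₀ ht₀]
      refine abs_le_interpolate hβ0 hγβ hH0 (norm_nonneg _) ?_ ?_
      · refine (abs_sub _ _).trans ?_
        linarith [h1 x, h1 y]
      · have e1 := hb t h2 (le_of_lt h3) x y
        have e2 := hb t₀ ht₀ (by linarith) x y
        have e3 : v (x, t) - v (x, t₀) - (v (y, t) - v (y, t₀))
            = (v (x, t) - v (y, t)) - (v (x, t₀) - v (y, t₀)) := by ring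
        rw [e3]
        refine (abs_sub _ _).trans ?_
        rw [hHdef]
        linarith
  have hLp : MemLp M (ENNReal.ofReal q) (timeMeasure T) := by
    have hg : MemLp (fun t : ℝ => A + C * t ^ (-((β : ℝ) / 2))) (ENNReal.ofReal q)
        (timeMeasure T) :=
      (memLp_const A).add ((memLp_rpow_timeMeasure hq0 (by linarith) T).const_mul C)
    refine hg.of_le (hcont.aestronglyMeasurable measurableSet_Ioo) ?_
    filter_upwards [ae_restrict_mem measurableSet_Ioo] with t ht
    exact (hMn t ht).trans (le_abs_self _)
  refine ⟨M, ?_, hLp, fun δ hδ => ?_⟩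
  · filter_upwards [ae_restrict_mem measurableSet_Ioo] with t ht
    exact .of_forall fun x => (hM t ht x).symm
  · obtain ⟨g, h1, h2, h3, h4⟩ := exists_contDiff_eLpNorm_sub_le ENNReal.ofReal_ne_top hLp
      (δ := ENNReal.ofReal δ) (by simpa using hδ)
    exact ⟨g, h2, h3, h4, h1⟩

/-- Restarting at the earlier of the two times, the heat flow moves a 1/2-Hölder function little and
the new Duhamel part is O(√(t - s)). The Hölder constant is uniform on [t₀/2, 2t₀]. -/
theorem eventually_abs_mild_sub_le {ε : ℝ} (hε : 0 < ε) {u : Space d → ℝ}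
    (hu : StronglyMeasurable u) {A B : ℝ} (hA : ∀ x, ‖u x‖ ≤ A) {F : Space d × ℝ → Space d}
    (hF : StronglyMeasurable F) (hB : ∀ p, ‖F p‖ ≤ B) {t₀ : ℝ} (ht₀ : 0 < t₀) {η : ℝ}
    (hη : 0 < η) : ∀ᶠ t in 𝓝 t₀, ∀ x, |mild ε u F (x, t) - mild ε u F (x, t₀)| ≤ η := by
  obtain ⟨K, hK, h⟩ := exists_abs_mild_sub_le d hε (β := 1 / 2) (by norm_num) (by norm_num)
  have hA0 : 0 ≤ A := (norm_nonneg _).trans (hA 0)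
  have hB0 : 0 ≤ B := (norm_nonneg _).trans (hB 0)
  have ht2 : 0 < t₀ / 2 := by linarith
  set H : ℝ := K * (A * (t₀ / 2) ^ (-((1 / 2 : ℝ) / 2)) + B * (2 * t₀) ^ ((1 - 1 / 2 : ℝ) / 2))
    with hH
  have hH0 : 0 ≤ H := by positivity
  have hHs : ∀ s, t₀ / 2 ≤ s → s ≤ 2 * t₀ → ∀ x y,
      ‖mild ε u F (x, s) - mild ε u F (y, s)‖ ≤ H * ‖x - y‖ ^ (1 / 2 : ℝ) := by
    intro s hs1 hs2 x y
    refine (h u hu F hF A B hA hB s (by linarith) x y).trans ?_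
    have e1 := Real.rpow_le_rpow_of_nonpos ht2 hs1 (by norm_num : -((1 / 2 : ℝ) / 2) ≤ 0)
    have e2 := Real.rpow_le_rpow (by linarith) hs2 (by norm_num : 0 ≤ (1 - 1 / 2 : ℝ) / 2)
    rw [hH]
    gcongr
  set w : ℝ → ℝ := fun σ => H * (ε * √σ) ^ (1 / 2 : ℝ) * (1 + gaussMoment d)
    + gaussMoment d / ε * (2 * √σ) * B with hw
  have key : ∀ s t, t₀ / 2 ≤ s → s ≤ 2 * t₀ → s < t → ∀ x,
      |mild ε u F (x, t) - mild ε u F (x, s)| ≤ w (t - s) := by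
    intro s t hs1 hs2 hst x
    have hs0 : 0 ≤ s := by linarith
    rw [mild_restart hε hu hA hF hB x hs0 hst, add_sub_right_comm]
    refine (abs_add_le _ _).trans (add_le_add ?_ ?_)
    · exact norm_heat_sub_self_le hε (t - s)
        ((stronglyMeasurable_mild ε hu hF).comp_measurable (by fun_prop))
        (fun y => abs_mild_le hε hA hB hs0 y) hH0 (by norm_num) (by norm_num)
        (hHs s hs1 hs2) x
    · exact abs_setIntegral_flux_le hε hB x hst.le
  have hlim : Tendsto (fun t => w |t - t₀|) (𝓝 t₀) (𝓝 0) := by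
    have hcw : Continuous fun t => w |t - t₀| := by
      refine Continuous.add (Continuous.mul (continuous_const.mul
        (Continuous.rpow_const (by fun_prop) fun _ => Or.inr (by norm_num))) continuous_const) ?_
      fun_prop
    have := hcw.tendsto t₀
    simpa [hw] using this
  filter_upwards [hlim.eventually_lt_const hη, Ioi_mem_nhds (by linarith : t₀ / 2 < t₀),
    Iio_mem_nhds (by linarith : t₀ < 2 * t₀)] with t h1 h2 h3 x
  refine le_trans ?_ h1.le
  rcases lt_trichotomy t t₀ with h4 | h4 | h4
  · rw [abs_sub_comm, abs_sub_comm t, abs_of_pos (sub_pos.2 h4)]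
    exact key t t₀ (le_of_lt h2) (le_of_lt h3) h4 x
  · simp [h4, hw]
  · rw [abs_of_pos (sub_pos.2 h4)]
    exact key t₀ t (by linarith) (by linarith) h4 x

theorem memLqHolder_of_eq_mild {T ε q : ℝ} {β : ℝ≥0} (hε : 0 < ε) (hq : 1 ≤ q) (hβ : 0 < β)
    (hβq : (β : ℝ) < min 1 (2 / q)) {u : Space d → ℝ} (hu : StronglyMeasurable u) {A B : ℝ}
    (hA : ∀ x, ‖u x‖ ≤ A) {F : Space d × ℝ → Space d} (hF : StronglyMeasurable F)
    (hB : ∀ p, ‖F p‖ ≤ B) {m : Space d × ℝ → ℝ}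
    (hm : ∀ x, ∀ t ∈ Ioo 0 T, m (x, t) = mild ε u F (x, t)) : MemLqHolder d T q β m := by
  have hA0 : 0 ≤ A := (norm_nonneg _).trans (hA 0)
  have hB0 : 0 ≤ B := (norm_nonneg _).trans (hB 0)
  have hκ : 0 ≤ gaussMoment d / ε := div_nonneg gaussMoment_nonneg hε.le
  refine memLqHolder_of_bounds hq hβ hβq (A := A + gaussMoment d / ε * (2 * √T) * B)
    (by positivity) (fun x t ht => ?_) (fun γ h0 h1 => ?_) (fun t₀ ht₀ η hη => ?_)
  · rw [hm x t ht]
    refine (abs_mild_le hε hA hB ht.1.le x).trans ?_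
    have := Real.sqrt_le_sqrt ht.2.le
    gcongr
  · obtain ⟨K, hK, h⟩ := exists_abs_mild_sub_le d hε h0 h1
    rcases le_or_gt T 0 with hT | hT
    · exact ⟨0, le_rfl, fun t ht => absurd (ht.1.trans ht.2) hT.not_gt⟩
    refine ⟨K * (A + B * T ^ (1 / 2 : ℝ)), by positivity, fun t ht x y => ?_⟩
    have ht0 : 0 < t := ht.1
    rw [hm x t ht, hm y t ht]
    refine (h u hu F hF A B hA hB t ht.1 x y).trans ?_
    -- The Duhamel contribution is less singular, so it fits under t^(-γ/2) at the cost of √T.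
    have e1 : t ^ ((1 - γ) / 2) = t ^ (1 / 2 : ℝ) * t ^ (-(γ / 2)) := by
      rw [← Real.rpow_add ht.1]
      ring_nf
    have e2 : t ^ (1 / 2 : ℝ) ≤ T ^ (1 / 2 : ℝ) :=
      Real.rpow_le_rpow ht.1.le ht.2.le (by norm_num)
    have e3 : 0 ≤ t ^ (-(γ / 2)) := Real.rpow_nonneg ht.1.le _
    rw [e1]
    refine mul_le_mul_of_nonneg_right ?_ (by positivity)
    calc K * (A * t ^ (-(γ / 2)) + B * (t ^ (1 / 2 : ℝ) * t ^ (-(γ / 2))))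
        = K * (A + B * t ^ (1 / 2 : ℝ)) * t ^ (-(γ / 2)) := by ring
      _ ≤ K * (A + B * T ^ (1 / 2 : ℝ)) * t ^ (-(γ / 2)) := by gcongr
  · filter_upwards [eventually_abs_mild_sub_le hε hu hA hF hB ht₀.1 hη,
      Ioo_mem_nhds ht₀.1 ht₀.2] with t h1 h2 x
    rw [hm x t h2, hm x t₀ ht₀]
    exact h1 x

/-- The truncation of a real number to `[-R, R]`. -/
def clamp (R a : ℝ) : ℝ := max (-R) (min R a)

theorem abs_clamp_le {R : ℝ} (hR : 0 ≤ R) (a : ℝ) : |clamp R a| ≤ R :=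
  abs_le.2 ⟨le_max_left _ _, max_le (by linarith) (min_le_left _ _)⟩

theorem clamp_of_abs_le {R a : ℝ} (h : |a| ≤ R) : clamp R a = a := by
  obtain ⟨h1, h2⟩ := abs_le.1 h
  rw [clamp, min_eq_right h2, max_eq_right h1]

theorem continuous_clamp (R : ℝ) : Continuous (clamp R) := by
  unfold clamp; fun_prop

theorem abs_clamp_sub_le (R a b : ℝ) : |clamp R a - clamp R b| ≤ |a - b| := by
  have h : LipschitzWith 1 (clamp R) := (LipschitzWith.id.const_min R).const_max (-R)
  simpa [Real.dist_eq] using h.dist_le_mul a b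

theorem exists_boundedLipschitz_clamp {f : ℝ → Space d} (hf : ContDiff ℝ 1 f) {R : ℝ}
    (hR : 0 ≤ R) : ∃ B L, BoundedLipschitz (fun a => f (clamp R a)) B L := by
  obtain ⟨B, hB⟩ := (isCompact_Icc (a := -R) (b := R)).exists_bound_of_continuousOn
    hf.continuous.continuousOn
  obtain ⟨L, hL⟩ := hf.contDiffOn.exists_lipschitzOnWith one_ne_zero (convex_Icc (-R) R)
    isCompact_Icc
  have hmem : ∀ a, clamp R a ∈ Icc (-R) R := fun a => abs_le.1 (abs_clamp_le hR a)
  refine ⟨B, L, fun a => hB _ (hmem a), fun a b => ?_⟩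
  have h := hL.dist_le_mul _ (hmem a) _ (hmem b)
  rw [dist_eq_norm, Real.dist_eq] at h
  exact h.trans (mul_le_mul_of_nonneg_left (abs_clamp_sub_le R a b) L.coe_nonneg)

/-! ### Bounded representatives and uniqueness for the nonlinear equation -/

theorem exists_bounded_stronglyMeasurable_ae_eq {α : Type*} [MeasurableSpace α] {μ : Measure α}
    {g : α → ℝ} (hg : AEStronglyMeasurable g μ) {R : ℝ} (hR : 0 ≤ R) (h : ∀ᵐ x ∂μ, |g x| ≤ R) :
    ∃ u : α → ℝ, StronglyMeasurable u ∧ (∀ x, ‖u x‖ ≤ R) ∧ u =ᵐ[μ] g := by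
  refine ⟨fun x => clamp R (hg.mk g x), (continuous_clamp R).comp_stronglyMeasurable
    hg.stronglyMeasurable_mk, fun x => abs_clamp_le hR _, ?_⟩
  filter_upwards [h, hg.ae_eq_mk] with x h1 h2
  rw [← h2, clamp_of_abs_le h1]

theorem ae_abs_le_eLpNorm_top {α : Type*} [MeasurableSpace α] {μ : Measure α} {g : α → ℝ}
    (hg : MemLp g ⊤ μ) : ∀ᵐ x ∂μ, |g x| ≤ (eLpNorm g ⊤ μ).toReal := by
  have h := hg.2.ne
  rw [eLpNorm_exponent_top] at h ⊢
  filter_upwards [ae_le_eLpNormEssSup (f := g) (μ := μ)] with x hx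
  have := ENNReal.toReal_mono h hx
  rwa [toReal_enorm] at this

theorem IsWeakSolution.congr_initial {T ε : ℝ} {f : ℝ → Space d} {u v : Space d → ℝ}
    {m : Space d × ℝ → ℝ} (h : IsWeakSolution d T ε f u m) (huv : u =ᵐ[volume] v) :
    IsWeakSolution d T ε f v m := by
  refine ⟨h.memLp, fun φ hφ => ?_⟩
  refine Eq.trans ?_ (h.weak φ hφ)
  congr 1
  refine integral_congr_ae ?_
  filter_upwards [huv] with x hx
  rw [← hx]

/-- By Fubini almost every time slice agrees almost everywhere, and the Gaussian average ignores
null sets at positive lag. The conclusion therefore holds at every point. -/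
theorem duhamel_congr_ae {T ε : ℝ} (hε : 0 < ε) {F G : Space d × ℝ → Space d}
    (h : ∀ᵐ p ∂(spaceTimeMeasure d T), F p = G p) (x : Space d) {t : ℝ} (ht : t ≤ T) :
    duhamel ε F (x, t) = duhamel ε G (x, t) := by
  have h1 : ∀ᵐ q ∂((timeMeasure T).prod (volume : Measure (Space d))), F q.swap = G q.swap :=
    Measure.measurePreserving_swap.quasiMeasurePreserving.ae h
  have h2 := (ae_restrict_iff' measurableSet_Ioo).1 (Measure.ae_ae_of_ae_prod h1)
  refine setIntegral_congr_ae measurableSet_Ioo ?_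
  filter_upwards [h2] with s hs hst
  have hc : ε * √(t - s) ≠ 0 := (mul_pos hε (Real.sqrt_pos.2 (sub_pos.2 hst.2))).ne'
  refine integral_congr_ae ?_
  filter_upwards [(quasiMeasurePreserving_sub_smul hc x).ae
    (hs ⟨hst.1, hst.2.trans_le ht⟩)] with ζ hζ
  have hζ' : F (x - (ε * √(t - s)) • ζ, s) = G (x - (ε * √(t - s)) • ζ, s) := hζ
  simp only [hζ']

theorem ae_eq_of_isWeakSolution {T ε : ℝ} (hT : 0 < T) (hε : 0 < ε) {f : ℝ → Space d}
    (hf : ContDiff ℝ 1 f) {u : Space d → ℝ} (hu : StronglyMeasurable u) {R : ℝ}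
    (hR : ∀ x, ‖u x‖ ≤ R) {m m' : Space d × ℝ → ℝ} (hm : StronglyMeasurable m)
    (hmR : ∀ x t, 0 < t → |m (x, t)| ≤ R)
    (hfix : ∀ x t, 0 < t → m (x, t) = mild ε u (fun p => f (clamp R (m p))) (x, t))
    (hm' : IsWeakSolution d T ε f u m') : m' =ᵐ[spaceTimeMeasure d T] m := by
  -- The competitor `m'` is not known to obey the maximum principle. A truncation level above both
  -- bounds is inactive on both solutions, so they solve the same fixed point equation.
  set R' := max R (eLpNorm m' ⊤ (spaceTimeMeasure d T)).toReal with hR'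
  have hR'0 : 0 ≤ R' := le_max_of_le_right ENNReal.toReal_nonneg
  have hb' : ∀ᵐ p ∂(spaceTimeMeasure d T), |m' p| ≤ R' := by
    filter_upwards [ae_abs_le_eLpNorm_top hm'.memLp] with p hp
    exact hp.trans (le_max_right _ _)
  obtain ⟨w, hw, hwR, hwm⟩ := exists_bounded_stronglyMeasurable_ae_eq hm'.memLp.1 hR'0 hb'
  obtain ⟨B, L, hBL⟩ := exists_boundedLipschitz_clamp hf hR'0
  have hF := hBL.stronglyMeasurable_comp hw
  have h1 := hm'.ae_eq_mild hε hT hu hR hF (fun p => hBL.bound (w p))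
    (by
      filter_upwards [hwm, hb'] with p h2 h3
      rw [h2, clamp_of_abs_le h3]) hb'
  set v := mild ε u fun p => f (clamp R' (w p)) with hv
  have hκ : 0 ≤ gaussMoment d / ε := div_nonneg gaussMoment_nonneg hε.le
  obtain ⟨C, hC, h2⟩ := exists_mild_stability hε hBL T
  have h3 := h2 u v m (stronglyMeasurable_mild ε hu hF) hm
    -- The defect is exactly 0 because `v`, `m'` and `w` agree almost everywhere and the Duhamel
    -- integral sees only almost everywhere classes.
    (R + gaussMoment d / ε * (2 * √T) * B + R) 0 le_rfl ?_ ?_ ?_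
  · filter_upwards [h1, spaceTimeMeasure_ae_mem d T] with p h4 h5
    have h6 := h3 p.1 p.2 h5
    rw [mul_zero] at h6
    rw [h4]
    exact sub_eq_zero.1 (abs_nonpos_iff.1 h6)
  · intro x t ht
    refine (abs_sub _ _).trans (add_le_add ?_ (hmR x t ht.1))
    refine (abs_mild_le hε hR (fun p => hBL.bound (w p)) ht.1.le x).trans ?_
    have := Real.sqrt_le_sqrt ht.2.le
    have := hBL.nonneg_bound
    gcongr
  · intro x t ht
    rw [abs_nonpos_iff, sub_eq_zero, hv, mild, mild, add_right_inj]
    refine duhamel_congr_ae hε ?_ x ht.2.le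
    filter_upwards [h1, hwm] with p h4 h5
    rw [h5, h4]
  · intro x t ht
    rw [hfix x t ht.1, mild, mild, add_right_inj]
    refine duhamel_congr_ae hε ?_ x ht.2.le
    filter_upwards [spaceTimeMeasure_ae_mem d T] with p hp
    have h4 := hmR p.1 p.2 hp.1
    rw [clamp_of_abs_le h4, clamp_of_abs_le (h4.trans (le_max_left _ _))]

end ViscousLaw

end

/-! ### Assembly of the theorem -/

theorem mainTheorem5 (d : ℕ) (T ε : ℝ) (hT : 0 < T) (hε : 0 < ε)
    (f : ℝ → ViscousLaw.Space d) (hf : ContDiff ℝ 1 f)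
    (uin : ViscousLaw.Space d → ℝ) (huin : MemLp uin ∞ volume) :
    ∃ m : ViscousLaw.Space d × ℝ → ℝ,
      ViscousLaw.IsWeakSolution d T ε f uin m ∧
      (∀ m' : ViscousLaw.Space d × ℝ → ℝ, ViscousLaw.IsWeakSolution d T ε f uin m' →
        m' =ᵐ[ViscousLaw.spaceTimeMeasure d T] m) ∧
      eLpNorm m ∞ (ViscousLaw.spaceTimeMeasure d T) ≤ eLpNorm uin ∞ volume ∧
      (∀ᵐ t ∂(ViscousLaw.timeMeasure T),
        eLpNorm (fun x => m (x, t)) ∞ volume ≤ eLpNorm uin ∞ volume) ∧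
      ∀ (q : ℝ) (β : ℝ≥0), 1 ≤ q → 0 < β → (β : ℝ) < min 1 (2 / q) →
        ViscousLaw.MemLqHolder d T q β m := by
  open ViscousLaw in
  set R := (eLpNorm uin ⊤ volume).toReal with hR
  have hR0 : 0 ≤ R := ENNReal.toReal_nonneg
  have hRe : ENNReal.ofReal R = eLpNorm uin ⊤ volume := ENNReal.ofReal_toReal huin.2.ne
  -- The mild theory needs a datum bounded at every point; replacing the datum on a null set changes
  -- neither the weak formulation nor its norm.
  obtain ⟨u, hu, huR, huu⟩ :=
    exists_bounded_stronglyMeasurable_ae_eq huin.1 hR0 (ae_abs_le_eLpNorm_top huin)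
  obtain ⟨B, L, hBL⟩ := exists_boundedLipschitz_clamp hf hR0
  obtain ⟨m, hm, hfix⟩ := exists_mild_fixedPoint hε hBL hu huR
  have hmR : ∀ x t, 0 < t → |m (x, t)| ≤ R := fun x t ht =>
    -- This bound makes the truncation at `R` inactive along `m`, so `m` solves the original
    -- equation.
    abs_mild_fixedPoint_le hε hBL hu huR hm hfix x ht
  have hF := hBL.stronglyMeasurable_comp hm
  have hae : ∀ᵐ p ∂(spaceTimeMeasure d T), ‖m p‖ ≤ R := by
    filter_upwards [spaceTimeMeasure_ae_mem d T] with p hp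
    exact hmR p.1 p.2 hp.1
  have hsup : eLpNorm m ⊤ (spaceTimeMeasure d T) ≤ eLpNorm uin ⊤ volume := by
    rw [← hRe, eLpNorm_exponent_top]
    exact eLpNormEssSup_le_of_ae_bound hae
  refine ⟨m, ?_, fun m' hm' => ?_, hsup, ?_, fun q β hq hβ hβq => ?_⟩
  · refine (isWeakSolution_of_eq_mild hε hT hu huR hF (fun p => hBL.bound (m p))
      ⟨hm.aestronglyMeasurable, hsup.trans_lt huin.2⟩ ?_ ?_).congr_initial huu
    · filter_upwards [hae] with p hp
      rw [clamp_of_abs_le hp]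
    · filter_upwards [spaceTimeMeasure_ae_mem d T] with p hp
      exact hfix p.1 p.2 hp.1
  · exact ae_eq_of_isWeakSolution hT hε hf hu huR hm hmR hfix (hm'.congr_initial huu.symm)
  · filter_upwards [timeMeasure_ae_mem T] with t ht
    rw [← hRe, eLpNorm_exponent_top]
    exact eLpNormEssSup_le_of_ae_bound (.of_forall fun x => hmR x t ht.1)
  · exact memLqHolder_of_eq_mild hε hq hβ hβq hu huR hF (fun p => hBL.bound (m p))
      fun x t ht => hfix x t ht.1
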